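/- Let $p$ be a prime. For a subgroup $K$ of a group let $K^k$ denote the subgroup generated by the $k$-th powers of elements of $K$. A finite $p$-group $G$ is powerful if $[G,G]\le G^p$ ($p$ odd), resp. $[G,G]\le G^4$ ($p=2$); a powerful $p$-group $G$ is powerfully nilpotent if there is a chain $1=H_0\le H_1\le\dots\le H_k=G$ with $[H_i,G]\le H_{i-1}^p$ for all $i\geq 1$. For powerfully nilpotent $p$-groups $G,H$, say that $G$ is a direct ancestor of $H$, and $H$ a direct descendant of $G$ (written $H\to G$), if $G$ is non-abelian and $H\cong G/Z(G)^p$. The rank of a powerful $p$-group is its minimal number of generators. A group is split if it is a semidirect product of a cyclic normal subgroup by a cyclic subgroup. Put $[a,b]=a^{-1}b^{-1}ab$ and $$G(n,m,r)=\langle a,b\mid a^{p^n}=b^{p^m}=1,\ [a,b]=a^{p^r}\rangle,\qquad G(n,m,l,r)=\langle a,b\mid a^{p^n}=1,\ b^{p^m}=a^{p^l},\ [a,b]=a^{p^r}\rangle .$$ Let $A(n)=C_{p^n}\times C_{p^n}$ and $B(n)=C_{p^{n+1}}\times C_{p^n}$. **1. The groups.** The non-abelian powerfully nilpotent $p$-groups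 of rank 2 are, up to isomorphism and without repetition within each of the two families, the split groups $G(n,m,r)$ with $n-r\le m$, $2\le r\le n-1$, and the groups $G(n,m,l,r)$ with $2\le r<l\le n-1$, $n-r\le l<m$, which are not split. **2. Direct descendants.** Let the parameters be as in 1. (a) If $m>n-r$, the direct descendant of $G(n,m,r)$ is $G(n-r+1,n-r+1,r)$; (b) if $m=n-r$, it is $G(n-r+1,n-r,r)$. In both cases it is abelian iff $r\ge n-r+1$. (c) If $n-r<l$, the direct descendant of $G(n,m,l,r)$ is $G(n-r+1,n-r+1,r)$, which is abelian iff $r\ge n-r+1$; (d) if $n-r=l$, it is $G(n-r,n-r+1,r)$, which is not abelian. (The symbol $G(\cdot,\cdot,\cdot)$ here denotes the group with the given presentation, also when it is abelian.) Hence the direct descendant of a non-abelian powerfully nilpotent group of rank 2 always is a split group of rank 2, and non-split powerfully nilpotent groups of rank 2, in particular the groups $G(n,m,l,r)$ of 1, have no direct ancestors. **3. Direct ancestors.** An abelian $p$-group of rank 2 has a direct ancestor iff it is isomorphic to $A(n)$ with $n\ge2$ or to $B(n)$ with $n\ge1$. A non-abelian powerfully nilpotent $p$-group of rank 2 has a direct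 ancestor iff it is isomorphic to $G(n,n,r)$ with $n\ge3$, $2\le r\le n-1$, or $G(n+1,n,r)$ with $n\ge2$, $2\le r\le n$, or $G(n,n+1,r)$ with $n\ge3$, $2\le r\le n-1$. For these parameters the direct ancestors are, up to isomorphism, exactly: - of $A(n)$: $G(n+r-1,m,r)$ with $r\ge n$, $m\ge n$, and $G(n+r-1,m,l,r)$ with $r+n-2\ge l>r\ge n$, $m>l$; - of $B(n)$: $G(n+r,n,r)$ with $r\ge n+1$; - of $G(n,n,r)$: $G(n+r-1,m,r)$ with $m\ge n$, and $G(n+r-1,m,l,r)$ with $m>l\ge n$, $l\le r+n-2$; - of $G(n+1,n,r)$: $G(n+r,n,r)$; - of $G(n,n+1,r)$: $G(n+r,m,n,r)$ with $m>n$. **4. Infinite branches.** The powerfully nilpotent $p$-groups of rank 2 that have a direct ancestor which itself has a direct ancestor are exactly $A(\bar n)$, $\bar n\ge2$, and $G(\bar n,\bar n,r)$, $\bar n\ge3$, $2\le r\le\bar n-1$. An infinite branch is an infinite chain $H_0\to H_1\to H_2\to\cdots$ of groups of rank 2 in which $H_0$ has no direct descendant. Up to isomorphism the infinite branches are exactly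 the chains $$A(\bar n)\to G(\bar n+r-1,\bar n+r-1,r)\to\cdots\to G(\bar n+i(r-1),\bar n+i(r-1),r)\to\cdots ,$$ one for each pair $(\bar n,r)$ with $r\ge\bar n\ge2$. More generally, the infinite chains $H_0\to H_1\to\cdots$ of groups of rank 2 with arbitrary $H_0$ are, up to isomorphism, exactly the chains with $H_i=G(\bar n+i(r-1),\bar n+i(r-1),r)$ for $i\ge0$, one for each pair $\bar n,r\ge2$; for such a pair, $H_0=G(\bar n,\bar n,r)$ is isomorphic to $A(\bar n)$ iff $r\ge\bar n$. -/

import Mathlib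

universe u v

/-- `K^k`: the subgroup of `G` generated by the `k`-th powers of the elements of the subgroup `K`. -/
def powSubgroup {G : Type u} [Group G] (K : Subgroup G) (k : ℕ) : Subgroup G :=
  Subgroup.closure {x | ∃ y ∈ K, y ^ k = x}

/-- A finite `p`-group is powerful if `[G,G] ≤ G^p` (`p` odd), resp. `[G,G] ≤ G^4` (`p = 2`). -/
def IsPowerful (p : ℕ) (G : Type u) [Group G] : Prop :=
  commutator G ≤ powSubgroup (⊤ : Subgroup G) (if p = 2 then 4 else p)

/-- A powerfully nilpotent `p`-group: a finite powerful `p`-group with an ascending chain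
`1 = H 0 ≤ H 1 ≤ ⋯ ≤ H k = G` that is powerfully central in `G`. -/
structure IsPowerfullyNilpotent (p : ℕ) (G : Type u) [Group G] : Prop where
  finite : Finite G
  isPGroup : IsPGroup p G
  powerful : IsPowerful p G
  chain : ∃ (k : ℕ) (H : ℕ → Subgroup G), H 0 = ⊥ ∧ H k = ⊤ ∧
    ∀ i < k, H i ≤ H (i + 1) ∧ ⁅H (i + 1), (⊤ : Subgroup G)⁆ ≤ powSubgroup (H i) p

/-- `G` is abelian. -/
def IsAbelian (G : Type u) [Group G] : Prop := ∀ x y : G, x * y = y * x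

/-- `G` has rank `2`: the minimal number of generators is `2`. -/
def HasRankTwo (G : Type u) [Group G] : Prop := ∃ _ : Group.FG G, Group.rank G = 2

/-- `Z(G)^p`. -/
abbrev centerPow (p : ℕ) (G : Type u) [Group G] : Subgroup G :=
  powSubgroup (Subgroup.center G) p

theorem centerPow_le_center (p : ℕ) (G : Type u) [Group G] :
    centerPow p G ≤ Subgroup.center G := by
  refine (Subgroup.closure_le _).2 ?_
  rintro x ⟨y, hy, rfl⟩
  exact Subgroup.pow_mem _ hy p

instance centerPow_normal (p : ℕ) (G : Type u) [Group G] : (centerPow p G).Normal where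
  conj_mem x hx g := by
    have h := Subgroup.mem_center_iff.1 (centerPow_le_center p G hx) g
    rw [h, mul_inv_cancel_right]
    exact hx

/-- `G` is a direct ancestor of `H` (equivalently, `H` is a direct descendant of `G`,
written `H → G`) in the ancestry tree of powerfully nilpotent `p`-groups. -/
structure IsDirectAncestor (p : ℕ) (G : Type u) [Group G] (H : Type v) [Group H] : Prop where
  left : IsPowerfullyNilpotent p G
  right : IsPowerfullyNilpotent p H
  not_abelian : ¬ IsAbelian G
  iso : Nonempty (H ≃* G ⧸ centerPow p G)

/-- `H` has a direct ancestor. -/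
def HasDirectAncestor (p : ℕ) (H : Type u) [Group H] : Prop :=
  ∃ (G : Type u) (_ : Group G), IsDirectAncestor p G H

/-- `G` is split: a semidirect product of a cyclic (normal) subgroup by a cyclic subgroup. -/
def IsSplitMetacyclic (G : Type u) [Group G] : Prop :=
  ∃ a b : G, (Subgroup.zpowers a).Normal ∧
    Subgroup.IsComplement' (Subgroup.zpowers a) (Subgroup.zpowers b)

/-- The relators of `⟨a, b | a^{p^n} = 1, b^{p^m} = 1, [a,b] = a^{p^r}⟩`,
where `[a,b] = a⁻¹ b⁻¹ a b`. -/
def splitRels (p n m r : ℕ) : Set (FreeGroup (Fin 2)) :=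
  let a := FreeGroup.of (0 : Fin 2)
  let b := FreeGroup.of (1 : Fin 2)
  {a ^ p ^ n, b ^ p ^ m, a⁻¹ * b⁻¹ * a * b * (a ^ p ^ r)⁻¹}

/-- `G(n,m,r) = ⟨a, b | a^{p^n} = 1, b^{p^m} = 1, [a,b] = a^{p^r}⟩`. -/
abbrev SplitGroup (p n m r : ℕ) : Type := PresentedGroup (splitRels p n m r)

/-- The relators of `⟨a, b | a^{p^n} = 1, b^{p^m} = a^{p^l}, [a,b] = a^{p^r}⟩`,
where `[a,b] = a⁻¹ b⁻¹ a b`. -/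
def nonsplitRels (p n m l r : ℕ) : Set (FreeGroup (Fin 2)) :=
  let a := FreeGroup.of (0 : Fin 2)
  let b := FreeGroup.of (1 : Fin 2)
  {a ^ p ^ n, b ^ p ^ m * (a ^ p ^ l)⁻¹, a⁻¹ * b⁻¹ * a * b * (a ^ p ^ r)⁻¹}

/-- `G(n,m,l,r) = ⟨a, b | a^{p^n} = 1, b^{p^m} = a^{p^l}, [a,b] = a^{p^r}⟩`. -/
abbrev NonsplitGroup (p n m l r : ℕ) : Type := PresentedGroup (nonsplitRels p n m l r)

/-- Admissible parameters of the split family: `n - r ≤ m`, `2 ≤ r ≤ n - 1`. -/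
def SplitParams (n m r : ℕ) : Prop := n ≤ m + r ∧ 2 ≤ r ∧ r + 1 ≤ n

/-- Admissible parameters of the non-split family: `2 ≤ r < l ≤ n - 1`, `n - r ≤ l < m`. -/
def NonsplitParams (n m l r : ℕ) : Prop :=
  2 ≤ r ∧ r < l ∧ l + 1 ≤ n ∧ n ≤ l + r ∧ l < m

/-- `A(n)`, the direct product of two cyclic groups of order `p^n`. -/
abbrev AbelianA (p n : ℕ) : Type := Multiplicative (ZMod (p ^ n) × ZMod (p ^ n))

/-- `B(n)`, the direct product of cyclic groups of orders `p^(n+1)` and `p^n`. -/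
abbrev AbelianB (p n : ℕ) : Type := Multiplicative (ZMod (p ^ (n + 1)) × ZMod (p ^ n))

/-- An infinite chain `H 0 → H 1 → H 2 → ⋯` of rank-2 groups in the ancestry tree. -/
structure IsInfiniteChain (p : ℕ) (H : ℕ → Type u) [∀ i, Group (H i)] : Prop where
  rank_two : ∀ i, HasRankTwo (H i)
  step : ∀ i, IsDirectAncestor p (H (i + 1)) (H i)

/-- An infinite branch: an infinite chain that starts at a root, that is, at a group that has
no direct descendant. -/
structure IsInfiniteBranch (p : ℕ) (H : ℕ → Type u) [∀ i, Group (H i)] : Prop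
    extends IsInfiniteChain p H where
  root : ∀ (K : Type u) [Group K], ¬ IsDirectAncestor p (H 0) K

/-! Everything is expressed by pairs of generators `a`, `b` with `⟨a⟩` normal of order `p^n`, `b` of
order `p^m` modulo `⟨a⟩`, `b^{p^m} = a^{p^l}` and `[a,b] = a^{p^r}` (`IsMetacyclicPair`). The split
case is `l = n`, the abelian case `n ≤ r`. A group has such a pair iff it is the presented group,
because a central quotient of `ZMod (p^n) ⋊ ℤ` realises the exact orders
(`exists_isMetacyclicPair`).

Classification. Let `G` be powerfully nilpotent with two generators. The first term of the chain
outside `G^p` contains a member of a generating pair, which forces `G' ≤ (G^p)^p`. Modulo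
`[G',G](G')^p` every element of `(G^p)^p` is a `p^2`-th power, so the commutator of the generators
is some `c^{p^s}` with `s ≥ 2`; raising `s` as long as possible gives `c ∉ G^p`, so `c` is part of a
generating pair. An induction on the order lifts this to `G' ≤ ⟨c^{p^s}⟩`
(`commutator_le_zpowers_of_le_sup`). Hence `G` is metacyclic with `r ≥ 2`, and changes of generators
lead to one of the two families. The parameters are recovered from `|G|`, `|G'|`, the exponent of
`G/G'` and the exponent of `G`.

Descendants. Since `r ≥ 2`, the order of `1 + p^r` modulo `p^n` is `p^{n-r}` for every prime. So
`Z(G)` consists of the `b^j a^i` with `p^{n-r}` dividing `i` and `j`, and `G/Z(G)^p` is split with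
orders `p^{min(n-r+1,l)}` and `p^{min(m,n-r+1)}` and the same `r` (`quotient_centerPow`).

Ancestors and chains are then integer arithmetic on this map of parameters. An abelian group has
pairs with every `r ≥ n`, hence ancestors for all these `r`. A group with a grandparent has both
orders equal; along an infinite chain `r` is constant and `n` grows by `r - 1`. -/

open scoped commutatorElement

/-! ### Powers of `1 + p ^ r * u` -/

theorem exists_one_add_pow_eq (x n : ℕ) : ∃ y, (1 + x) ^ n = 1 + n * x + x ^ 2 * y := by
  induction n with
  | zero => exact ⟨0, by simp⟩
  | succ n ih =>
    obtain ⟨y, hy⟩ := ih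
    refine ⟨n + y + x * y, ?_⟩
    rw [pow_succ, hy]
    ring

/-- In the step from `k` to `k + 1` the quadratic remainder is divisible by `p^{2(r+k)}`, and `r + k
≥ 2` makes it a multiple of `p^{r+k+2}`. Because of `2 ≤ r` the prime `2` needs no separate
treatment. -/
theorem exists_one_add_pow_prime_pow_eq {p r : ℕ} (hr : 2 ≤ r) (w k : ℕ) :
    ∃ w', (1 + p ^ r * w) ^ p ^ k = 1 + p ^ (r + k) * w' ∧ w' ≡ w [MOD p] := by
  induction k with
  | zero => exact ⟨w, by simp, rfl⟩
  | succ k ih =>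
    obtain ⟨w', hw', hmod⟩ := ih
    obtain ⟨y, hy⟩ := exists_one_add_pow_eq (p ^ (r + k) * w') p
    obtain ⟨s, hs⟩ : ∃ s, r + k = s + 2 := ⟨r + k - 2, by omega⟩
    refine ⟨w' + p * (p ^ s * w' ^ 2 * y), ?_, ?_⟩
    · rw [pow_succ p k, pow_mul, hw', hy, ← add_assoc, hs]
      ring
    · rw [add_comm]
      exact (Nat.add_modEq_right_iff.2 (dvd_mul_right _ _)).trans hmod

theorem sum_range_mul_pow (x A s : ℕ) :
    ∑ t ∈ Finset.range (A * s), x ^ t =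
      (∑ t ∈ Finset.range A, x ^ t) * ∑ i ∈ Finset.range s, (x ^ A) ^ i := by
  induction s with
  | zero => simp
  | succ s ih =>
    rw [Nat.mul_succ, Finset.sum_range_add, ih, Finset.sum_range_succ, mul_add, ← pow_mul,
      Finset.sum_mul (a := x ^ (A * s)), add_right_inj]
    exact Finset.sum_congr rfl fun t _ => by rw [pow_add, mul_comm]

theorem prime_pow_dvd_geom_sum {p x : ℕ} (hx : x ≡ 1 [MOD p]) (k : ℕ) :
    p ^ k ∣ ∑ t ∈ Finset.range (p ^ k), x ^ t := by
  induction k with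
  | zero => simp
  | succ k ih =>
    rw [pow_succ, sum_range_mul_pow]
    refine mul_dvd_mul ih ?_
    rw [← ZMod.natCast_eq_zero_iff]
    have h1 : (x : ZMod p) = 1 := by exact_mod_cast (ZMod.natCast_eq_natCast_iff _ _ _).2 hx
    simp [h1]

/-- The sum times `p^r` equals `(1 + p^r)^{p^k} - 1`. That the cofactor `w` is a unit modulo `p` is
what later allows `b` to be corrected by a power of `a`. -/
theorem geom_sum_one_add_prime_pow {p r : ℕ} (hp : p.Prime) (hr : 2 ≤ r) (k : ℕ) :
    ∃ w, ∑ t ∈ Finset.range (p ^ k), (1 + p ^ r) ^ t = p ^ k * w ∧ w.Coprime p := by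
  obtain ⟨w, hw, hmod⟩ := exists_one_add_pow_prime_pow_eq (p := p) hr 1 k
  refine ⟨w, ?_, ?_⟩
  · have h := geom_sum_mul_add (p ^ r) (p ^ k)
    rw [mul_one] at hw
    rw [add_comm (p ^ r) 1, hw, add_comm 1 (p ^ (r + k) * w), add_left_inj, pow_add] at h
    have h0 : 0 < p ^ r := pow_pos hp.pos r
    apply Nat.eq_of_mul_eq_mul_right h0
    rw [h]; ring
  · rw [Nat.coprime_comm, hp.coprime_iff_not_dvd]
    intro h
    have := (Nat.modEq_zero_iff_dvd.2 h).symm.trans hmod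
    have h1 : p ∣ 1 := Nat.modEq_zero_iff_dvd.1 this.symm
    exact hp.one_lt.ne' (Nat.dvd_one.1 h1)

/-- The `p^{n-r-1}`-th power is `1 + p^{n-1} w'` with `p ∤ w'`, so the order is exactly `p^{n-r}`.
This decides which powers of `b` commute with `a`. -/
theorem one_add_pow_modEq_one_iff {p r n w : ℕ} (hp : p.Prime) (hr : 2 ≤ r) (hrn : r ≤ n)
    (hw : ¬ p ∣ w) (j : ℕ) : (1 + p ^ r * w) ^ j ≡ 1 [MOD p ^ n] ↔ p ^ (n - r) ∣ j := by
  have hord : orderOf ((1 + p ^ r * w : ℕ) : ZMod (p ^ n)) = p ^ (n - r) := by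
    have hfin : ((1 + p ^ r * w : ℕ) : ZMod (p ^ n)) ^ p ^ (n - r) = 1 := by
      obtain ⟨w', h, -⟩ := exists_one_add_pow_prime_pow_eq (p := p) hr w (n - r)
      rw [← Nat.cast_pow, h, show r + (n - r) = n by omega]
      push_cast
      rw [← Nat.cast_pow, ZMod.natCast_self]
      simp
    rcases hrn.eq_or_lt with rfl | hlt
    · simp only [Nat.sub_self, pow_zero, pow_one] at hfin ⊢
      rw [hfin, orderOf_one]
    · obtain ⟨k, hk⟩ : ∃ k, n - r = k + 1 := ⟨n - r - 1, by omega⟩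
      rw [hk] at hfin ⊢
      have := Fact.mk hp
      refine orderOf_eq_prime_pow ?_ hfin
      intro h1
      obtain ⟨w', h, hmod⟩ := exists_one_add_pow_prime_pow_eq (p := p) hr w k
      rw [← Nat.cast_pow, h] at h1
      push_cast at h1
      rw [add_eq_left] at h1
      have h2 : ((p ^ (r + k) * w' : ℕ) : ZMod (p ^ n)) = 0 := by push_cast; exact h1
      rw [ZMod.natCast_eq_zero_iff, show n = r + k + 1 by omega, pow_succ] at h2
      have h3 := Nat.dvd_of_mul_dvd_mul_left (pow_pos hp.pos _) h2
      exact hw ((Nat.modEq_zero_iff_dvd.1 (hmod.symm.trans (Nat.modEq_zero_iff_dvd.2 h3))))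
  rw [← hord, orderOf_dvd_iff_pow_eq_one, ← ZMod.natCast_eq_natCast_iff]
  push_cast
  rfl

/-- Successive approximation: if `k` is right modulo `p^{r+i}` with error `p^{r+i} e`, adding `p^i
f` to `k` changes the next digit by `f U` with `U` prime to `p`, and `f` is chosen to cancel `e`. -/
theorem exists_one_add_pow_modEq {p r w : ℕ} (hp : p.Prime) (hr : 2 ≤ r) (hw : ¬ p ∣ w) (i : ℕ) :
    ∃ k : ℕ, (1 + p ^ r * w) ^ k ≡ 1 + p ^ r [MOD p ^ (r + i)] := by
  induction i with
  | zero => exact ⟨0, by simp [Nat.ModEq]⟩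
  | succ i ih =>
    obtain ⟨k, hk⟩ := ih
    obtain ⟨U, hU, hmod⟩ := exists_one_add_pow_prime_pow_eq (p := p) hr w i
    obtain ⟨e, he⟩ : ∃ e : ℤ, ((1 + p ^ r * w : ℕ) : ℤ) ^ k = (1 + p ^ r) + p ^ (r + i) * e := by
      obtain ⟨e, he⟩ := (Nat.modEq_iff_dvd.1 hk.symm)
      exact ⟨e, by push_cast at he ⊢; linarith⟩
    have hUp : IsCoprime (U : ℤ) p := by
      rw [Nat.isCoprime_iff_coprime, Nat.coprime_comm, hp.coprime_iff_not_dvd]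
      exact fun h => hw (Nat.modEq_zero_iff_dvd.1
        (hmod.symm.trans (Nat.modEq_zero_iff_dvd.2 h)))
    obtain ⟨f, hf⟩ : ∃ f : ℕ, (p : ℤ) ∣ e + f * U := by
      obtain ⟨s, t, hst⟩ := hUp
      refine ⟨((-e * s) % p).toNat, ?_⟩
      rw [Int.toNat_of_nonneg (Int.emod_nonneg _ (by exact_mod_cast hp.ne_zero)), Int.emod_def]
      refine ⟨e * t - (-e * s / p) * U, ?_⟩
      linear_combination -e * hst
    obtain ⟨g, hg⟩ := hf
    obtain ⟨y, hy⟩ := exists_one_add_pow_eq (p ^ (r + i) * U) f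
    -- With `r = q + 1` all second-order terms are visibly multiples of `p^{r+i+1}`.
    obtain ⟨q, rfl⟩ : ∃ q, r = q + 1 := ⟨r - 1, by omega⟩
    refine ⟨k + p ^ i * f, Nat.ModEq.symm ?_⟩
    rw [Nat.modEq_iff_dvd]
    have hy' : ((1 + p ^ (q + 1) * w : ℕ) : ℤ) ^ (p ^ i * f) =
        1 + f * (p ^ (q + 1 + i) * U) + (p ^ (q + 1 + i) * U) ^ 2 * y := by
      rw [pow_mul]
      have h1 : ((1 + p ^ (q + 1) * w : ℕ) : ℤ) ^ p ^ i = ((1 + p ^ (q + 1 + i) * U : ℕ) : ℤ) := by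
        exact_mod_cast hU
      rw [h1]
      exact_mod_cast hy
    push_cast at he hy' ⊢
    rw [pow_add (1 + (p : ℤ) ^ (q + 1) * w) k, he, hy']
    refine ⟨g + p ^ q * (f * U) + p ^ (q + i) * (e * f * U) +
      p ^ (q + i) * ((1 + p ^ (q + 1)) + p ^ (q + 1 + i) * e) * U ^ 2 * y, ?_⟩
    have hg' : (p : ℤ) * g = e + f * U := hg.symm
    have : (p : ℤ) ^ (q + 1 + i + 1) * g = p ^ (q + 1 + i) * (e + f * U) := by
      rw [pow_succ, mul_assoc, hg']
    linear_combination -this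

theorem exists_coprime_one_add_pow_modEq {p r n w : ℕ} (hp : p.Prime) (hr : 2 ≤ r) (hrn : r < n)
    (hw : ¬ p ∣ w) : ∃ k : ℕ, k.Coprime p ∧ (1 + p ^ r * w) ^ k ≡ 1 + p ^ r [MOD p ^ n] := by
  obtain ⟨k, hk⟩ := exists_one_add_pow_modEq hp hr hw (n - r)
  rw [show r + (n - r) = n by omega] at hk
  refine ⟨k, ?_, hk⟩
  rw [Nat.coprime_comm, hp.coprime_iff_not_dvd]
  -- If `p ∣ k`, the power would be `1` modulo `p^{r+1}`, so `p^{r+1}` would divide `p^r`.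
  intro hpk
  have h1 : (1 + p ^ r * w) ^ k ≡ 1 [MOD p ^ (r + 1)] := by
    rw [one_add_pow_modEq_one_iff hp hr (by omega) hw]
    simpa using hpk
  have h2 := h1.symm.trans (hk.of_dvd (pow_dvd_pow p hrn))
  have h3 : p ^ (r + 1) ∣ p ^ r := by
    have := (Nat.modEq_iff_dvd' (by omega)).1 h2
    simpa using this
  have := (Nat.pow_dvd_pow_iff_le_right hp.one_lt).1 h3
  omega

/-! ### Pairs of generators with `a * b = b * a ^ c` -/

section
variable {G : Type u} [Group G] {a b : G} {c : ℕ}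

theorem pow_mul_pow_of_comm (h : a * b = b * a ^ c) (i j : ℕ) :
    a ^ i * b ^ j = b ^ j * a ^ (i * c ^ j) := by
  have h1 : ∀ i : ℕ, a ^ i * b = b * a ^ (i * c) := by
    intro i
    induction i with
    | zero => simp
    | succ i ih => rw [pow_succ, mul_assoc, h, ← mul_assoc, ih, mul_assoc, ← pow_add,
        Nat.succ_mul]
  induction j with
  | zero => simp
  | succ j ih => rw [pow_succ, ← mul_assoc, ih, mul_assoc, h1, ← mul_assoc, mul_assoc i,
      ← pow_succ c]

theorem mul_pow_of_comm (h : a * b = b * a ^ c) (i j k : ℕ) :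
    (b ^ j * a ^ i) ^ k = b ^ (j * k) * a ^ (i * ∑ t ∈ Finset.range k, (c ^ j) ^ t) := by
  induction k with
  | zero => simp
  | succ k ih =>
    rw [pow_succ', ih, Finset.sum_range_succ, ← mul_assoc, mul_assoc (b ^ j),
      pow_mul_pow_of_comm h, ← mul_assoc, ← pow_add, mul_assoc, ← pow_add, ← pow_mul]
    congr 2 <;> ring

/-- Finite orders turn the subgroup closure into a monoid closure, so natural exponents suffice. -/
theorem exists_eq_pow_mul_pow (hgen : Subgroup.closure {a, b} = ⊤) (h : a * b = b * a ^ c)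
    (ha : IsOfFinOrder a) (hb : IsOfFinOrder b) (g : G) : ∃ j i : ℕ, g = b ^ j * a ^ i := by
  have hg : g ∈ Submonoid.closure {a, b} := by
    have h1 := Subgroup.closure_toSubmonoid_of_isOfFinOrder (s := {a, b}) (by
      rintro x (rfl | rfl)
      · exact ha
      · exact hb)
    rw [← h1, hgen]
    trivial
  induction hg using Submonoid.closure_induction with
  | mem x hx =>
    rcases hx with rfl | rfl
    · exact ⟨0, 1, by simp⟩
    · exact ⟨1, 0, by simp⟩
  | one => exact ⟨0, 0, by simp⟩
  | mul x y _ _ hx hy =>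
    obtain ⟨j, i, rfl⟩ := hx
    obtain ⟨j', i', rfl⟩ := hy
    refine ⟨j + j', i * c ^ j' + i', ?_⟩
    rw [← mul_assoc, mul_assoc (b ^ j), pow_mul_pow_of_comm h, ← mul_assoc, ← pow_add, mul_assoc,
      ← pow_add]

theorem comm_of_closure_pair (hgen : Subgroup.closure {a, b} = ⊤) (h : a * b = b * a) (x y : G) :
    x * y = y * x := by
  have h1 := Subgroup.isMulCommutative_closure (k := {a, b}) (by
    rintro x (rfl | rfl) y (rfl | rfl) <;> simp [h])
  exact setLike_mul_comm (s := Subgroup.closure {a, b}) (hgen ▸ trivial) (hgen ▸ trivial)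

theorem closure_pair_map {H : Type v} [Group H] (f : G →* H) (hf : Function.Surjective f)
    (hgen : Subgroup.closure {a, b} = ⊤) : Subgroup.closure {f a, f b} = ⊤ := by
  have := MonoidHom.map_closure f {a, b}
  rw [hgen, Subgroup.map_top_of_surjective f hf, Set.image_pair] at this
  exact this.symm

theorem commutator_le_of_closure_pair (hgen : Subgroup.closure {a, b} = ⊤) (N : Subgroup G)
    [N.Normal] (h : ⁅a, b⁆ ∈ N) : commutator G ≤ N := by
  rw [commutator_def, Subgroup.commutator_le]
  intro x _ y _
  have hab : (a : G ⧸ N) * b = b * a := by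
    rw [← commutatorElement_eq_one_iff_mul_comm]
    exact (QuotientGroup.eq_one_iff _).2 h
  have := comm_of_closure_pair (closure_pair_map (QuotientGroup.mk' N)
    (QuotientGroup.mk'_surjective N) hgen) hab x y
  rw [← commutatorElement_eq_one_iff_mul_comm] at this
  exact (QuotientGroup.eq_one_iff _).1 this

/-- Finiteness makes `x N x⁻¹ ≤ N` enough for `x` to normalise `N`; conjugation by inverses need not
be checked. -/
theorem normal_of_closure_pair [Finite G] (hgen : Subgroup.closure {a, b} = ⊤) (N : Subgroup G)
    (ha : ∀ x ∈ N, a * x * a⁻¹ ∈ N) (hb : ∀ x ∈ N, b * x * b⁻¹ ∈ N) : N.Normal := by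
  rw [← Subgroup.normalizer_eq_top_iff, eq_top_iff, ← hgen, Subgroup.closure_le]
  rintro x (rfl | rfl)
  · exact Subgroup.mem_normalizer_fintype ha
  · exact Subgroup.mem_normalizer_fintype hb

theorem forall_pow_mem_commutator_iff (hgen : Subgroup.closure {a, b} = ⊤) (k : ℕ) :
    (∀ x : G, x ^ k ∈ commutator G) ↔ a ^ k ∈ commutator G ∧ b ^ k ∈ commutator G := by
  refine ⟨fun h => ⟨h a, h b⟩, fun ⟨ha, hb⟩ x => ?_⟩
  have hx : x ∈ Subgroup.closure {a, b} := hgen ▸ trivial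
  have hker : ∀ y : G, y ^ k ∈ commutator G ↔ (powMonoidHom k).comp Abelianization.of y = 1 := by
    intro y
    rw [← Abelianization.ker_of, MonoidHom.mem_ker]
    simp
  rw [hker] at *
  rw [← MonoidHom.mem_ker]
  revert x
  suffices h : Subgroup.closure {a, b} ≤ ((powMonoidHom k).comp (Abelianization.of (G := G))).ker by
    exact fun x hx => h hx
  rw [Subgroup.closure_le]
  rintro y (rfl | rfl)
  · exact ha
  · exact hb

end

/-! ### Metacyclic presentations -/

/-- `a`, `b` generate `G` and satisfy the relations of `⟨a, b | a^{p^n}, b^{p^m} = a^{p^l},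
[a,b] = a^{p^r}⟩`. -/
structure MetacyclicRel (p n m l r : ℕ) {G : Type u} [Group G] (a b : G) : Prop where
  gen : Subgroup.closure {a, b} = ⊤
  pow_a : a ^ p ^ n = 1
  pow_b : b ^ p ^ m = a ^ p ^ l
  comm : a * b = b * a ^ (1 + p ^ r)

/-- The relations of `MetacyclicRel` hold, `a` has order `p^n`, and `b` has order `p^m`
modulo `⟨a⟩`. -/
structure IsMetacyclicPair (p n m l r : ℕ) {G : Type u} [Group G] (a b : G) : Prop
    extends MetacyclicRel p n m l r a b where
  dvd_of_pow_eq_one : ∀ i : ℕ, a ^ i = 1 → p ^ n ∣ i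
  dvd_of_pow_mem : ∀ j : ℤ, b ^ j ∈ Subgroup.zpowers a → ((p ^ m : ℕ) : ℤ) ∣ j

theorem zpowers_pow_normal {G : Type u} [Group G] {a : G} (h : (Subgroup.zpowers a).Normal)
    (t : ℕ) : (Subgroup.zpowers (a ^ t)).Normal where
  conj_mem := by
    rintro _ ⟨i, rfl⟩ g
    obtain ⟨k, hk⟩ := h.conj_mem a (Subgroup.mem_zpowers a) g
    refine ⟨k * i, ?_⟩
    simp only at hk ⊢
    rw [← conj_zpow, ← conj_pow, ← hk, ← zpow_natCast, ← zpow_natCast, ← zpow_mul, ← zpow_mul,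
      ← zpow_mul]
    ring_nf

theorem commutator_eq_zpowers {G : Type u} [Group G] {a b : G} {c : ℕ}
    (hgen : Subgroup.closure {a, b} = ⊤) (hnormal : (Subgroup.zpowers a).Normal)
    (h : a * b = b * a ^ (1 + c)) : commutator G = Subgroup.zpowers (a ^ c) := by
  have hN := zpowers_pow_normal hnormal c
  apply le_antisymm
  · refine commutator_le_of_closure_pair hgen _ ?_
    rw [commutatorElement_def, h, pow_add, pow_one]
    have := hN.conj_mem _ (Subgroup.mem_zpowers (a ^ c)) b
    convert this using 1
    have h2 : a * a ^ c = a ^ c * a := by rw [← pow_succ, ← pow_succ']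
    rw [h2]; group
  · rw [Subgroup.zpowers_le]
    -- `⁅x, y⁆` is `x y x⁻¹ y⁻¹`, so the commutator `a⁻¹ b⁻¹ a b` is `⁅a⁻¹, b⁻¹⁆`.
    have : a ^ c = ⁅a⁻¹, b⁻¹⁆ := by
      rw [commutatorElement_def, inv_inv, inv_inv, mul_assoc, h, pow_add, pow_one]
      group
    rw [this]
    exact Subgroup.commutator_mem_commutator (Subgroup.mem_top _) (Subgroup.mem_top _)

theorem mem_center_iff_of_closure_pair {G : Type u} [Group G] {a b x : G}
    (hgen : Subgroup.closure {a, b} = ⊤) :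
    x ∈ Subgroup.center G ↔ a * x = x * a ∧ b * x = x * b := by
  rw [Subgroup.mem_center_iff]
  refine ⟨fun h => ⟨h a, h b⟩, fun ⟨ha, hb⟩ g => ?_⟩
  have h : Subgroup.closure {a, b} ≤ Subgroup.centralizer {x} := by
    rw [Subgroup.closure_le]
    rintro y (rfl | rfl)
    · exact Subgroup.mem_centralizer_singleton_iff.2 ha
    · exact Subgroup.mem_centralizer_singleton_iff.2 hb
  exact Subgroup.mem_centralizer_singleton_iff.1 (h (hgen ▸ Subgroup.mem_top g))

section
variable {G : Type u} [Group G] {a b : G} {p n m l r : ℕ}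

namespace MetacyclicRel

theorem isOfFinOrder_left (hp : p.Prime) (h : MetacyclicRel p n m l r a b) : IsOfFinOrder a :=
  isOfFinOrder_iff_pow_eq_one.2 ⟨p ^ n, pow_pos hp.pos _, h.pow_a⟩

theorem isOfFinOrder_right (hp : p.Prime) (h : MetacyclicRel p n m l r a b) : IsOfFinOrder b :=
  isOfFinOrder_iff_pow_eq_one.2 ⟨p ^ m * p ^ n, mul_pos (pow_pos hp.pos _) (pow_pos hp.pos _), by
    rw [pow_mul, h.pow_b, ← pow_mul, mul_comm, pow_mul, h.pow_a, one_pow]⟩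

theorem exists_eq (hp : p.Prime) (h : MetacyclicRel p n m l r a b) (g : G) :
    ∃ j i : ℕ, g = b ^ j * a ^ i :=
  exists_eq_pow_mul_pow h.gen h.comm (h.isOfFinOrder_left hp) (h.isOfFinOrder_right hp) g

theorem map {H : Type v} [Group H] (h : MetacyclicRel p n m l r a b) (f : G →* H)
    (hf : Function.Surjective f) : MetacyclicRel p n m l r (f a) (f b) where
  gen := closure_pair_map f hf h.gen
  pow_a := by rw [← map_pow, h.pow_a, map_one]
  pow_b := by rw [← map_pow, h.pow_b, map_pow]
  comm := by rw [← map_mul, h.comm, map_mul, map_pow]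

theorem finite (hp : p.Prime) (h : MetacyclicRel p n m l r a b) : Finite G := by
  have := (h.isOfFinOrder_left hp).finite_zpowers.to_subtype
  have := (h.isOfFinOrder_right hp).finite_zpowers.to_subtype
  refine Finite.of_surjective (fun x : Subgroup.zpowers b × Subgroup.zpowers a => (x.1 * x.2 : G))
    fun g => ?_
  obtain ⟨j, i, rfl⟩ := h.exists_eq hp g
  exact ⟨⟨⟨b ^ j, j, by simp⟩, ⟨a ^ i, i, by simp⟩⟩, rfl⟩

theorem normal (hp : p.Prime) (h : MetacyclicRel p n m l r a b) :
    (Subgroup.zpowers a).Normal := by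
  have := h.finite hp
  refine normal_of_closure_pair h.gen _ (fun x hx => ?_) (fun x hx => ?_)
  · exact Subgroup.mul_mem _ (Subgroup.mul_mem _ (Subgroup.mem_zpowers a) hx)
      (Subgroup.inv_mem _ (Subgroup.mem_zpowers a))
  · obtain ⟨i, rfl⟩ := (h.isOfFinOrder_left hp).mem_powers_iff_mem_zpowers.2 hx
    obtain ⟨k, hk⟩ := (h.isOfFinOrder_right hp).mem_powers_iff_mem_zpowers.2
      (Subgroup.inv_mem _ (Subgroup.mem_zpowers b))
    simp only at hk ⊢
    rw [← hk, mul_assoc, pow_mul_pow_of_comm h.comm, ← mul_assoc, hk, mul_inv_cancel, one_mul]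
    exact ⟨_, zpow_natCast _ _⟩

theorem commutator_eq (hp : p.Prime) (h : MetacyclicRel p n m l r a b) :
    commutator G = Subgroup.zpowers (a ^ p ^ r) :=
  commutator_eq_zpowers h.gen (h.normal hp) h.comm

/-- A homomorphism that maps a pair satisfying the metacyclic relations to a metacyclic pair is
injective. -/
theorem injective (hp : p.Prime) (h : MetacyclicRel p n m l r a b) {H : Type v} [Group H]
    (f : G →* H) (hf : IsMetacyclicPair p n m l r (f a) (f b)) : Function.Injective f := by
  rw [injective_iff_map_eq_one]
  intro g hg
  obtain ⟨j, i, rfl⟩ := h.exists_eq hp g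
  simp only [map_mul, map_pow] at hg
  -- For `b^j a^i` in the kernel, the exact index gives `p^m ∣ j`. Rewriting `b^{p^m}` as `a^{p^l}`
  -- in both groups leaves a power of `a`, which the exact order of `f a` kills.
  have hmem : f b ^ (j : ℤ) ∈ Subgroup.zpowers (f a) := by
    rw [zpow_natCast, eq_inv_of_mul_eq_one_left hg]
    exact Subgroup.inv_mem _ (Subgroup.pow_mem _ (Subgroup.mem_zpowers _) _)
  obtain ⟨k, rfl⟩ := Int.natCast_dvd_natCast.1 (hf.dvd_of_pow_mem _ hmem)
  rw [pow_mul, hf.pow_b, ← pow_mul, ← pow_add] at hg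
  obtain ⟨t, ht⟩ := hf.dvd_of_pow_eq_one _ hg
  rw [pow_mul, h.pow_b, ← pow_mul, ← pow_add, ht, pow_mul, h.pow_a, one_pow]

/-- Exact orders can be read off in an image; a presented group inherits them from any model. -/
theorem of_map (h : MetacyclicRel p n m l r a b) {H : Type v} [Group H]
    (f : G →* H) (hf : IsMetacyclicPair p n m l r (f a) (f b)) : IsMetacyclicPair p n m l r a b where
  toMetacyclicRel := h
  dvd_of_pow_eq_one i hi := hf.dvd_of_pow_eq_one i (by rw [← map_pow, hi, map_one])
  dvd_of_pow_mem j hj := hf.dvd_of_pow_mem j (by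
    obtain ⟨k, hk⟩ := hj
    exact ⟨k, by simp only at hk ⊢; rw [← map_zpow, hk, map_zpow]⟩)

end MetacyclicRel

/-! ### Invariants of a metacyclic pair: order, commutator subgroup, exponents -/

namespace IsMetacyclicPair

theorem map_equiv {H : Type v} [Group H] (h : IsMetacyclicPair p n m l r a b) (e : G ≃* H) :
    IsMetacyclicPair p n m l r (e a) (e b) :=
  (h.toMetacyclicRel.map e.toMonoidHom e.surjective).of_map e.symm.toMonoidHom (by simpa using h)

theorem orderOf_left (h : IsMetacyclicPair p n m l r a b) : orderOf a = p ^ n :=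
  Nat.dvd_antisymm (orderOf_dvd_of_pow_eq_one h.pow_a)
    (h.dvd_of_pow_eq_one _ (pow_orderOf_eq_one a))

theorem zpow_eq_one_iff (h : IsMetacyclicPair p n m l r a b) (i : ℤ) :
    a ^ i = 1 ↔ ((p ^ n : ℕ) : ℤ) ∣ i := by
  rw [← orderOf_dvd_iff_zpow_eq_one, h.orderOf_left]

theorem pow_eq_one_iff (h : IsMetacyclicPair p n m l r a b) (i : ℕ) :
    a ^ i = 1 ↔ p ^ n ∣ i := by
  rw [← orderOf_dvd_iff_pow_eq_one, h.orderOf_left]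

theorem card_eq (hp : p.Prime) (h : IsMetacyclicPair p n m l r a b) :
    Nat.card G = p ^ (n + m) := by
  have := h.finite hp
  have := h.normal hp
  rw [Subgroup.card_eq_card_quotient_mul_card_subgroup (Subgroup.zpowers a), Nat.card_zpowers,
    h.orderOf_left, pow_add, mul_comm]
  congr 1
  have h1 : orderOf (b : G ⧸ Subgroup.zpowers a) = p ^ m := by
    apply Nat.dvd_antisymm
    · apply orderOf_dvd_of_pow_eq_one
      rw [← QuotientGroup.mk_pow, QuotientGroup.eq_one_iff, h.pow_b]
      exact Subgroup.pow_mem _ (Subgroup.mem_zpowers a) _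
    · have h2 := pow_orderOf_eq_one (b : G ⧸ Subgroup.zpowers a)
      rw [← QuotientGroup.mk_pow, QuotientGroup.eq_one_iff, ← zpow_natCast] at h2
      exact Int.natCast_dvd_natCast.1 (h.dvd_of_pow_mem _ h2)
  rw [← h1]
  refine (orderOf_eq_card_of_forall_mem_zpowers fun x => ?_).symm
  obtain ⟨g, rfl⟩ := QuotientGroup.mk_surjective x
  obtain ⟨j, i, rfl⟩ := h.exists_eq hp g
  refine ⟨j, ?_⟩
  simp only [zpow_natCast]
  rw [← QuotientGroup.mk_pow, QuotientGroup.eq, ← mul_assoc, inv_mul_cancel, one_mul]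
  exact Subgroup.pow_mem _ (Subgroup.mem_zpowers a) _

theorem isPGroup (hp : p.Prime) (h : IsMetacyclicPair p n m l r a b) : IsPGroup p G :=
  IsPGroup.of_card (h.card_eq hp)

theorem isAbelian_iff (hp : p.Prime) (h : IsMetacyclicPair p n m l r a b) :
    IsAbelian G ↔ n ≤ r := by
  rw [← Nat.pow_dvd_pow_iff_le_right hp.one_lt, ← h.pow_eq_one_iff]
  have h1 : a * b = b * a ↔ a ^ p ^ r = 1 := by
    rw [h.comm, mul_right_inj, pow_add, pow_one, mul_eq_left]
  rw [← h1]
  exact ⟨fun H => H a b, fun H => comm_of_closure_pair h.gen H⟩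

theorem pow_mem_zpowers_iff (h : IsMetacyclicPair p n m l r a b) (i : ℕ) :
    a ^ i ∈ Subgroup.zpowers (a ^ p ^ r) ↔ p ^ min r n ∣ i := by
  constructor
  · rintro ⟨k, hk⟩
    simp only at hk
    have h1 : a ^ ((i : ℤ) - (p ^ r : ℕ) * k) = 1 := by
      rw [zpow_sub, zpow_mul, zpow_natCast, zpow_natCast, hk, mul_inv_cancel]
    rw [h.zpow_eq_one_iff] at h1
    have h2 : ((p ^ min r n : ℕ) : ℤ) ∣ (p ^ n : ℕ) :=
      Int.natCast_dvd_natCast.2 (pow_dvd_pow _ (min_le_right _ _))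
    have h3 : ((p ^ min r n : ℕ) : ℤ) ∣ (p ^ r : ℕ) * k :=
      (Int.natCast_dvd_natCast.2 (pow_dvd_pow _ (min_le_left _ _))).mul_right k
    have := dvd_add (h2.trans h1) h3
    rw [sub_add_cancel] at this
    exact Int.natCast_dvd_natCast.1 this
  · rintro ⟨k, rfl⟩
    rcases le_total r n with hle | hle
    · rw [min_eq_left hle, pow_mul]
      exact Subgroup.pow_mem _ (Subgroup.mem_zpowers _) _
    · rw [min_eq_right hle, pow_mul, h.pow_a, one_pow]
      exact Subgroup.one_mem _

theorem card_commutator (hp : p.Prime) (h : IsMetacyclicPair p n m l r a b) :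
    Nat.card (commutator G) = p ^ (n - r) := by
  rw [h.commutator_eq hp, Nat.card_zpowers, orderOf_pow' _ (pow_pos hp.pos r).ne', h.orderOf_left]
  rcases le_total r n with hle | hle
  · rw [Nat.gcd_eq_right (pow_dvd_pow _ hle), Nat.pow_div hle hp.pos]
  · rw [Nat.gcd_eq_left (pow_dvd_pow _ hle), Nat.div_self (pow_pos hp.pos _),
      Nat.sub_eq_zero_of_le hle, pow_zero]

theorem le_of_pow_mem (hp : p.Prime) (h : IsMetacyclicPair p n m l r a b) {k : ℕ}
    (hk : b ^ p ^ k ∈ Subgroup.zpowers a) : m ≤ k := by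
  rw [← zpow_natCast] at hk
  exact (Nat.pow_dvd_pow_iff_le_right hp.one_lt).1
    (Int.natCast_dvd_natCast.1 (h.dvd_of_pow_mem _ hk))

theorem pow_right_of_le (h : IsMetacyclicPair p n m l r a b) {k : ℕ} (hk : m ≤ k) :
    b ^ p ^ k = a ^ p ^ (l + (k - m)) := by
  rw [show k = m + (k - m) by omega, pow_add p m, pow_mul, h.pow_b, ← pow_mul, ← pow_add]
  simp

/-- This computes the exponent of `G/G'`. The hypothesis `min r n ≤ l` places `b^{p^m}` in `G'`. -/
theorem forall_pow_mem_commutator_iff (hp : p.Prime) (h : IsMetacyclicPair p n m l r a b)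
    (hl : min r n ≤ l) (k : ℕ) :
    (∀ x : G, x ^ p ^ k ∈ commutator G) ↔ min r n ≤ k ∧ m ≤ k := by
  rw [_root_.forall_pow_mem_commutator_iff h.gen, h.commutator_eq hp, h.pow_mem_zpowers_iff,
    Nat.pow_dvd_pow_iff_le_right hp.one_lt]
  refine and_congr_right fun _ => ⟨fun hb => h.le_of_pow_mem hp ?_, fun hk => ?_⟩
  · refine (Subgroup.zpowers_le.2 ?_ : Subgroup.zpowers (a ^ p ^ r) ≤ Subgroup.zpowers a) hb
    exact Subgroup.pow_mem _ (Subgroup.mem_zpowers a) _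
  · rw [h.pow_right_of_le hk, h.pow_mem_zpowers_iff]
    exact pow_dvd_pow _ (by omega)

/-- This computes the exponent of `G`. For `l ≤ n` the order of `b` is `p^{m+n-l}`; in `(b^j
a^i)^{p^k}` the exponent of `a` carries a geometric sum divisible by `p^k`. -/
theorem forall_pow_eq_one_iff (hp : p.Prime) (h : IsMetacyclicPair p n m l r a b)
    (hr : 1 ≤ r) (hl : l ≤ n) (k : ℕ) :
    (∀ x : G, x ^ p ^ k = 1) ↔ n ≤ k ∧ m + n ≤ k + l := by
  constructor
  · intro H
    have h1 : n ≤ k := (Nat.pow_dvd_pow_iff_le_right hp.one_lt).1 ((h.pow_eq_one_iff _).1 (H a))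
    have h2 : m ≤ k := h.le_of_pow_mem hp (by rw [H b]; exact Subgroup.one_mem _)
    have h3 := H b
    rw [h.pow_right_of_le h2, h.pow_eq_one_iff, Nat.pow_dvd_pow_iff_le_right hp.one_lt] at h3
    omega
  · rintro ⟨h1, h2⟩ x
    obtain ⟨j, i, rfl⟩ := h.exists_eq hp x
    rw [mul_pow_of_comm h.comm, mul_comm j, pow_mul, h.pow_right_of_le (show m ≤ k by omega)]
    have h3 : a ^ p ^ (l + (k - m)) = 1 := by
      rw [h.pow_eq_one_iff]
      exact pow_dvd_pow _ (by omega)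
    rw [h3, one_pow, one_mul, h.pow_eq_one_iff]
    refine (pow_dvd_pow p h1).trans (Dvd.dvd.mul_left (prime_pow_dvd_geom_sum ?_ k) i)
    have h4 : 1 + p ^ r ≡ 1 [MOD p] := by
      rw [Nat.add_modEq_left_iff]
      exact dvd_pow_self p (by omega)
    simpa using h4.pow j

/-- The element `a^{p^l}` is a power of `b`, so it commutes with `b`. -/
theorem le_add_of_comm (hp : p.Prime) (h : IsMetacyclicPair p n m l r a b) : n ≤ l + r := by
  have h1 : a ^ p ^ l * b = b * a ^ p ^ l := by rw [← h.pow_b, ← pow_succ, ← pow_succ']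
  have h2 := pow_mul_pow_of_comm h.comm (p ^ l) 1
  rw [pow_one, pow_one, h1, mul_right_inj, mul_add, mul_one, pow_add, left_eq_mul, ← pow_add,
    h.pow_eq_one_iff, Nat.pow_dvd_pow_iff_le_right hp.one_lt] at h2
  exact h2

/-- The element `b^{p^m}` is a power of `a`, so it commutes with `a`, and `p^{n-r}` divides `p^m`.
-/
theorem le_add_of_comm' (hp : p.Prime) (hr : 2 ≤ r) (hrn : r ≤ n)
    (h : IsMetacyclicPair p n m l r a b) : n ≤ m + r := by
  have h1 : a * b ^ p ^ m = b ^ p ^ m * a := by rw [h.pow_b, ← pow_succ, ← pow_succ']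
  have h2 := pow_mul_pow_of_comm h.comm 1 (p ^ m)
  rw [pow_one, h1, mul_right_inj, one_mul] at h2
  have h3 := pow_eq_pow_iff_modEq.1 ((pow_one a).trans h2).symm
  rw [h.orderOf_left] at h3
  have h4 := (one_add_pow_modEq_one_iff (w := 1) hp hr hrn hp.not_dvd_one (p ^ m)).1
    (by simpa using h3)
  have := (Nat.pow_dvd_pow_iff_le_right hp.one_lt).1 h4
  omega

end IsMetacyclicPair
end

/-! ### Subgroups generated by powers -/

section
variable {G : Type u} [Group G]

theorem pow_mem_powSubgroup {K : Subgroup G} {x : G} (hx : x ∈ K) (k : ℕ) :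
    x ^ k ∈ powSubgroup K k :=
  Subgroup.subset_closure ⟨x, hx, rfl⟩

theorem powSubgroup_le_iff {K N : Subgroup G} {k : ℕ} :
    powSubgroup K k ≤ N ↔ ∀ x ∈ K, x ^ k ∈ N := by
  rw [powSubgroup, Subgroup.closure_le]
  exact ⟨fun h x hx => h ⟨x, hx, rfl⟩, fun h => by rintro _ ⟨x, hx, rfl⟩; exact h x hx⟩

theorem powSubgroup_mono {K N : Subgroup G} (h : K ≤ N) (k : ℕ) :
    powSubgroup K k ≤ powSubgroup N k :=
  powSubgroup_le_iff.2 fun _ hx => pow_mem_powSubgroup (h hx) k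

theorem powSubgroup_le (K : Subgroup G) (k : ℕ) : powSubgroup K k ≤ K :=
  powSubgroup_le_iff.2 fun _ hx => K.pow_mem hx k

theorem map_powSubgroup {H : Type v} [Group H] (f : G →* H) (K : Subgroup G) (k : ℕ) :
    (powSubgroup K k).map f = powSubgroup (K.map f) k := by
  apply le_antisymm
  · rw [Subgroup.map_le_iff_le_comap, powSubgroup_le_iff]
    intro x hx
    rw [Subgroup.mem_comap, map_pow]
    exact pow_mem_powSubgroup (Subgroup.mem_map_of_mem f hx) k
  · rw [powSubgroup_le_iff]
    rintro _ ⟨x, hx, rfl⟩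
    rw [← map_pow]
    exact Subgroup.mem_map_of_mem f (pow_mem_powSubgroup hx k)

instance powSubgroup_normal (K : Subgroup G) [hK : K.Normal] (k : ℕ) :
    (powSubgroup K k).Normal where
  conj_mem x hx g := by
    have h1 : (powSubgroup K k).map (MulAut.conj g).toMonoidHom ≤ powSubgroup K k := by
      rw [map_powSubgroup]
      apply powSubgroup_mono
      rintro _ ⟨y, hy, rfl⟩
      exact hK.conj_mem y hy g
    exact h1 ⟨x, hx, rfl⟩

theorem mem_centerPow_iff {p : ℕ} {x : G} :
    x ∈ centerPow p G ↔ ∃ y ∈ Subgroup.center G, y ^ p = x := by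
  refine ⟨fun hx => ?_, fun ⟨y, hy, h⟩ => h ▸ pow_mem_powSubgroup hy p⟩
  induction hx using Subgroup.closure_induction with
  | mem x hx => exact hx
  | one => exact ⟨1, Subgroup.one_mem _, one_pow p⟩
  | mul x y _ _ hx hy =>
    obtain ⟨z, hz, rfl⟩ := hx
    obtain ⟨w, hw, rfl⟩ := hy
    exact ⟨z * w, Subgroup.mul_mem _ hz hw,
      Commute.mul_pow (Subgroup.mem_center_iff.1 hw z) p⟩
  | inv x _ hx =>
    obtain ⟨z, hz, rfl⟩ := hx
    exact ⟨z⁻¹, Subgroup.inv_mem _ hz, inv_pow z p⟩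

/-! ### Groups of rank two -/

theorem hasRankTwo_iff [Finite G] :
    HasRankTwo G ↔ (∃ a b : G, Subgroup.closure {a, b} = ⊤) ∧ ¬ IsCyclic G := by
  classical
  constructor
  · rintro ⟨hfg, h⟩
    refine ⟨?_, fun hc => ?_⟩
    · obtain ⟨S, hS, hgen⟩ := Group.rank_spec G
      obtain ⟨a, b, -, rfl⟩ := Finset.card_eq_two.1 (hS.trans h)
      exact ⟨a, b, by simpa using hgen⟩
    · obtain ⟨g, hg⟩ := hc.exists_generator
      have : Subgroup.closure (({g} : Finset G) : Set G) = ⊤ := by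
        rw [Finset.coe_singleton, ← Subgroup.zpowers_eq_closure]
        exact (Subgroup.eq_top_iff' _).2 hg
      have := Group.rank_le this
      rw [Finset.card_singleton] at this
      omega
  · rintro ⟨⟨a, b, hab⟩, hc⟩
    refine ⟨inferInstance, le_antisymm ?_ ?_⟩
    · have : Subgroup.closure (({a, b} : Finset G) : Set G) = ⊤ := by simpa using hab
      exact (Group.rank_le this).trans Finset.card_le_two
    · by_contra! hlt
      obtain ⟨S, hS, hgen⟩ := Group.rank_spec G
      obtain ⟨g, hg⟩ := Finset.card_le_one_iff_subset_singleton.1 (show S.card ≤ 1 by omega)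
      refine hc ⟨g, fun x => ?_⟩
      have h1 : Subgroup.closure (S : Set G) ≤ Subgroup.zpowers g := by
        rw [Subgroup.closure_le]
        intro y hy
        rw [Finset.mem_singleton.1 (hg hy)]
        exact Subgroup.mem_zpowers g
      exact h1 (hgen ▸ Subgroup.mem_top x)

theorem HasRankTwo.of_equiv {H : Type v} [Group H] (h : HasRankTwo G) (e : G ≃* H) :
    HasRankTwo H := by
  obtain ⟨hfg, h⟩ := h
  have hH : Group.FG H := Group.fg_of_surjective (f := e.toMonoidHom) e.surjective
  exact ⟨hH, (Group.rank_congr e).symm.trans h⟩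

theorem IsAbelian.of_equiv {H : Type v} [Group H] (h : IsAbelian G) (e : G ≃* H) :
    IsAbelian H := fun x y => e.symm.injective (by simp [h (e.symm x)])

end

/-! ### The centre of a metacyclic group and its direct descendant -/

namespace IsMetacyclicPair

variable {G : Type u} [Group G] {a b : G} {p n m l r : ℕ}

theorem hasRankTwo (hp : p.Prime) (h : IsMetacyclicPair p n m l r a b) (hr : 1 ≤ r) (hm : 1 ≤ m)
    (hl : 1 ≤ l) (hln : l ≤ n) : HasRankTwo G := by
  have := h.finite hp
  refine hasRankTwo_iff.2 ⟨⟨a, b, h.gen⟩, fun hc => ?_⟩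
  obtain ⟨g, hg⟩ := IsCyclic.exists_ofOrder_eq_natCard (α := G)
  -- A cyclic group has exponent equal to its order, but `max n (m + n - l) < n + m`.
  have h1 := (h.forall_pow_eq_one_iff hp hr hln (max n (m + n - l))).2 (by omega) g
  rw [← orderOf_dvd_iff_pow_eq_one, hg, h.card_eq hp, Nat.pow_dvd_pow_iff_le_right hp.one_lt] at h1
  omega

theorem isPowerfullyNilpotent (hp : p.Prime) (h : IsMetacyclicPair p n m l r a b) (hr : 2 ≤ r) :
    IsPowerfullyNilpotent p G where
  finite := h.finite hp
  isPGroup := h.isPGroup hp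
  powerful := by
    rw [IsPowerful, h.commutator_eq hp, Subgroup.zpowers_le]
    obtain ⟨s, rfl⟩ : ∃ s, r = s + 2 := ⟨r - 2, by omega⟩
    split_ifs with h2
    · subst h2
      rw [pow_add, pow_mul]
      exact pow_mem_powSubgroup (Subgroup.mem_top _) _
    · rw [show s + 2 = (s + 1) + 1 by omega, pow_succ, pow_mul]
      exact pow_mem_powSubgroup (Subgroup.mem_top _) _
  chain := by
    have hpow : ∀ t s : ℕ, t < s →
        Subgroup.zpowers (a ^ p ^ s) ≤ powSubgroup (Subgroup.zpowers (a ^ p ^ t)) p := by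
      intro t s hts
      obtain ⟨k, rfl⟩ : ∃ k, s = t + k + 1 := ⟨s - t - 1, by omega⟩
      rw [Subgroup.zpowers_le, pow_succ, pow_mul, pow_add, pow_mul]
      exact pow_mem_powSubgroup (Subgroup.pow_mem _ (Subgroup.mem_zpowers _) _) p
    -- The chain climbs through the subgroups `⟨a^{p^{n-i}}⟩` up to `⟨a⟩` and ends with `G`.
    refine ⟨n + 1, fun i => if i ≤ n then Subgroup.zpowers (a ^ p ^ (n - i)) else ⊤, ?_, ?_, ?_⟩
    · simp [h.pow_a]
    · simp
    · intro i hi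
      beta_reduce
      rw [if_pos (show i ≤ n by omega)]
      rcases (show i ≤ n by omega).eq_or_lt with rfl | hlt
      · rw [if_neg (by omega), ← commutator_def, h.commutator_eq hp]
        exact ⟨le_top, hpow _ _ (by omega)⟩
      · rw [if_pos (by omega)]
        obtain ⟨t, ht⟩ : ∃ t, n - i = t + 1 := ⟨n - i - 1, by omega⟩
        rw [ht, show n - (i + 1) = t by omega]
        constructor
        · rw [Subgroup.zpowers_le, pow_succ, pow_mul]
          exact Subgroup.pow_mem _ (Subgroup.mem_zpowers _) _
        · refine le_trans ?_ (hpow (t + 1) (t + 2) (by omega))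
          have hN := zpowers_pow_normal (h.normal hp) (p ^ (t + 2))
          set K := Subgroup.zpowers (a ^ p ^ (t + 2)) with hK
          -- Moving `a^{p^t}` past `b` costs `a^{p^{t+r}}`, which lies in `K` because `r ≥ 2`.
          have hc : ((a ^ p ^ t : G) : G ⧸ K) ∈ Subgroup.center (G ⧸ K) := by
            rw [mem_center_iff_of_closure_pair (closure_pair_map (QuotientGroup.mk' K)
              (QuotientGroup.mk'_surjective K) h.gen)]
            simp only [QuotientGroup.mk'_apply]
            rw [← QuotientGroup.mk_mul, ← QuotientGroup.mk_mul, ← QuotientGroup.mk_mul,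
              ← QuotientGroup.mk_mul]
            refine ⟨by rw [← pow_succ, ← pow_succ'], ?_⟩
            have h1 := pow_mul_pow_of_comm h.comm (p ^ t) 1
            simp only [pow_one] at h1
            rw [h1, QuotientGroup.eq]
            obtain ⟨q, rfl⟩ : ∃ q, r = q + 2 := ⟨r - 2, by omega⟩
            rw [mul_add, mul_one, pow_add, ← mul_assoc b, inv_mul_cancel_left,
              show p ^ t * p ^ (q + 2) = p ^ (t + 2) * p ^ q by ring, pow_mul]
            exact Subgroup.pow_mem _ (Subgroup.mem_zpowers _) _
          rw [Subgroup.commutator_le]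
          rintro _ ⟨k, rfl⟩ g -
          have h2 := Subgroup.mem_center_iff.1 (Subgroup.zpow_mem _ hc k) g
          rw [← QuotientGroup.eq_one_iff, ← QuotientGroup.mk'_apply, map_commutatorElement,
            commutatorElement_eq_one_iff_mul_comm]
          exact h2.symm

/-- The two generators give separate conditions: commuting with `a` means `(1 + p^r)^j ≡ 1` modulo
`p^n`, commuting with `b` means `p^n ∣ i p^r`. -/
theorem mem_center_iff (hp : p.Prime) (h : IsMetacyclicPair p n m l r a b) (hr : 2 ≤ r)
    (hrn : r ≤ n) (j i : ℕ) :
    b ^ j * a ^ i ∈ Subgroup.center G ↔ p ^ (n - r) ∣ j ∧ p ^ (n - r) ∣ i := by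
  rw [mem_center_iff_of_closure_pair h.gen]
  refine and_congr ?_ ?_
  · have h1 := pow_mul_pow_of_comm h.comm 1 j
    rw [pow_one, one_mul] at h1
    rw [← mul_assoc, h1, mul_assoc, mul_assoc, mul_right_inj, ← pow_add, ← pow_succ, add_comm i,
      pow_eq_pow_iff_modEq, h.orderOf_left]
    have h2 := one_add_pow_modEq_one_iff (w := 1) hp hr hrn hp.not_dvd_one j
    rw [mul_one] at h2
    rw [← h2]
    exact ⟨fun h3 => Nat.ModEq.add_right_cancel' i h3, fun h3 => h3.add_right i⟩
  · have h1 := pow_mul_pow_of_comm h.comm i 1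
    rw [pow_one, pow_one] at h1
    rw [mul_assoc, h1, ← mul_assoc, ← mul_assoc, ← pow_succ, ← pow_succ', mul_right_inj, mul_add,
      mul_one, pow_add, left_eq_mul, h.pow_eq_one_iff]
    conv_lhs => rw [show n = (n - r) + r by omega, pow_add]
    exact Nat.mul_dvd_mul_iff_right (pow_pos hp.pos r)

theorem mem_centerPow_iff (hp : p.Prime) (h : IsMetacyclicPair p n m l r a b) (hr : 2 ≤ r)
    (hrn : r ≤ n) {x : G} :
    x ∈ centerPow p G ↔
      ∃ j i : ℕ, x = b ^ (p ^ (n - r + 1) * j) * a ^ (p ^ (n - r + 1) * i) := by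
  have hc : ∀ j i : ℕ, (b ^ (p ^ (n - r) * j) * a ^ (p ^ (n - r) * i)) ^ p =
      b ^ (p ^ (n - r + 1) * j) * a ^ (p ^ (n - r + 1) * i) := by
    intro j i
    have h1 : a ^ (p ^ (n - r) * i) ∈ Subgroup.center G := by
      have := (h.mem_center_iff hp hr hrn 0 (p ^ (n - r) * i)).2 ⟨dvd_zero _, dvd_mul_right _ _⟩
      simpa using this
    rw [Commute.mul_pow (Subgroup.mem_center_iff.1 h1 _), ← pow_mul, ← pow_mul]
    congr 2 <;> ring
  rw [_root_.mem_centerPow_iff]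
  constructor
  · rintro ⟨y, hy, rfl⟩
    obtain ⟨j, i, rfl⟩ := h.exists_eq hp y
    obtain ⟨⟨j', rfl⟩, ⟨i', rfl⟩⟩ := (h.mem_center_iff hp hr hrn _ _).1 hy
    exact ⟨j', i', hc j' i'⟩
  · rintro ⟨j, i, rfl⟩
    exact ⟨_, (h.mem_center_iff hp hr hrn _ _).2 ⟨dvd_mul_right _ _, dvd_mul_right _ _⟩, hc j i⟩

/-- `Z(G)^p` contains the `p^{n-r+1}`-th powers of `a` and `b`. If `l = n - r`, it also contains
`a^{p^l} = b^{p^m}`, since then `m ≥ n - r + 1`; this is the source of the minimum with `l`. The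
third parameter equals the first, so the quotient is split. -/
theorem quotient_centerPow (hp : p.Prime) (h : IsMetacyclicPair p n m l r a b) (hr : 2 ≤ r)
    (hrn : r < n) (hln : l ≤ n) (hlm : l < m ∨ l = n) :
    IsMetacyclicPair p (min (n - r + 1) l) (min m (n - r + 1)) (min (n - r + 1) l) r
      (a : G ⧸ centerPow p G) (b : G ⧸ centerPow p G) := by
  have hlr := h.le_add_of_comm hp
  have hmr := h.le_add_of_comm' hp hr hrn.le
  have hmem := fun x => h.mem_centerPow_iff hp hr hrn.le (x := x)
  have ha : ∀ s, n - r + 1 ≤ s → a ^ p ^ s ∈ centerPow p G := fun s hs =>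
    (hmem _).2 ⟨0, p ^ (s - (n - r + 1)), by
      rw [mul_zero, pow_zero, one_mul, ← pow_add]
      congr 2; omega⟩
  have hb : ∀ s, n - r + 1 ≤ s → b ^ p ^ s ∈ centerPow p G := fun s hs =>
    (hmem _).2 ⟨p ^ (s - (n - r + 1)), 0, by
      rw [mul_zero, pow_zero, mul_one, ← pow_add]
      congr 2; omega⟩
  have ha' : a ^ p ^ min (n - r + 1) l ∈ centerPow p G := by
    rcases le_or_gt (n - r + 1) l with h1 | h1
    · rw [min_eq_left h1]
      exact ha _ le_rfl
    · rw [min_eq_right h1.le, ← h.pow_b]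
      exact hb _ (by omega)
  have hb' : b ^ p ^ min m (n - r + 1) ∈ centerPow p G := by
    rcases le_or_gt (n - r + 1) m with h1 | h1
    · rw [min_eq_right h1]
      exact hb _ le_rfl
    · rw [min_eq_left h1.le, h.pow_b]
      exact ha _ (by omega)
  refine ⟨⟨closure_pair_map (QuotientGroup.mk' _) (QuotientGroup.mk'_surjective _) h.gen, ?_, ?_,
    ?_⟩, ?_, ?_⟩
  · rw [← QuotientGroup.mk_pow, QuotientGroup.eq_one_iff]
    exact ha'
  · rw [← QuotientGroup.mk_pow, ← QuotientGroup.mk_pow, (QuotientGroup.eq_one_iff _).2 ha',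
      (QuotientGroup.eq_one_iff _).2 hb']
  · rw [← QuotientGroup.mk_mul, h.comm, QuotientGroup.mk_mul, QuotientGroup.mk_pow]
  · intro i hi
    rw [← QuotientGroup.mk_pow, QuotientGroup.eq_one_iff, hmem] at hi
    obtain ⟨j, i', hi⟩ := hi
    have h1 : b ^ ((p ^ (n - r + 1) * j : ℕ) : ℤ) ∈ Subgroup.zpowers a := by
      rw [zpow_natCast, ← mul_inv_eq_iff_eq_mul.2 hi]
      exact Subgroup.mul_mem _ (Subgroup.pow_mem _ (Subgroup.mem_zpowers a) _)
        (Subgroup.inv_mem _ (Subgroup.pow_mem _ (Subgroup.mem_zpowers a) _))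
    obtain ⟨y, hy⟩ := Int.natCast_dvd_natCast.1 (h.dvd_of_pow_mem _ h1)
    rw [hy, pow_mul, h.pow_b, ← pow_mul, ← pow_add, pow_eq_pow_iff_modEq, h.orderOf_left] at hi
    refine ((hi.of_dvd (pow_dvd_pow p (?_ : min (n - r + 1) l ≤ n))).dvd_iff dvd_rfl).2 ?_
    · omega
    · exact dvd_add ((pow_dvd_pow p (min_le_right _ _)).mul_right _)
        ((pow_dvd_pow p (min_le_left _ _)).mul_right _)
  · rintro j ⟨k, hk⟩
    simp only [← QuotientGroup.mk_zpow] at hk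
    rw [QuotientGroup.eq] at hk
    obtain ⟨x, y, hxy⟩ := (hmem _).1 hk
    have hbx : b ^ (p ^ (n - r + 1) * x) ∈ Subgroup.center G := by
      apply centerPow_le_center p
      rw [pow_mul]
      exact Subgroup.pow_mem _ (hb _ le_rfl) _
    have h1 : b ^ (j - (p ^ (n - r + 1) * x : ℕ)) ∈ Subgroup.zpowers a := by
      refine ⟨k + (p ^ (n - r + 1) * y : ℕ), ?_⟩
      simp only
      rw [zpow_sub, zpow_add, zpow_natCast, zpow_natCast, eq_mul_inv_iff_mul_eq, mul_assoc,
        Subgroup.mem_center_iff.1 hbx, ← hxy, mul_inv_cancel_left]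
    have h2 := h.dvd_of_pow_mem _ h1
    have h3 : ((p ^ min m (n - r + 1) : ℕ) : ℤ) ∣ (p ^ m : ℕ) :=
      Int.natCast_dvd_natCast.2 (pow_dvd_pow _ (min_le_left _ _))
    have h4 : ((p ^ min m (n - r + 1) : ℕ) : ℤ) ∣ (p ^ (n - r + 1) * x : ℕ) :=
      Int.natCast_dvd_natCast.2 ((pow_dvd_pow _ (min_le_right _ _)).mul_right x)
    have := dvd_add (h3.trans h2) h4
    rwa [sub_add_cancel] at this

end IsMetacyclicPair

/-! ### Existence of groups with a metacyclic presentation -/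

theorem zpowers_normal_of_mem_center {G : Type u} [Group G] {z : G}
    (hz : z ∈ Subgroup.center G) : (Subgroup.zpowers z).Normal :=
  ⟨fun x hx g => by
    have hx' := Subgroup.zpowers_le.2 hz hx
    rw [Subgroup.mem_center_iff.1 hx' g, mul_inv_cancel_right]
    exact hx⟩

/-- The semidirect product of `ZMod N` by `ℤ`, where `1 : ℤ` acts as multiplication by `w`. -/
@[ext]
structure CyclicExtension (N : ℕ) (w : (ZMod N)ˣ) where
  fst : ℤ
  snd : ZMod N

namespace CyclicExtension

variable {N : ℕ} {w : (ZMod N)ˣ}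

instance : Mul (CyclicExtension N w) :=
  ⟨fun x y => ⟨x.fst + y.fst, x.snd * ((w ^ y.fst : (ZMod N)ˣ) : ZMod N) + y.snd⟩⟩

instance : One (CyclicExtension N w) := ⟨⟨0, 0⟩⟩

instance : Inv (CyclicExtension N w) :=
  ⟨fun x => ⟨-x.fst, -(x.snd * ((w ^ (-x.fst) : (ZMod N)ˣ) : ZMod N))⟩⟩

@[simp] theorem mul_fst (x y : CyclicExtension N w) : (x * y).fst = x.fst + y.fst := rfl
@[simp] theorem mul_snd (x y : CyclicExtension N w) :
    (x * y).snd = x.snd * ((w ^ y.fst : (ZMod N)ˣ) : ZMod N) + y.snd := rfl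
@[simp] theorem one_fst : (1 : CyclicExtension N w).fst = 0 := rfl
@[simp] theorem one_snd : (1 : CyclicExtension N w).snd = 0 := rfl
@[simp] theorem inv_fst (x : CyclicExtension N w) : x⁻¹.fst = -x.fst := rfl
@[simp] theorem inv_snd (x : CyclicExtension N w) :
    x⁻¹.snd = -(x.snd * ((w ^ (-x.fst) : (ZMod N)ˣ) : ZMod N)) := rfl

instance : Group (CyclicExtension N w) :=
  Group.ofLeftAxioms
    (fun x y z => by
      ext
      · simp [add_assoc]
      · simp [zpow_add, add_mul, mul_assoc, add_assoc])
    (fun x => by ext <;> simp)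
    (fun x => by
      ext
      · simp
      · simp [mul_assoc])

/-- The projection to `ℤ`. -/
def fstHom : CyclicExtension N w →* Multiplicative ℤ where
  toFun x := Multiplicative.ofAdd x.fst
  map_one' := rfl
  map_mul' _ _ := rfl

/-- The inclusion of `ℤ`. -/
def inlHom : Multiplicative ℤ →* CyclicExtension N w where
  toFun x := ⟨x.toAdd, 0⟩
  map_one' := rfl
  map_mul' x y := by ext <;> simp

/-- The inclusion of `ZMod N`. -/
def inrHom : Multiplicative (ZMod N) →* CyclicExtension N w where
  toFun x := ⟨0, x.toAdd⟩
  map_one' := rfl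
  map_mul' x y := by ext <;> simp

theorem inl_zpow (j : ℤ) : (⟨1, 0⟩ : CyclicExtension N w) ^ j = ⟨j, 0⟩ := by
  have h : (⟨1, 0⟩ : CyclicExtension N w) = inlHom (Multiplicative.ofAdd 1) := rfl
  rw [h, ← map_zpow, ← ofAdd_zsmul]
  ext <;> simp [inlHom]

theorem inl_pow (j : ℕ) : (⟨1, 0⟩ : CyclicExtension N w) ^ j = ⟨j, 0⟩ := by
  rw [← zpow_natCast, inl_zpow]

theorem inr_pow (i : ℕ) : (⟨0, 1⟩ : CyclicExtension N w) ^ i = ⟨0, i⟩ := by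
  have h : (⟨0, 1⟩ : CyclicExtension N w) = inrHom (Multiplicative.ofAdd 1) := rfl
  rw [h, ← map_pow, ← ofAdd_nsmul]
  ext <;> simp [inrHom]

theorem closure_eq_top [NeZero N] :
    Subgroup.closure {(⟨0, 1⟩ : CyclicExtension N w), ⟨1, 0⟩} = ⊤ := by
  rw [Subgroup.eq_top_iff']
  intro x
  have : x = ⟨1, 0⟩ ^ x.fst * ⟨0, 1⟩ ^ x.snd.val := by
    rw [inl_zpow, inr_pow]
    ext <;> simp
  rw [this]
  exact Subgroup.mul_mem _
    (Subgroup.zpow_mem _ (Subgroup.subset_closure (Set.mem_insert_of_mem _ (Set.mem_singleton _))) _)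
    (Subgroup.pow_mem _ (Subgroup.subset_closure (Set.mem_insert _ _)) _)

theorem zpow_fst (x : CyclicExtension N w) (t : ℤ) : (x ^ t).fst = x.fst * t := by
  have h2 := congrArg Multiplicative.toAdd (map_zpow (fstHom (N := N) (w := w)) x t)
  simp only [toAdd_zpow] at h2
  have h3 : (x ^ t).fst = t • x.fst := h2
  rw [h3, smul_eq_mul, mul_comm]

/-- The element is `b^P a^{-L}`. It commutes with `a` because `w^P = 1` and with `b` because `L w =
L`; killing it imposes `b^P = a^L`. -/
theorem mk_mem_center [NeZero N] {P L : ℕ} (hP : w ^ (P : ℤ) = 1)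
    (hL : (L : ZMod N) * w = L) :
    (⟨P, -L⟩ : CyclicExtension N w) ∈ Subgroup.center (CyclicExtension N w) := by
  rw [mem_center_iff_of_closure_pair closure_eq_top]
  constructor
  · ext
    · simp
    · simp only [mul_snd, hP]
      simp [add_comm]
  · ext
    · simp [add_comm]
    · simp only [mul_snd, hP, zpow_one, neg_mul, hL]
      simp

theorem isMetacyclicPair_quotient {p n m l r : ℕ} [NeZero (p ^ n)] (hp : p.Prime)
    {w : (ZMod (p ^ n))ˣ} (hw : (w : ZMod (p ^ n)) = ((1 + p ^ r : ℕ) : ZMod (p ^ n)))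
    (hP : w ^ ((p ^ m : ℕ) : ℤ) = 1) {z : CyclicExtension (p ^ n) w}
    (hz : z = ⟨(p ^ m : ℕ), -((p ^ l : ℕ) : ZMod (p ^ n))⟩) [(Subgroup.zpowers z).Normal] :
    IsMetacyclicPair p n m l r
      (QuotientGroup.mk' (Subgroup.zpowers z) ⟨0, 1⟩)
      (QuotientGroup.mk' (Subgroup.zpowers z) ⟨1, 0⟩) := by
  have hzpow : ∀ (x : CyclicExtension (p ^ n) w) (t : ℤ), z ^ t = x →
      x.fst = (p ^ m : ℕ) * t := by
    rintro x t rfl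
    rw [zpow_fst, hz]
  refine ⟨⟨closure_pair_map (QuotientGroup.mk' _) (QuotientGroup.mk'_surjective _)
    closure_eq_top, ?_, ?_, ?_⟩, ?_, ?_⟩
  · rw [← map_pow, inr_pow, ZMod.natCast_self]
    exact map_one _
  · rw [← map_pow, ← map_pow, eq_comm, QuotientGroup.mk'_apply, QuotientGroup.mk'_apply,
      QuotientGroup.eq, inr_pow, inl_pow]
    convert Subgroup.mem_zpowers z using 1
    ext
    · simp [hz]
    · simp only [mul_snd, inv_snd, hP]
      simp [hz]
  · rw [← map_pow, ← map_mul, ← map_mul, inr_pow]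
    congr 1
    ext
    · simp
    · simp only [mul_snd, zpow_one, hw]
      simp
  · intro i hi
    rw [← map_pow, QuotientGroup.mk'_apply, QuotientGroup.eq_one_iff, inr_pow] at hi
    obtain ⟨t, ht⟩ := hi
    have h1 := hzpow _ t ht
    -- The first coordinate of `z^t` is `p^m t`, so `⟨z⟩` meets the cyclic normal subgroup trivially
    -- and the order of `a` survives.
    have h2 : t = 0 := by
      have h3 : ((p ^ m : ℕ) : ℤ) ≠ 0 := by exact_mod_cast (pow_pos hp.pos m).ne'
      exact (mul_eq_zero.1 h1.symm).resolve_left h3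
    rw [h2] at ht
    have h4 := congrArg CyclicExtension.snd ht
    simp only [zpow_zero, one_snd] at h4
    exact (ZMod.natCast_eq_zero_iff _ _).1 h4.symm
  · rintro j ⟨k, hk⟩
    simp only [← map_zpow] at hk
    rw [QuotientGroup.mk'_apply, QuotientGroup.mk'_apply, QuotientGroup.eq] at hk
    obtain ⟨t, ht⟩ := hk
    have h1 := hzpow _ t ht
    rw [mul_fst, inv_fst, zpow_fst, inl_zpow, zero_mul, neg_zero, zero_add] at h1
    exact ⟨t, h1⟩

end CyclicExtension

/-- The two inequalities are what makes `b^{p^m} a^{-p^l}` central in the semidirect product. -/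
theorem exists_isMetacyclicPair {p n m l r : ℕ} (hp : p.Prime) (hr : 2 ≤ r) (hm : n ≤ m + r)
    (hl : n ≤ l + r) :
    ∃ (M : Type) (_ : Group M) (a b : M), IsMetacyclicPair p n m l r a b := by
  have : NeZero (p ^ n) := ⟨(pow_pos hp.pos n).ne'⟩
  have hcop : (1 + p ^ r).Coprime (p ^ n) := by
    apply Nat.Coprime.pow_right
    rw [Nat.coprime_comm, hp.coprime_iff_not_dvd,
      ← Nat.dvd_add_iff_left (dvd_pow_self p (by omega))]
    exact hp.not_dvd_one
  obtain ⟨w, hw⟩ : ∃ w : (ZMod (p ^ n))ˣ, (w : ZMod (p ^ n)) = ((1 + p ^ r : ℕ) : ZMod (p ^ n)) :=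
    ⟨ZMod.unitOfCoprime (1 + p ^ r) hcop, ZMod.coe_unitOfCoprime _ _⟩
  have hP : w ^ ((p ^ m : ℕ) : ℤ) = 1 := by
    rw [zpow_natCast]
    ext
    obtain ⟨w', h, -⟩ := exists_one_add_pow_prime_pow_eq (p := p) hr 1 m
    rw [mul_one] at h
    rw [Units.val_pow_eq_pow_val, hw, ← Nat.cast_pow, h, Nat.cast_add, Nat.cast_one,
      Units.val_one, add_eq_left, ZMod.natCast_eq_zero_iff]
    exact (pow_dvd_pow p (by omega)).mul_right _
  have hL : ((p ^ l : ℕ) : ZMod (p ^ n)) * w = (p ^ l : ℕ) := by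
    rw [hw, ← Nat.cast_mul, mul_add, ← pow_add, Nat.cast_add (p ^ l * 1),
      (ZMod.natCast_eq_zero_iff _ _).2 (pow_dvd_pow p hl), mul_one, add_zero]
  have := zpowers_normal_of_mem_center (CyclicExtension.mk_mem_center hP hL)
  exact ⟨_, inferInstance, _, _, CyclicExtension.isMetacyclicPair_quotient hp hw hP rfl⟩

/-! ### The presented groups -/

section
variable {p n m l r : ℕ} {G : Type u} [Group G] {a b : G}

theorem closure_of_fin_two (rels : Set (FreeGroup (Fin 2))) :
    Subgroup.closure {(PresentedGroup.of 0 : PresentedGroup rels), PresentedGroup.of 1} = ⊤ := by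
  rw [← PresentedGroup.closure_range_of rels]
  congr 1
  ext x
  simp [Fin.exists_fin_two, eq_comm]

theorem lift_mem_nonsplitRels (h : MetacyclicRel p n m l r a b) :
    ∀ x ∈ nonsplitRels p n m l r, FreeGroup.lift ![a, b] x = 1 := by
  rintro x (rfl | rfl | rfl)
  · simp [h.pow_a]
  · simp [h.pow_b]
  · simp only [map_mul, map_inv, map_pow, FreeGroup.lift_apply_of, Matrix.cons_val_zero,
      Matrix.cons_val_one]
    rw [mul_assoc _ a b, h.comm, pow_add, pow_one]
    group

theorem lift_mem_splitRels (h : MetacyclicRel p n m n r a b) :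
    ∀ x ∈ splitRels p n m r, FreeGroup.lift ![a, b] x = 1 := by
  rintro x (rfl | rfl | rfl)
  · simp [h.pow_a]
  · simp [h.pow_b, h.pow_a]
  · simp only [map_mul, map_inv, map_pow, FreeGroup.lift_apply_of, Matrix.cons_val_zero,
      Matrix.cons_val_one]
    rw [mul_assoc _ a b, h.comm, pow_add, pow_one]
    group

theorem comm_of_relator {c : ℕ} (h : a⁻¹ * b⁻¹ * a * b * (a ^ c)⁻¹ = 1) :
    a * b = b * a ^ (1 + c) := by
  rw [mul_inv_eq_one] at h
  rw [pow_add, pow_one, ← h]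
  group

theorem metacyclicRel_nonsplitGroup (p n m l r : ℕ) :
    MetacyclicRel p n m l r (PresentedGroup.of 0 : NonsplitGroup p n m l r)
      (PresentedGroup.of 1) where
  gen := closure_of_fin_two _
  pow_a := PresentedGroup.one_of_mem (rels := nonsplitRels p n m l r) (Or.inl rfl)
  pow_b := mul_inv_eq_one.1
    (PresentedGroup.one_of_mem (rels := nonsplitRels p n m l r) (Or.inr (Or.inl rfl)))
  comm := comm_of_relator
    (PresentedGroup.one_of_mem (rels := nonsplitRels p n m l r) (Or.inr (Or.inr rfl)))

theorem metacyclicRel_splitGroup (p n m r : ℕ) :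
    MetacyclicRel p n m n r (PresentedGroup.of 0 : SplitGroup p n m r)
      (PresentedGroup.of 1) where
  gen := closure_of_fin_two _
  pow_a := PresentedGroup.one_of_mem (rels := splitRels p n m r) (Or.inl rfl)
  pow_b := (PresentedGroup.one_of_mem (rels := splitRels p n m r) (Or.inr (Or.inl rfl))).trans
    (PresentedGroup.one_of_mem (rels := splitRels p n m r) (Or.inl rfl)).symm
  comm := comm_of_relator
    (PresentedGroup.one_of_mem (rels := splitRels p n m r) (Or.inr (Or.inr rfl)))

theorem IsMetacyclicPair.nonempty_equiv_presented (hp : p.Prime)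
    (h : IsMetacyclicPair p n m l r a b) {rels : Set (FreeGroup (Fin 2))}
    (hrel : MetacyclicRel p n m l r (PresentedGroup.of 0 : PresentedGroup rels)
      (PresentedGroup.of 1))
    (hlift : ∀ x ∈ rels, FreeGroup.lift ![a, b] x = 1) :
    Nonempty (G ≃* PresentedGroup rels) := by
  have ha : PresentedGroup.toGroup hlift (PresentedGroup.of 0) = a := by simp
  have hb : PresentedGroup.toGroup hlift (PresentedGroup.of 1) = b := by simp
  refine ⟨(MulEquiv.ofBijective (PresentedGroup.toGroup hlift)
    ⟨hrel.injective hp _ (by rwa [ha, hb]), ?_⟩).symm⟩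
  rw [← MonoidHom.range_eq_top, eq_top_iff, ← h.gen, Subgroup.closure_le]
  rintro x (rfl | rfl)
  · exact ⟨_, ha⟩
  · exact ⟨_, hb⟩

end

/-- `G` has a metacyclic pair of generators with the parameters `n`, `m`, `l`, `r`. -/
def HasMetacyclicPair (p n m l r : ℕ) (G : Type u) [Group G] : Prop :=
  ∃ a b : G, IsMetacyclicPair p n m l r a b

section
variable {p n m l r : ℕ} {G : Type u} [Group G]

theorem HasMetacyclicPair.of_equiv {H : Type v} [Group H] (h : HasMetacyclicPair p n m l r G)
    (e : G ≃* H) : HasMetacyclicPair p n m l r H := by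
  obtain ⟨a, b, h⟩ := h
  exact ⟨e a, e b, h.map_equiv e⟩

theorem hasMetacyclicPair_nonsplitGroup (hp : p.Prime) (hr : 2 ≤ r) (hm : n ≤ m + r)
    (hl : n ≤ l + r) : HasMetacyclicPair p n m l r (NonsplitGroup p n m l r) := by
  obtain ⟨M, _, a, b, h⟩ := exists_isMetacyclicPair hp hr hm hl
  have hlift := lift_mem_nonsplitRels h.toMetacyclicRel
  exact ⟨_, _, (metacyclicRel_nonsplitGroup p n m l r).of_map (PresentedGroup.toGroup hlift)
    (by simpa using h)⟩

theorem hasMetacyclicPair_splitGroup (hp : p.Prime) (hr : 2 ≤ r) (hm : n ≤ m + r) :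
    HasMetacyclicPair p n m n r (SplitGroup p n m r) := by
  obtain ⟨M, _, a, b, h⟩ := exists_isMetacyclicPair hp hr hm (show n ≤ n + r by omega)
  have hlift := lift_mem_splitRels h.toMetacyclicRel
  exact ⟨_, _, (metacyclicRel_splitGroup p n m r).of_map (PresentedGroup.toGroup hlift)
    (by simpa using h)⟩

theorem nonempty_equiv_nonsplitGroup_iff (hp : p.Prime) (hr : 2 ≤ r) (hm : n ≤ m + r)
    (hl : n ≤ l + r) :
    Nonempty (G ≃* NonsplitGroup p n m l r) ↔ HasMetacyclicPair p n m l r G :=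
  ⟨fun ⟨e⟩ => (hasMetacyclicPair_nonsplitGroup hp hr hm hl).of_equiv e.symm,
    fun ⟨_, _, h⟩ => h.nonempty_equiv_presented hp (metacyclicRel_nonsplitGroup p n m l r)
      (lift_mem_nonsplitRels h.toMetacyclicRel)⟩

theorem nonempty_equiv_splitGroup_iff (hp : p.Prime) (hr : 2 ≤ r) (hm : n ≤ m + r) :
    Nonempty (G ≃* SplitGroup p n m r) ↔ HasMetacyclicPair p n m n r G :=
  ⟨fun ⟨e⟩ => (hasMetacyclicPair_splitGroup hp hr hm).of_equiv e.symm,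
    fun ⟨_, _, h⟩ => h.nonempty_equiv_presented hp (metacyclicRel_splitGroup p n m r)
      (lift_mem_splitRels h.toMetacyclicRel)⟩

end

/-! ### Generators of finite `p`-groups -/

section
variable {G : Type u} [Group G] {p : ℕ}

theorem mem_of_pow_mem_of_coprime {K : Subgroup G} {x : G} {i j : ℕ} (hi : x ^ i ∈ K)
    (hj : x ^ j ∈ K) (hij : i.Coprime j) : x ∈ K := by
  obtain ⟨s, t, hst⟩ := Nat.isCoprime_iff_coprime.2 hij
  have : x = (x ^ i) ^ s * (x ^ j) ^ t := by
    rw [← zpow_natCast, ← zpow_natCast, ← zpow_mul, ← zpow_mul, ← zpow_add, mul_comm _ s,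
      mul_comm _ t, hst, zpow_one]
  rw [this]
  exact K.mul_mem (K.zpow_mem hi s) (K.zpow_mem hj t)

theorem IsPGroup.mem_zpowers_pow (hG : IsPGroup p G) {k : ℕ} (hk : k.Coprime p) (x : G) :
    x ∈ Subgroup.zpowers (x ^ k) := by
  obtain ⟨e, he⟩ := hG x
  exact mem_of_pow_mem_of_coprime (Subgroup.mem_zpowers _) (by rw [he]; exact Subgroup.one_mem _)
    (hk.pow_right e)

/-- Otherwise `M` and `x^p` generate `G`, so `x ≡ x^{pk}` modulo the normal subgroup `M`. The order
of `x` modulo `M` is a power of `p` dividing `1 - pk`, hence is `1`. -/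
theorem IsPGroup.pow_mem_of_isCoatom [Finite G] (hp : p.Prime) (hG : IsPGroup p G)
    {M : Subgroup G} (hM : IsCoatom M) (x : G) : x ^ p ∈ M := by
  have := Fact.mk hp
  have := hG.isNilpotent
  have hN : M.Normal :=
    Subgroup.NormalizerCondition.normal_of_coatom _ Group.normalizerCondition_of_isNilpotent hM
  by_contra hx
  have hlt : M < (Subgroup.zpowers (QuotientGroup.mk' M (x ^ p))).comap (QuotientGroup.mk' M) := by
    refine lt_of_le_of_ne (fun y hy => ?_) (fun h => hx ?_)
    · have hy1 : QuotientGroup.mk' M y = 1 := (QuotientGroup.eq_one_iff y).2 hy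
      rw [Subgroup.mem_comap, hy1]
      exact Subgroup.one_mem _
    · rw [h, Subgroup.mem_comap]
      exact Subgroup.mem_zpowers _
  have htop := hM.2 _ hlt
  have hxm : x ∈ (Subgroup.zpowers (QuotientGroup.mk' M (x ^ p))).comap (QuotientGroup.mk' M) := by
    rw [htop]
    trivial
  obtain ⟨k, hk⟩ := hxm
  have h1 : (QuotientGroup.mk' M x) ^ (1 - p * k : ℤ) = 1 := by
    rw [zpow_sub, zpow_one, zpow_mul, zpow_natCast, ← map_pow]
    simp only at hk
    rw [hk, mul_inv_cancel]
  obtain ⟨e, he⟩ := (IsPGroup.iff_orderOf.1 (hG.to_quotient M)) (QuotientGroup.mk' M x)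
  have h2 := orderOf_dvd_iff_zpow_eq_one.2 h1
  rw [he] at h2
  rcases Nat.eq_zero_or_pos e with rfl | hpos
  · rw [pow_zero, orderOf_eq_one_iff] at he
    exact hx (M.pow_mem ((QuotientGroup.eq_one_iff x).1 he) p)
  · have h3 : (p : ℤ) ∣ 1 - p * k :=
      (Int.natCast_dvd_natCast.2 (dvd_pow_self p hpos.ne')).trans h2
    have h4 := (dvd_sub_left (dvd_mul_right (p : ℤ) k)).1 h3
    exact hp.not_dvd_one (Int.natCast_dvd_natCast.1 (by simpa using h4))

theorem IsPGroup.eq_top_of_sup_powSubgroup [Finite G] (hp : p.Prime) (hG : IsPGroup p G)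
    {H : Subgroup G} (h : H ⊔ powSubgroup ⊤ p = ⊤) : H = ⊤ := by
  rcases eq_top_or_exists_le_coatom H with h1 | ⟨M, hM, hHM⟩
  · exact h1
  · refine absurd (top_le_iff.1 (h ▸ sup_le hHM ?_)) hM.1
    exact powSubgroup_le_iff.2 fun x _ => hG.pow_mem_of_isCoatom hp hM x

/-- Basis exchange in the elementary abelian group `G/G^p`: writing `c ≡ b^j a^i`, the element `b`
completes `c` if `p ∤ i`, and `a` does if `p ∤ j`. -/
theorem exists_closure_pair_eq_top [Finite G] (hp : p.Prime) (hG : IsPGroup p G) {a b c : G}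
    (hgen : Subgroup.closure {a, b} = ⊤) (hpow : commutator G ≤ powSubgroup ⊤ p)
    (hc : c ∉ powSubgroup (⊤ : Subgroup G) p) : ∃ d, Subgroup.closure {c, d} = ⊤ := by
  set Φ := powSubgroup (⊤ : Subgroup G) p with hΦ
  have hpΦ : ∀ x : G, x ^ p ∈ Φ := fun x => pow_mem_powSubgroup (Subgroup.mem_top x) p
  have hab : (a : G ⧸ Φ) * b = b * (a : G ⧸ Φ) ^ 1 := by
    rw [pow_one, ← commutatorElement_eq_one_iff_mul_comm]
    exact (QuotientGroup.eq_one_iff _).2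
      (hpow (Subgroup.commutator_mem_commutator (Subgroup.mem_top a) (Subgroup.mem_top b)))
  obtain ⟨j, i, hji⟩ := exists_eq_pow_mul_pow (closure_pair_map (QuotientGroup.mk' Φ)
    (QuotientGroup.mk'_surjective Φ) hgen) hab (isOfFinOrder_of_finite _)
    (isOfFinOrder_of_finite _) (c : G ⧸ Φ)
  simp only [QuotientGroup.mk'_apply, ← QuotientGroup.mk_pow, ← QuotientGroup.mk_mul] at hji
  have hmem := QuotientGroup.eq.1 hji
  have key : ∀ d, a ∈ Subgroup.closure {c, d} ⊔ Φ → b ∈ Subgroup.closure {c, d} ⊔ Φ →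
      Subgroup.closure {c, d} = ⊤ := by
    intro d had hbd
    apply hG.eq_top_of_sup_powSubgroup hp
    rw [← hΦ, eq_top_iff, ← hgen, Subgroup.closure_le]
    rintro x (rfl | rfl)
    · exact had
    · exact hbd
  have hcK : ∀ d, c ∈ Subgroup.closure {c, d} ⊔ Φ := fun d =>
    Subgroup.mem_sup_left (Subgroup.subset_closure (Set.mem_insert _ _))
  have hdK : ∀ d, d ∈ Subgroup.closure {c, d} ⊔ Φ := fun d =>
    Subgroup.mem_sup_left (Subgroup.subset_closure (Set.mem_insert_of_mem _ (Set.mem_singleton _)))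
  have hjiK : ∀ d, b ^ j * a ^ i ∈ Subgroup.closure {c, d} ⊔ Φ := fun d => by
    have := Subgroup.mul_mem _ (hcK d) (Subgroup.mem_sup_right hmem)
    rwa [mul_inv_cancel_left] at this
  by_cases hi : p ∣ i
  · by_cases hj : p ∣ j
    · exfalso
      obtain ⟨i', rfl⟩ := hi
      obtain ⟨j', rfl⟩ := hj
      have h1 : b ^ (p * j') * a ^ (p * i') ∈ Φ := by
        rw [pow_mul, pow_mul]
        exact Φ.mul_mem (Φ.pow_mem (hpΦ _) _) (Φ.pow_mem (hpΦ _) _)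
      have h2 := Φ.mul_mem hmem (Φ.inv_mem h1)
      rw [mul_inv_cancel_right] at h2
      exact hc (inv_mem_iff.1 h2)
    · refine ⟨a, key a (hdK a) (mem_of_pow_mem_of_coprime (i := j) (j := p) ?_
        (Subgroup.mem_sup_right (hpΦ b)) ((hp.coprime_iff_not_dvd.2 hj).symm))⟩
      have := Subgroup.mul_mem _ (hjiK a) (Subgroup.inv_mem _ (Subgroup.pow_mem _ (hdK a) i))
      rwa [mul_inv_cancel_right] at this
  · refine ⟨b, key b (mem_of_pow_mem_of_coprime (i := i) (j := p) ?_
        (Subgroup.mem_sup_right (hpΦ a)) ((hp.coprime_iff_not_dvd.2 hi).symm)) (hdK b)⟩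
    have := Subgroup.mul_mem _ (Subgroup.inv_mem _ (Subgroup.pow_mem _ (hdK b) j)) (hjiK b)
    rwa [inv_mul_cancel_left] at this

/-! ### The commutator subgroup of a two-generator powerfully nilpotent group -/

theorem IsPowerful.commutator_le (h : IsPowerful p G) :
    commutator G ≤ powSubgroup ⊤ p := by
  refine le_trans h (powSubgroup_le_iff.2 fun x _ => ?_)
  split_ifs with h2
  · subst h2
    rw [show 4 = 2 * 2 by rfl, pow_mul]
    exact pow_mem_powSubgroup (Subgroup.mem_top _) _
  · exact pow_mem_powSubgroup (Subgroup.mem_top _) _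

/-- Take the first term `H i` of the chain not contained in `G^p`, and `c` in it outside `G^p`. Then
`c` and some `d` generate `G`, and `[c,d]` lies in `(H (i-1))^p ≤ (G^p)^p`; with two generators this
one commutator controls `G'`. -/
theorem IsPowerfullyNilpotent.commutator_le (hp : p.Prime) (h : IsPowerfullyNilpotent p G)
    {a b : G} (hgen : Subgroup.closure {a, b} = ⊤) :
    commutator G ≤ powSubgroup (powSubgroup ⊤ p) p := by
  have := h.finite
  have hpow := h.powerful.commutator_le
  obtain ⟨k, H, h0, hk, hstep⟩ := h.chain
  by_cases hall : ∃ i, i ≤ k ∧ ¬ H i ≤ powSubgroup ⊤ p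
  · classical
    obtain ⟨hik, hi⟩ := Nat.find_spec hall
    have hmin := fun j => Nat.find_min hall (m := j)
    set i := Nat.find hall
    obtain ⟨j, hj⟩ : ∃ j, i = j + 1 := by
      refine Nat.exists_eq_succ_of_ne_zero fun h1 => hi ?_
      rw [h1, h0]
      exact bot_le
    have hHj : H j ≤ powSubgroup ⊤ p := by
      by_contra h1
      exact hmin j (by omega) ⟨by omega, h1⟩
    obtain ⟨c, hcH, hc⟩ := Set.not_subset.1 hi
    obtain ⟨d, hd⟩ := exists_closure_pair_eq_top hp h.isPGroup hgen hpow hc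
    refine commutator_le_of_closure_pair hd _ ?_
    rw [hj] at hcH
    exact powSubgroup_mono hHj p
      ((hstep j (by omega)).2 (Subgroup.commutator_mem_commutator hcH (Subgroup.mem_top d)))
  · push Not at hall
    -- If no term leaves `G^p`, then `G = G^p`, which is possible only for the trivial group.
    have h1 := hall k le_rfl
    rw [hk, top_le_iff] at h1
    have h2 := h.isPGroup.eq_top_of_sup_powSubgroup hp (H := ⊥) (by rw [h1, bot_sup_eq])
    exact le_top.trans (h2 ▸ bot_le)

theorem IsPGroup.exists_mem_center_of_normal [Finite G] (hp : p.Prime) (hG : IsPGroup p G)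
    (N : Subgroup G) [N.Normal] (hN : N ≠ ⊥) :
    ∃ z ∈ N, z ∈ Subgroup.center G ∧ z ≠ 1 ∧ z ^ p = 1 := by
  have := Fact.mk hp
  have hdvd : p ∣ Nat.card N := by
    have := (Subgroup.nontrivial_iff_ne_bot N).2 hN
    obtain ⟨n, hn0, hn⟩ := (hG.to_subgroup N).nontrivial_iff_card.mp inferInstance
    exact hn.symm ▸ dvd_pow_self _ (ne_of_gt hn0)
  obtain ⟨y, hy, hy1⟩ :=
    (hG.of_equiv ConjAct.toConjAct).exists_fixed_point_of_prime_dvd_card_of_fixed_point N hdvd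
      (a := 1) (fun g => by simp)
  have hyc : (y : G) ∈ Subgroup.center G := by
    rw [Subgroup.mem_center_iff]
    intro g
    have h1 := congrArg Subtype.val (hy (ConjAct.toConjAct g))
    rw [ConjAct.Subgroup.val_conj_smul, ConjAct.toConjAct_smul] at h1
    exact mul_inv_eq_iff_eq_mul.1 h1
  obtain ⟨e, he⟩ := IsPGroup.iff_orderOf.1 hG (y : G)
  have he0 : e ≠ 0 := by
    rintro rfl
    rw [pow_zero, orderOf_eq_one_iff] at he
    exact hy1 (Subtype.ext he.symm)
  obtain ⟨t, rfl⟩ := Nat.exists_eq_succ_of_ne_zero he0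
  refine ⟨y ^ p ^ t, N.pow_mem y.2 _, Subgroup.pow_mem _ hyc _, fun h1 => ?_, ?_⟩
  · have h2 := orderOf_dvd_of_pow_eq_one h1
    rw [he, Nat.pow_dvd_pow_iff_le_right hp.one_lt] at h2
    omega
  · rw [← pow_mul, ← pow_succ, ← he, pow_orderOf_eq_one]

/-- `[G',G] (G')^p` -/
abbrev commutatorFrattini (p : ℕ) (G : Type u) [Group G] : Subgroup G :=
  ⁅commutator G, ⊤⁆ ⊔ powSubgroup (commutator G) p

theorem map_commutator_top {H : Type v} [Group H] (f : G →* H) (hf : Function.Surjective f) :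
    (commutator G).map f = commutator H := by
  rw [commutator_def, Subgroup.map_commutator, Subgroup.map_top_of_surjective f hf, commutator_def]

theorem map_commutatorFrattini {H : Type v} [Group H] (f : G →* H) (hf : Function.Surjective f) :
    (commutatorFrattini p G).map f = commutatorFrattini p H := by
  rw [Subgroup.map_sup, map_powSubgroup, Subgroup.map_commutator, map_commutator_top f hf,
    Subgroup.map_top_of_surjective f hf]

/-- Induction on the order through `G/⟨z⟩`, with `z ∈ G'` central of order `p`. It gives `G' ≤
⟨c^{p^s}⟩⟨z⟩`; since `p`-th powers forget `z`, the subgroup `⟨c^{p^s}⟩` is normal and absorbs both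
`[G',G]` and `(G')^p`. -/
theorem commutator_le_zpowers_of_le_sup (hp : p.Prime) (N : ℕ) :
    ∀ (G : Type u) [Group G] [Finite G], Nat.card G = N → IsPGroup p G →
      ∀ (c d : G) (s : ℕ), 1 ≤ s → Subgroup.closure {c, d} = ⊤ →
      commutator G ≤ Subgroup.zpowers (c ^ p ^ s) ⊔ commutatorFrattini p G →
      commutator G ≤ Subgroup.zpowers (c ^ p ^ s) := by
  induction N using Nat.strong_induction_on with
  | _ N ih =>
  intro G _ _ hcard hG c d s hs hgen hle
  by_cases hbot : commutator G = ⊥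
  · rw [hbot]
    exact bot_le
  obtain ⟨z, hzG, hzc, hz1, hzp⟩ := hG.exists_mem_center_of_normal hp _ hbot
  have hZ := zpowers_normal_of_mem_center hzc
  have hsurj := QuotientGroup.mk'_surjective (Subgroup.zpowers z)
  have hIH := ih (Nat.card (G ⧸ Subgroup.zpowers z)) (by
    rw [← hcard, Subgroup.card_eq_card_quotient_mul_card_subgroup (Subgroup.zpowers z)]
    refine lt_mul_of_one_lt_right Nat.card_pos ?_
    rw [Nat.card_zpowers]
    have := orderOf_pos z
    have := mt orderOf_eq_one_iff.1 hz1
    omega) (G ⧸ Subgroup.zpowers z) rfl (hG.to_quotient _) (QuotientGroup.mk' _ c)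
    (QuotientGroup.mk' _ d) s hs (closure_pair_map _ hsurj hgen) (by
      rw [← map_commutator_top _ hsurj, ← map_commutatorFrattini _ hsurj, ← map_pow,
        ← MonoidHom.map_zpowers, ← Subgroup.map_sup]
      exact Subgroup.map_mono hle)
  have hform : ∀ x ∈ commutator G, ∃ y ∈ Subgroup.zpowers (c ^ p ^ s), ∃ t : ℤ, x = y * z ^ t := by
    intro x hx
    have h1 := hIH ((map_commutator_top _ hsurj) ▸ Subgroup.mem_map_of_mem _ hx)
    rw [← map_pow, ← MonoidHom.map_zpowers] at h1
    obtain ⟨y, hy, hxy⟩ := h1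
    obtain ⟨t, ht⟩ := QuotientGroup.eq.1 hxy
    simp only at ht
    exact ⟨y, hy, t, by rw [ht, mul_inv_cancel_left]⟩
  have hzz : ∀ t : ℤ, z ^ t ∈ Subgroup.center G := fun t => Subgroup.zpow_mem _ hzc t
  have hpow : ∀ (y : G) (t : ℤ) (k : ℕ), 1 ≤ k → (y * z ^ t) ^ p ^ k = y ^ p ^ k := by
    intro y t k hk
    rw [Commute.mul_pow (Subgroup.mem_center_iff.1 (hzz t) y), ← zpow_natCast (z ^ t), ← zpow_mul,
      mul_comm, zpow_mul, zpow_natCast, show k = 1 + (k - 1) by omega, pow_add p, pow_one,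
      pow_mul z, hzp, one_pow, one_zpow, mul_one]
  have hN : (Subgroup.zpowers (c ^ p ^ s)).Normal := by
    refine normal_of_closure_pair hgen _ ?_ ?_
    · rintro _ ⟨k, rfl⟩
      have h1 : Commute c ((c ^ p ^ s) ^ k) := ((Commute.refl c).pow_right _).zpow_right k
      simp only
      rw [h1.eq, mul_inv_cancel_right]
      exact ⟨k, rfl⟩
    · rintro _ ⟨k, rfl⟩
      simp only
      rw [← conj_zpow, ← conj_pow]
      refine Subgroup.zpow_mem _ ?_ k
      obtain ⟨y, hy, t, hyt⟩ := hform ⁅d, c⁆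
        (Subgroup.commutator_mem_commutator (Subgroup.mem_top d) (Subgroup.mem_top c))
      -- The conjugate is `y z^t c` with commuting factors, and its `p^s`-th power is `y^{p^s}
      -- c^{p^s}` because `s ≥ 1`.
      have h1 : d * c * d⁻¹ = y * z ^ t * c := by
        rw [← hyt, commutatorElement_def, inv_mul_cancel_right]
      have h2 : Commute (y * z ^ t) c := by
        refine Commute.mul_left ?_ (Subgroup.mem_center_iff.1 (hzz t) c).symm
        obtain ⟨q, rfl⟩ := hy
        exact ((Commute.refl c).pow_left _).zpow_left q
      rw [h1, h2.mul_pow, hpow y t s hs]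
      exact Subgroup.mul_mem _ (Subgroup.pow_mem _ hy _) (Subgroup.mem_zpowers _)
  refine hle.trans (sup_le le_rfl (sup_le ?_ ?_))
  · rw [Subgroup.commutator_le]
    intro x hx g _
    obtain ⟨y, hy, t, rfl⟩ := hform x hx
    have h1 : ⁅y * z ^ t, g⁆ = y * (g * y⁻¹ * g⁻¹) := by
      rw [commutatorElement_def, mul_assoc y, ← Subgroup.mem_center_iff.1 (hzz t) g]
      group
    rw [h1]
    exact Subgroup.mul_mem _ hy (hN.conj_mem _ (Subgroup.inv_mem _ hy) g)
  · rw [powSubgroup_le_iff]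
    intro x hx
    obtain ⟨y, hy, t, rfl⟩ := hform x hx
    have := hpow y t 1 le_rfl
    rw [pow_one] at this
    rw [this]
    exact Subgroup.pow_mem _ hy p

end

/-! ### Groups whose commutators are central of order dividing `p` -/

section
variable {G : Type u} [Group G] {p : ℕ}

theorem exists_mul_pow_eq (hc : ∀ x y : G, ⁅x, y⁆ ∈ Subgroup.center G)
    (hcp : ∀ x y : G, ⁅x, y⁆ ^ p = 1) (x y : G) (k : ℕ) :
    ∃ e ∈ Subgroup.center G, e ^ p = 1 ∧ (x * y) ^ k = x ^ k * y ^ k * e := by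
  induction k with
  | zero => exact ⟨1, Subgroup.one_mem _, one_pow p, by simp⟩
  | succ k ih =>
    obtain ⟨e, he, hep, h⟩ := ih
    have hf := hc (y ^ k)⁻¹ x⁻¹
    refine ⟨⁅(y ^ k)⁻¹, x⁻¹⁆ * e, Subgroup.mul_mem _ hf he, ?_, ?_⟩
    · rw [Commute.mul_pow (Subgroup.mem_center_iff.1 he _), hcp, hep, one_mul]
    · have h1 : y ^ k * x = x * y ^ k * ⁅(y ^ k)⁻¹, x⁻¹⁆ := by
        rw [commutatorElement_def]
        group
      have h2 := Subgroup.mem_center_iff.1 hf y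
      rw [pow_succ (x * y), h, mul_assoc _ e, ← Subgroup.mem_center_iff.1 he (x * y), ← mul_assoc,
        ← mul_assoc, mul_assoc (x ^ k), h1, pow_succ x, pow_succ y]
      simp only [mul_assoc]
      rw [← mul_assoc _ y e, ← h2, mul_assoc y]

theorem pow_mem_center (hc : ∀ x y : G, ⁅x, y⁆ ∈ Subgroup.center G)
    (hcp : ∀ x y : G, ⁅x, y⁆ ^ p = 1) (x : G) : x ^ p ∈ Subgroup.center G := by
  rw [Subgroup.mem_center_iff]
  intro g
  rw [← mul_inv_eq_iff_eq_mul, ← conj_pow]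
  have h1 : g * x * g⁻¹ = ⁅g, x⁆ * x := by
    rw [commutatorElement_def, inv_mul_cancel_right]
  rw [h1, Commute.mul_pow (Subgroup.mem_center_iff.1 (hc g x) x).symm, hcp, one_mul]

theorem exists_eq_of_mem_powSubgroup (hc : ∀ x y : G, ⁅x, y⁆ ∈ Subgroup.center G)
    (hcp : ∀ x y : G, ⁅x, y⁆ ^ p = 1) {x : G} (hx : x ∈ powSubgroup (⊤ : Subgroup G) p) :
    ∃ y, ∃ e ∈ Subgroup.center G, e ^ p = 1 ∧ x = y ^ p * e := by
  induction hx using Subgroup.closure_induction with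
  | mem x hx =>
    obtain ⟨y, -, rfl⟩ := hx
    exact ⟨y, 1, Subgroup.one_mem _, one_pow p, (mul_one _).symm⟩
  | one => exact ⟨1, 1, Subgroup.one_mem _, one_pow p, by simp⟩
  | mul x y _ _ hx hy =>
    obtain ⟨x, e, he, hep, rfl⟩ := hx
    obtain ⟨y, f, hf, hfp, rfl⟩ := hy
    obtain ⟨q, hq, hqp, h⟩ := exists_mul_pow_eq hc hcp x y p
    have hef : e * f ∈ Subgroup.center G := Subgroup.mul_mem _ he hf
    refine ⟨x * y, q⁻¹ * (e * f), Subgroup.mul_mem _ (Subgroup.inv_mem _ hq) hef, ?_, ?_⟩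
    · rw [Commute.mul_pow (Subgroup.mem_center_iff.1 hef _), inv_pow, hqp,
        Commute.mul_pow (Subgroup.mem_center_iff.1 hf _), hep, hfp]
      simp
    · rw [h, mul_assoc (x ^ p * y ^ p), mul_inv_cancel_left, mul_assoc, mul_assoc, ← mul_assoc e,
        ← Subgroup.mem_center_iff.1 he, mul_assoc]
  | inv x _ hx =>
    obtain ⟨x, e, he, hep, rfl⟩ := hx
    refine ⟨x⁻¹, e⁻¹, Subgroup.inv_mem _ he, by rw [inv_pow, hep, inv_one], ?_⟩
    rw [mul_inv_rev, inv_pow, Subgroup.mem_center_iff.1 (Subgroup.inv_mem _ he)]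

/-- The `p^2`-th powers are closed under products: `(xy)^p = x^p y^p e` with `e` central and `e^p =
1`, and `y^p` is central. -/
theorem exists_eq_of_mem_powSubgroup_powSubgroup (hc : ∀ x y : G, ⁅x, y⁆ ∈ Subgroup.center G)
    (hcp : ∀ x y : G, ⁅x, y⁆ ^ p = 1) {x : G}
    (hx : x ∈ powSubgroup (powSubgroup (⊤ : Subgroup G) p) p) : ∃ y, y ^ p ^ 2 = x := by
  induction hx using Subgroup.closure_induction with
  | mem x hx =>
    obtain ⟨y, hy, rfl⟩ := hx
    obtain ⟨y, e, he, hep, rfl⟩ := exists_eq_of_mem_powSubgroup hc hcp hy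
    exact ⟨y, by rw [Commute.mul_pow (Subgroup.mem_center_iff.1 he _), hep, mul_one, ← pow_mul,
      sq]⟩
  | one => exact ⟨1, one_pow _⟩
  | mul x y _ _ hx hy =>
    obtain ⟨x, rfl⟩ := hx
    obtain ⟨y, rfl⟩ := hy
    obtain ⟨q, hq, hqp, h⟩ := exists_mul_pow_eq hc hcp x y p
    refine ⟨x * y, ?_⟩
    rw [sq, pow_mul, h, Commute.mul_pow (Subgroup.mem_center_iff.1 hq _), hqp, mul_one,
      Commute.mul_pow (Subgroup.mem_center_iff.1 (pow_mem_center hc hcp y) _), ← pow_mul, ← pow_mul]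
  | inv x _ hx =>
    obtain ⟨x, rfl⟩ := hx
    exact ⟨x⁻¹, inv_pow _ _⟩

/-- If `x = y^p e` with `e` central of order dividing `p`, then `y` replaces `x` and `s` increases
by one. The exponent `p^K` bounds `s` because `w ≠ 1`; `k` counts the remaining room. -/
theorem exists_pow_eq_notMem_powSubgroup (hc : ∀ x y : G, ⁅x, y⁆ ∈ Subgroup.center G)
    (hcp : ∀ x y : G, ⁅x, y⁆ ^ p = 1) {K : ℕ} (hK : ∀ x : G, x ^ p ^ K = 1) {w : G} (hw : w ≠ 1)
    (k : ℕ) : ∀ (x : G) (s : ℕ), K ≤ s + k → 2 ≤ s → x ^ p ^ s = w →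
      ∃ (c : G) (s : ℕ), 2 ≤ s ∧ c ^ p ^ s = w ∧ c ∉ powSubgroup (⊤ : Subgroup G) p := by
  induction k with
  | zero =>
    intro x s hs _ hx
    refine absurd ?_ hw
    rw [← hx, show s = K + (s - K) by omega, pow_add, pow_mul, hK, one_pow]
  | succ k ih =>
    intro x s hs h2 hx
    by_cases hxΦ : x ∈ powSubgroup (⊤ : Subgroup G) p
    · obtain ⟨y, e, he, hep, rfl⟩ := exists_eq_of_mem_powSubgroup hc hcp hxΦ
      refine ih y (s + 1) (by omega) (by omega) ?_
      rw [Commute.mul_pow (Subgroup.mem_center_iff.1 he _), show s = 1 + (s - 1) by omega,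
        pow_add p 1, pow_one, pow_mul e, hep, one_pow, mul_one, ← pow_mul] at hx
      rw [← hx]
      congr 1
      rw [show s + 1 = 1 + 1 + (s - 1) by omega, pow_add, pow_add, pow_one, mul_assoc]
    · exact ⟨x, s, h2, hx, hxΦ⟩

theorem exists_commutator_le_zpowers [Finite G] (hp : p.Prime) (hG : IsPGroup p G) {a b : G}
    (hgen : Subgroup.closure {a, b} = ⊤)
    (hpow : commutator G ≤ powSubgroup (powSubgroup ⊤ p) p) :
    ∃ (c d : G) (s : ℕ), 2 ≤ s ∧ Subgroup.closure {c, d} = ⊤ ∧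
      commutator G ≤ Subgroup.zpowers (c ^ p ^ s) := by
  have := Fact.mk hp
  set L := commutatorFrattini p G with hL
  have hsurj := QuotientGroup.mk'_surjective L
  have hab : ⁅a, b⁆ ∈ commutator G :=
    Subgroup.commutator_mem_commutator (Subgroup.mem_top a) (Subgroup.mem_top b)
  by_cases hw : QuotientGroup.mk' L ⁅a, b⁆ = 1
  -- Here `G'` is contained in `[G',G](G')^p`, so any generating pair and any `s ≥ 2` would do.
  · refine ⟨a, b, 2, le_rfl, hgen, commutator_le_zpowers_of_le_sup hp _ G rfl hG a b 2 (by omega)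
      hgen (le_trans ?_ le_sup_right)⟩
    exact commutator_le_of_closure_pair hgen _ ((QuotientGroup.eq_one_iff _).1 hw)
  have hc : ∀ x y : G ⧸ L, ⁅x, y⁆ ∈ Subgroup.center (G ⧸ L) := by
    intro x y
    obtain ⟨x, rfl⟩ := hsurj x
    obtain ⟨y, rfl⟩ := hsurj y
    rw [Subgroup.mem_center_iff]
    intro g
    obtain ⟨g, rfl⟩ := hsurj g
    rw [← map_commutatorElement, eq_comm, ← commutatorElement_eq_one_iff_mul_comm,
      ← map_commutatorElement]
    refine (QuotientGroup.eq_one_iff _).2 (Subgroup.mem_sup_left ?_)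
    exact Subgroup.commutator_mem_commutator
      (Subgroup.commutator_mem_commutator (Subgroup.mem_top x) (Subgroup.mem_top y))
      (Subgroup.mem_top g)
  have hcp : ∀ x y : G ⧸ L, ⁅x, y⁆ ^ p = 1 := by
    intro x y
    obtain ⟨x, rfl⟩ := hsurj x
    obtain ⟨y, rfl⟩ := hsurj y
    rw [← map_commutatorElement, ← map_pow]
    exact (QuotientGroup.eq_one_iff _).2 (Subgroup.mem_sup_right (pow_mem_powSubgroup
      (Subgroup.commutator_mem_commutator (Subgroup.mem_top x) (Subgroup.mem_top y)) p))
  have hwmem : QuotientGroup.mk' L ⁅a, b⁆ ∈ powSubgroup (powSubgroup (⊤ : Subgroup (G ⧸ L)) p) p := by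
    rw [← Subgroup.map_top_of_surjective _ hsurj, ← map_powSubgroup, ← map_powSubgroup]
    exact Subgroup.mem_map_of_mem _ (hpow hab)
  obtain ⟨y, hy⟩ := exists_eq_of_mem_powSubgroup_powSubgroup hc hcp hwmem
  obtain ⟨K, hK⟩ := IsPGroup.iff_card.1 (hG.to_quotient L)
  obtain ⟨c, s, hs, hcw, hcΦ⟩ := exists_pow_eq_notMem_powSubgroup hc hcp (K := K)
    (fun x => by rw [← hK]; exact pow_card_eq_one') hw K y 2 (by omega) le_rfl hy
  obtain ⟨c, rfl⟩ := hsurj c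
  have hcG : c ∉ powSubgroup (⊤ : Subgroup G) p := by
    intro h
    apply hcΦ
    rw [← Subgroup.map_top_of_surjective _ hsurj, ← map_powSubgroup]
    exact Subgroup.mem_map_of_mem _ h
  obtain ⟨d, hd⟩ := exists_closure_pair_eq_top hp hG hgen
    (hpow.trans (powSubgroup_le _ p)) hcG
  refine ⟨c, d, s, hs, hd, commutator_le_zpowers_of_le_sup hp _ G rfl hG c d s (by omega) hd ?_⟩
  have hNw : (Subgroup.zpowers (QuotientGroup.mk' L ⁅a, b⁆)).Normal := by
    apply zpowers_normal_of_mem_center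
    rw [map_commutatorElement]
    exact hc _ _
  refine (commutator_le_of_closure_pair hgen
    ((Subgroup.zpowers (QuotientGroup.mk' L ⁅a, b⁆)).comap (QuotientGroup.mk' L))
    (Subgroup.mem_zpowers _)).trans ?_
  intro x hx
  rw [Subgroup.mem_comap, ← hcw, ← map_pow, ← MonoidHom.map_zpowers] at hx
  obtain ⟨y, hy, hxy⟩ := hx
  have := Subgroup.mul_mem_sup hy (QuotientGroup.eq.1 hxy)
  rwa [mul_inv_cancel_left] at this

end

/-! ### Normalizing the parameters -/

/-- A pair of generators with `⟨a⟩` normal of order `p^n` and index `p^m`, and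
`[a,b] = a^{p^r w}`. -/
structure IsTwistedPair (p n m r w : ℕ) {G : Type u} [Group G] (a b : G) : Prop where
  gen : Subgroup.closure {a, b} = ⊤
  normal : (Subgroup.zpowers a).Normal
  orderOf_left : orderOf a = p ^ n
  comm : a * b = b * a ^ (1 + p ^ r * w)
  pow_mem : b ^ p ^ m ∈ Subgroup.zpowers a
  dvd_of_pow_mem : ∀ j : ℤ, b ^ j ∈ Subgroup.zpowers a → ((p ^ m : ℕ) : ℤ) ∣ j

section
variable {G : Type u} [Group G] {a b : G} {p n m l r w : ℕ}

theorem exists_dvd_add_mul {x N : ℕ} (hN : 0 < N) (h : x.Coprime N) (y : ℕ) :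
    ∃ z : ℕ, N ∣ y + z * x := by
  obtain ⟨s, t, hst⟩ := Nat.isCoprime_iff_coprime.2 h
  refine ⟨((-y * s) % N).toNat, Int.natCast_dvd_natCast.1 ?_⟩
  push_cast
  rw [Int.toNat_of_nonneg (Int.emod_nonneg _ (by exact_mod_cast hN.ne')), Int.emod_def]
  refine ⟨y * t - (-y * s / N) * x, ?_⟩
  linear_combination -(y : ℤ) * hst

theorem closure_pair_eq_top_of_mem {a' b' : G} (hgen : Subgroup.closure {a, b} = ⊤)
    (ha : a ∈ Subgroup.closure {a', b'}) (hb : b ∈ Subgroup.closure {a', b'}) :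
    Subgroup.closure {a', b'} = ⊤ := by
  rw [eq_top_iff, ← hgen, Subgroup.closure_le]
  rintro x (rfl | rfl)
  · exact ha
  · exact hb

theorem left_mem_closure_pair (a b : G) : a ∈ Subgroup.closure {a, b} :=
  Subgroup.subset_closure (Set.mem_insert _ _)

theorem right_mem_closure_pair (a b : G) : b ∈ Subgroup.closure {a, b} :=
  Subgroup.subset_closure (Set.mem_insert_of_mem _ (Set.mem_singleton _))

namespace IsTwistedPair

theorem exists_right_pow [Finite G] (hp : p.Prime) (hG : IsPGroup p G)
    (h : IsTwistedPair p n m r w a b) (hr : 2 ≤ r) (hrn : r < n) (hw : ¬ p ∣ w) :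
    ∃ k : ℕ, k.Coprime p ∧ IsTwistedPair p n m r 1 a (b ^ k) := by
  obtain ⟨k, hk, hmod⟩ := exists_coprime_one_add_pow_modEq hp hr hrn hw
  refine ⟨k, hk, ?_, h.normal, h.orderOf_left, ?_, ?_, fun j hj => ?_⟩
  · refine closure_pair_eq_top_of_mem h.gen (left_mem_closure_pair _ _) ?_
    exact Subgroup.zpowers_le.2 (right_mem_closure_pair a (b ^ k)) (hG.mem_zpowers_pow hk b)
  · have h1 := pow_mul_pow_of_comm h.comm 1 k
    rw [pow_one, one_mul] at h1
    rw [h1, mul_right_inj, pow_eq_pow_iff_modEq, h.orderOf_left, mul_one]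
    exact hmod
  · rw [pow_right_comm]
    exact Subgroup.pow_mem _ h.pow_mem k
  · rw [← zpow_natCast, ← zpow_mul] at hj
    refine IsCoprime.dvd_of_dvd_mul_left ?_ (h.dvd_of_pow_mem _ hj)
    exact Nat.isCoprime_iff_coprime.2 (hk.symm.pow_left m)

/-- After normalising `w` to `1`, replacing `d` by `d a^x` multiplies `d^{p^m}` by `a^{x p^m q}`
with `q` prime to `p`; hence a `p^m`-th power in `⟨a^{p^m}⟩` can be cancelled. -/
theorem hasMetacyclicPair_of_pow_mem [Finite G] (hp : p.Prime) (hG : IsPGroup p G)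
    (h : IsTwistedPair p n m r w a b) (hr : 2 ≤ r) (hrn : r < n) (hw : ¬ p ∣ w)
    (hb : b ^ p ^ m ∈ Subgroup.zpowers (a ^ p ^ m)) : HasMetacyclicPair p n m n r G := by
  obtain ⟨k, -, h⟩ := h.exists_right_pow hp hG hr hrn hw
  replace hb : (b ^ k) ^ p ^ m ∈ Subgroup.zpowers (a ^ p ^ m) := by
    rw [pow_right_comm]
    exact Subgroup.pow_mem _ hb k
  set d := b ^ k
  have hcomm := h.comm
  rw [mul_one] at hcomm
  obtain ⟨y, hy⟩ := (isOfFinOrder_of_finite (a ^ p ^ m)).mem_powers_iff_mem_zpowers.2 hb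
  simp only at hy
  obtain ⟨q, hq, hqp⟩ := geom_sum_one_add_prime_pow hp hr m
  obtain ⟨x, hx⟩ := exists_dvd_add_mul (pow_pos hp.pos n) (hqp.pow_right n) y
  have hpow : (d * a ^ x) ^ p ^ m = 1 := by
    have h1 := mul_pow_of_comm hcomm x 1 (p ^ m)
    rw [pow_one, pow_one, one_mul, hq] at h1
    rw [h1, ← hy, ← pow_mul, ← pow_add, ← orderOf_dvd_iff_pow_eq_one, h.orderOf_left]
    rw [show p ^ m * y + x * (p ^ m * q) = p ^ m * (y + x * q) by ring]
    exact hx.mul_left (p ^ m)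
  have hmemx : a ^ x ∈ Subgroup.zpowers a := Subgroup.pow_mem _ (Subgroup.mem_zpowers a) x
  have hone : a ^ p ^ n = 1 := by rw [← h.orderOf_left, pow_orderOf_eq_one]
  refine ⟨a, d * a ^ x, ⟨?_, hone, by rw [hpow, hone], ?_⟩, ?_, ?_⟩
  · refine closure_pair_eq_top_of_mem h.gen (left_mem_closure_pair _ _) ?_
    have := Subgroup.mul_mem _ (right_mem_closure_pair a (d * a ^ x))
      (Subgroup.inv_mem _ (Subgroup.pow_mem _ (left_mem_closure_pair a (d * a ^ x)) x))
    rwa [mul_inv_cancel_right] at this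
  · rw [← mul_assoc, hcomm, mul_assoc, mul_assoc, ← pow_add, ← pow_add, add_comm]
  · intro i hi
    rw [← h.orderOf_left]
    exact orderOf_dvd_of_pow_eq_one hi
  · intro j hj
    have := h.normal
    apply h.dvd_of_pow_mem
    rw [← QuotientGroup.eq_one_iff, QuotientGroup.mk_zpow] at hj ⊢
    rwa [QuotientGroup.mk_mul, (QuotientGroup.eq_one_iff _).2 hmemx, mul_one] at hj

/-- Passing from `a` to `a^v` leaves the action of `b` unchanged and absorbs the unit `v` into the
relation for `b^{p^m}`. -/
theorem isMetacyclicPair (hG : IsPGroup p G)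
    (h : IsTwistedPair p n m r 1 a b) {v : ℕ} (hv : v.Coprime p) (hb : b ^ p ^ m = a ^ (p ^ l * v)) :
    IsMetacyclicPair p n m l r (a ^ v) b := by
  have hcomm := h.comm
  rw [mul_one] at hcomm
  have hone : a ^ p ^ n = 1 := by rw [← h.orderOf_left, pow_orderOf_eq_one]
  refine ⟨⟨?_, ?_, ?_, ?_⟩, ?_, ?_⟩
  · refine closure_pair_eq_top_of_mem h.gen ?_ (right_mem_closure_pair _ _)
    exact Subgroup.zpowers_le.2 (left_mem_closure_pair (a ^ v) b) (hG.mem_zpowers_pow hv a)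
  · rw [pow_right_comm, hone, one_pow]
  · rw [hb, mul_comm, pow_mul]
  · have h1 := pow_mul_pow_of_comm hcomm v 1
    rw [pow_one, pow_one] at h1
    rw [h1, pow_mul]
  · intro i hi
    rw [← pow_mul] at hi
    have h1 := orderOf_dvd_of_pow_eq_one hi
    rw [h.orderOf_left] at h1
    exact (hv.symm.pow_left n).dvd_of_dvd_mul_left h1
  · intro j hj
    exact h.dvd_of_pow_mem j
      (Subgroup.zpowers_le.2 (Subgroup.pow_mem _ (Subgroup.mem_zpowers a) v) hj)

end IsTwistedPair

/-- When `l ≤ r`, the generator `a^{p^r}` of `G'` is a power of `b`, so `⟨b⟩` is normal and the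
generators may exchange roles. The last parameter stands for `-1` modulo the order of `b`, as
`[b,a]` is the inverse of `[a,b]`. -/
theorem IsMetacyclicPair.swap (hp : p.Prime) (h : IsMetacyclicPair p n m l r a b) (hlr : l ≤ r)
    (hlm : l < m) (hln : l < n) :
    IsTwistedPair p (m + n - l) l (r + m - l) (p ^ (m + n - l) - 1) b a := by
  have hb : orderOf b = p ^ (m + n - l) := by
    apply Nat.dvd_antisymm
    · apply orderOf_dvd_of_pow_eq_one
      rw [h.pow_right_of_le (by omega), show l + (m + n - l - m) = n by omega, h.pow_a]
    · have h1 := pow_orderOf_eq_one b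
      have h2 : b ^ (orderOf b : ℤ) ∈ Subgroup.zpowers a := by
        rw [zpow_natCast, h1]
        exact Subgroup.one_mem _
      obtain ⟨t, ht⟩ := Int.natCast_dvd_natCast.1 (h.dvd_of_pow_mem _ h2)
      rw [ht, pow_mul, h.pow_b, ← pow_mul, h.pow_eq_one_iff, show n = l + (n - l) by omega,
        pow_add] at h1
      rw [ht, show m + n - l = m + (n - l) by omega, pow_add]
      exact mul_dvd_mul_left _ (Nat.dvd_of_mul_dvd_mul_left (pow_pos hp.pos l) h1)
  have har : a ^ p ^ r = b ^ p ^ (r + m - l) := by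
    rw [h.pow_right_of_le (by omega)]
    congr 2
    omega
  refine ⟨by rw [Set.pair_comm]; exact h.gen, ?_, hb, ?_, ?_, ?_⟩
  · have hle : commutator G ≤ Subgroup.zpowers b := by
      rw [h.commutator_eq hp, har, Subgroup.zpowers_le]
      exact Subgroup.pow_mem _ (Subgroup.mem_zpowers b) _
    refine ⟨fun x hx g => ?_⟩
    have h1 : g * x * g⁻¹ = ⁅g, x⁆ * x := by rw [commutatorElement_def, inv_mul_cancel_right]
    rw [h1]
    exact Subgroup.mul_mem _ (hle (Subgroup.commutator_mem_commutator (Subgroup.mem_top g)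
      (Subgroup.mem_top x))) hx
  · have hpos : 0 < p ^ (m + n - l) := pow_pos hp.pos _
    have h1 : b ^ p ^ (r + m - l) * b ^ (p ^ (r + m - l) * (p ^ (m + n - l) - 1)) = 1 := by
      rw [← pow_add, ← mul_one_add, show 1 + (p ^ (m + n - l) - 1) = p ^ (m + n - l) by omega,
        mul_comm, pow_mul, ← hb, pow_orderOf_eq_one, one_pow]
    have h2 : b * a * a ^ p ^ r = a * b := by
      rw [h.comm, pow_add, pow_one, mul_assoc]
    rw [pow_add, pow_one, ← mul_assoc, ← h2, mul_assoc (b * a), har, h1, mul_one]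
  · rw [← h.pow_b]
    exact Subgroup.pow_mem _ (Subgroup.mem_zpowers b) _
  · rintro j ⟨k, hk⟩
    simp only at hk
    obtain ⟨t, rfl⟩ := h.dvd_of_pow_mem k (by rw [hk]; exact ⟨j, rfl⟩)
    have h1 : a ^ (j - (p ^ l : ℕ) * t) = 1 := by
      rw [zpow_sub, ← hk, zpow_mul, zpow_mul, zpow_natCast, zpow_natCast, h.pow_b, mul_inv_cancel]
    rw [h.zpow_eq_one_iff] at h1
    have h2 : ((p ^ l : ℕ) : ℤ) ∣ (p ^ n : ℕ) := Int.natCast_dvd_natCast.2 (pow_dvd_pow _ hln.le)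
    have := dvd_add (h2.trans h1) (dvd_mul_right ((p ^ l : ℕ) : ℤ) t)
    rwa [sub_add_cancel] at this

theorem exists_isTwistedPair [Finite G] (hp : p.Prime) (hG : IsPGroup p G) {s : ℕ}
    (hgen : Subgroup.closure {a, b} = ⊤) (hcomm : commutator G ≤ Subgroup.zpowers (a ^ p ^ s))
    (hab : ¬ IsAbelian G) :
    ∃ n m r w, s ≤ r ∧ r < n ∧ ¬ p ∣ w ∧ IsTwistedPair p n m r w a b := by
  have := Fact.mk hp
  obtain ⟨n, hn⟩ := IsPGroup.iff_orderOf.1 hG a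
  have hle : Subgroup.zpowers (a ^ p ^ s) ≤ Subgroup.zpowers a :=
    Subgroup.zpowers_le.2 (Subgroup.pow_mem _ (Subgroup.mem_zpowers a) _)
  have hN : (Subgroup.zpowers a).Normal := by
    refine ⟨fun x hx g => ?_⟩
    have h1 : g * x * g⁻¹ = ⁅g, x⁆ * x := by rw [commutatorElement_def, inv_mul_cancel_right]
    rw [h1]
    exact Subgroup.mul_mem _ (hle (hcomm (Subgroup.commutator_mem_commutator (Subgroup.mem_top g)
      (Subgroup.mem_top x)))) hx
  obtain ⟨m, hm⟩ := IsPGroup.iff_orderOf.1 (hG.to_quotient (Subgroup.zpowers a))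
    (b : G ⧸ Subgroup.zpowers a)
  have hmem : ⁅a⁻¹, b⁻¹⁆ ∈ Subgroup.zpowers (a ^ p ^ s) :=
    hcomm (Subgroup.commutator_mem_commutator (Subgroup.mem_top _) (Subgroup.mem_top _))
  obtain ⟨k, hk⟩ := (isOfFinOrder_of_finite (a ^ p ^ s)).mem_powers_iff_mem_zpowers.2 hmem
  simp only [← pow_mul] at hk
  have hcom : a * b = b * a * a ^ (p ^ s * k) := by
    rw [hk, commutatorElement_def]
    group
  have hne : a ^ (p ^ s * k) ≠ 1 := fun h1 => hab (comm_of_closure_pair hgen (by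
    rw [hcom, h1, mul_one]))
  obtain ⟨r, w, hw, hrw⟩ := Nat.exists_eq_pow_mul_and_not_dvd
    (n := p ^ s * k) (by rintro h0; rw [h0] at hne; exact hne (pow_zero a)) p hp.one_lt.ne'
  rw [hrw] at hcom hne
  refine ⟨n, m, r, w, ?_, ?_, hw, hgen, hN, hn, ?_, ?_, ?_⟩
  · by_contra! hlt
    obtain ⟨q, rfl⟩ : ∃ q, s = r + 1 + q := ⟨s - (r + 1), by omega⟩
    refine hw (Nat.dvd_of_mul_dvd_mul_left (pow_pos hp.pos r) ?_)
    rw [← hrw, ← pow_succ, pow_add p (r + 1), mul_assoc]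
    exact dvd_mul_right _ _
  · by_contra! hle'
    apply hne
    rw [← orderOf_dvd_iff_pow_eq_one, hn]
    exact (pow_dvd_pow p hle').mul_right w
  · rw [hcom, pow_add, pow_one, mul_assoc]
  · rw [← QuotientGroup.eq_one_iff, QuotientGroup.mk_pow, ← hm, pow_orderOf_eq_one]
  · intro j hj
    rw [← QuotientGroup.eq_one_iff, QuotientGroup.mk_zpow, ← orderOf_dvd_iff_zpow_eq_one, hm] at hj
    exact hj

/-- Classification of the non-abelian powerfully nilpotent groups of rank two. -/
theorem exists_hasMetacyclicPair (hp : p.Prime) (hG : IsPowerfullyNilpotent p G)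
    (hrank : HasRankTwo G) (hab : ¬ IsAbelian G) :
    (∃ n m r, SplitParams n m r ∧ HasMetacyclicPair p n m n r G) ∨
      ∃ n m l r, NonsplitParams n m l r ∧ HasMetacyclicPair p n m l r G := by
  have := hG.finite
  have hP := hG.isPGroup
  obtain ⟨⟨a, b, hgen⟩, -⟩ := hasRankTwo_iff.1 hrank
  obtain ⟨c, d, s, hs, hcd, hcomm⟩ :=
    exists_commutator_le_zpowers hp hP hgen (hG.commutator_le hp hgen)
  obtain ⟨n, m, r, w, hsr, hrn, hw, h⟩ := exists_isTwistedPair hp hP hcd hcomm hab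
  have split : ∀ {n m r w : ℕ} {c d : G}, IsTwistedPair p n m r w c d → 2 ≤ r → r < n → ¬ p ∣ w →
      d ^ p ^ m ∈ Subgroup.zpowers (c ^ p ^ m) →
      ∃ n m r, SplitParams n m r ∧ HasMetacyclicPair p n m n r G := by
    intro n m r w c d h hr hrn hw hd
    obtain ⟨a, b, h'⟩ := h.hasMetacyclicPair_of_pow_mem hp hP hr hrn hw hd
    exact ⟨n, m, r, ⟨h'.le_add_of_comm' hp hr hrn.le, hr, hrn⟩, a, b, h'⟩
  have hr : 2 ≤ r := hs.trans hsr
  obtain ⟨t, ht⟩ := (isOfFinOrder_of_finite c).mem_powers_iff_mem_zpowers.2 h.pow_mem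
  simp only at ht
  by_cases hd1 : d ^ p ^ m = 1
  · exact Or.inl (split h hr hrn hw (by rw [hd1]; exact Subgroup.one_mem _))
  obtain ⟨l, v, hv, rfl⟩ := Nat.exists_eq_pow_mul_and_not_dvd (n := t)
    (by rintro rfl; exact hd1 (by rw [← ht, pow_zero])) p hp.one_lt.ne'
  have hln : l < n := by
    by_contra! hle
    apply hd1
    rw [← ht, ← orderOf_dvd_iff_pow_eq_one, h.orderOf_left]
    exact (pow_dvd_pow p hle).mul_right v
  rcases le_or_gt m l with hml | hlm
  · refine Or.inl (split h hr hrn hw ?_)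
    rw [← ht, show l = m + (l - m) by omega, pow_add, mul_assoc, pow_mul]
    exact Subgroup.pow_mem _ (Subgroup.mem_zpowers _) _
  obtain ⟨k, hk, h'⟩ := h.exists_right_pow hp hP hr hrn hw
  have h2 := h'.isMetacyclicPair hP (l := l) (v := v * k)
    (Nat.Coprime.mul_left ((hp.coprime_iff_not_dvd.2 hv).symm) hk)
    (by rw [pow_right_comm, ← ht, ← pow_mul, mul_assoc])
  rcases lt_or_ge r l with hrl | hlr
  · exact Or.inr ⟨n, m, l, r, ⟨hr, hrl, hln, h2.le_add_of_comm hp, hlm⟩, _, _, h2⟩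
  -- For `l ≤ r` the roles are exchanged; since `l < m`, the power `a^{p^l} = b^{p^m}` lies in
  -- `⟨b^{p^l}⟩` and can be removed.
  · refine Or.inl (split (h2.swap hp hlr hlm hln) (by omega) (by omega) ?_ ?_)
    · intro hdvd
      have hpos : 0 < p ^ (m + n - l) := pow_pos hp.pos _
      have h3 : p ∣ p ^ (m + n - l) := dvd_pow_self p (by omega)
      have h4 := (Nat.dvd_sub_iff_right (by omega) h3).1 hdvd
      exact hp.not_dvd_one h4
    · rw [← h2.pow_b, show m = l + (m - l) by omega, pow_add, pow_mul]
      exact Subgroup.pow_mem _ (Subgroup.mem_zpowers _) _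

end

/-! ### Uniqueness of the parameters -/

/-- The parameters of the two families of groups, with `l = n` for the split groups. -/
def MetacyclicParams (n m l r : ℕ) : Prop :=
  2 ≤ r ∧ r < n ∧ n ≤ m + r ∧ (l = n ∨ r < l ∧ l < n ∧ n ≤ l + r ∧ l < m)

theorem SplitParams.metacyclicParams {n m r : ℕ} (h : SplitParams n m r) :
    MetacyclicParams n m n r := by
  obtain ⟨h1, h2, h3⟩ := h
  refine ⟨h2, h3, h1, Or.inl rfl⟩

theorem NonsplitParams.metacyclicParams {n m l r : ℕ} (h : NonsplitParams n m l r) :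
    MetacyclicParams n m l r := by
  obtain ⟨h1, h2, h3, h4, h5⟩ := h
  exact ⟨h1, by omega, by omega, Or.inr ⟨h2, h3, h4, h5⟩⟩

namespace HasMetacyclicPair

variable {G : Type u} [Group G] {p n m l r n' m' l' r' : ℕ}

/-- The four equations compare the order, the order of `G'`, and the exponents of `G/G'` and of `G`.
They also apply to abelian groups, where `r` is not determined. -/
theorem invariants (hp : p.Prime) (h : HasMetacyclicPair p n m l r G)
    (h' : HasMetacyclicPair p n' m' l' r' G) (hr : 1 ≤ r) (hr' : 1 ≤ r') (hl : l ≤ n)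
    (hl' : l' ≤ n') (hrl : min r n ≤ l) (hrl' : min r' n' ≤ l') :
    n + m = n' + m' ∧ n - r = n' - r' ∧ max (min r n) m = max (min r' n') m' ∧
      max n (m + n - l) = max n' (m' + n' - l') := by
  obtain ⟨a, b, h⟩ := h
  obtain ⟨a', b', h'⟩ := h'
  have hinj := Nat.pow_right_injective hp.two_le
  refine ⟨hinj ((h.card_eq hp).symm.trans (h'.card_eq hp)),
    hinj ((h.card_commutator hp).symm.trans (h'.card_commutator hp)), ?_, ?_⟩
  · have h1 := fun k => (h.forall_pow_mem_commutator_iff hp hrl k).symm.trans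
      (h'.forall_pow_mem_commutator_iff hp hrl' k)
    have h2 := h1 (max (min r n) m)
    have h3 := h1 (max (min r' n') m')
    omega
  · have h1 := fun k => (h.forall_pow_eq_one_iff hp hr hl k).symm.trans
      (h'.forall_pow_eq_one_iff hp hr' hl' k)
    have h2 := h1 (max n (m + n - l))
    have h3 := h1 (max n' (m' + n' - l'))
    omega

theorem params_unique (hp : p.Prime) (h : HasMetacyclicPair p n m l r G)
    (h' : HasMetacyclicPair p n' m' l' r' G) (hP : MetacyclicParams n m l r)
    (hP' : MetacyclicParams n' m' l' r') : n = n' ∧ m = m' ∧ l = l' ∧ r = r' := by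
  unfold MetacyclicParams at hP hP'
  have := invariants hp h h' (by omega) (by omega) (by omega) (by omega) (by omega) (by omega)
  omega

theorem nonempty_mulEquiv {H : Type v} [Group H] (hp : p.Prime) (h : HasMetacyclicPair p n m l r G)
    (h' : HasMetacyclicPair p n m l r H) : Nonempty (G ≃* H) := by
  obtain ⟨a, b, h⟩ := h
  obtain ⟨a', b', h'⟩ := h'
  obtain ⟨e⟩ := h.nonempty_equiv_presented hp (metacyclicRel_nonsplitGroup p n m l r)
    (lift_mem_nonsplitRels h.toMetacyclicRel)
  obtain ⟨e'⟩ := h'.nonempty_equiv_presented hp (metacyclicRel_nonsplitGroup p n m l r)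
    (lift_mem_nonsplitRels h'.toMetacyclicRel)
  exact ⟨e.trans e'.symm⟩

theorem isAbelian_iff (hp : p.Prime) (h : HasMetacyclicPair p n m l r G) :
    IsAbelian G ↔ n ≤ r := by
  obtain ⟨a, b, h⟩ := h
  exact h.isAbelian_iff hp

theorem hasRankTwo (hp : p.Prime) (h : HasMetacyclicPair p n m l r G) (hr : 1 ≤ r) (hm : 1 ≤ m)
    (hl : 1 ≤ l) (hln : l ≤ n) : HasRankTwo G := by
  obtain ⟨a, b, h⟩ := h
  exact h.hasRankTwo hp hr hm hl hln

theorem isPowerfullyNilpotent (hp : p.Prime) (h : HasMetacyclicPair p n m l r G) (hr : 2 ≤ r) :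
    IsPowerfullyNilpotent p G := by
  obtain ⟨a, b, h⟩ := h
  exact h.isPowerfullyNilpotent hp hr

theorem isSplitMetacyclic (hp : p.Prime) (h : HasMetacyclicPair p n m n r G) :
    IsSplitMetacyclic G := by
  obtain ⟨a, b, h⟩ := h
  refine ⟨a, b, h.normal hp, Subgroup.isComplement'_of_disjoint_and_mul_eq_univ ?_ ?_⟩
  · rw [Subgroup.disjoint_def]
    rintro x hx ⟨j, rfl⟩
    obtain ⟨t, rfl⟩ := h.dvd_of_pow_mem j hx
    simp only
    rw [zpow_mul, zpow_natCast, h.pow_b, h.pow_a, one_zpow]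
  · rw [Set.eq_univ_iff_forall]
    intro g
    obtain ⟨j, i, hji⟩ := h.exists_eq hp g⁻¹
    rw [inv_eq_iff_eq_inv, mul_inv_rev] at hji
    rw [hji]
    exact Set.mul_mem_mul (Subgroup.inv_mem _ (Subgroup.pow_mem _ (Subgroup.mem_zpowers a) i))
      (Subgroup.inv_mem _ (Subgroup.pow_mem _ (Subgroup.mem_zpowers b) j))

end HasMetacyclicPair

/-! ### Non-split groups -/

section
variable {G : Type u} [Group G] {p n m l r w : ℕ} {a b : G}

theorem IsTwistedPair.commutator_eq [Finite G] (hp : p.Prime) (hG : IsPGroup p G)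
    (h : IsTwistedPair p n m r w a b) (hw : ¬ p ∣ w) :
    commutator G = Subgroup.zpowers (a ^ p ^ r) := by
  rw [commutator_eq_zpowers h.gen h.normal h.comm, pow_mul]
  apply le_antisymm
  · exact Subgroup.zpowers_le.2 (Subgroup.pow_mem _ (Subgroup.mem_zpowers _) w)
  · exact Subgroup.zpowers_le.2 (hG.mem_zpowers_pow ((hp.coprime_iff_not_dvd.2 hw).symm) _)

/-- A splitting gives a twisted pair whose `r'` might a priori be `0` or `1`. The order, `|G'|` and
the exponent of `G/G'` exclude this; then the pair normalises to split parameters, against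
uniqueness. -/
theorem HasMetacyclicPair.not_isSplitMetacyclic (hp : p.Prime) (h : HasMetacyclicPair p n m l r G)
    (hP : NonsplitParams n m l r) : ¬ IsSplitMetacyclic G := by
  rintro ⟨c, d, hN, hcompl⟩
  have hab := mt (h.isAbelian_iff hp).1 (by have := hP.metacyclicParams.2.1; omega)
  have hinv := fun {n' m' r' : ℕ} => HasMetacyclicPair.params_unique (n' := n') (m' := m')
    (l' := n') (r' := r') hp h
  obtain ⟨a, b, h⟩ := h
  have hfin := h.finite hp
  have hG := h.isPGroup hp
  have hgen : Subgroup.closure {c, d} = ⊤ := by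
    rw [eq_top_iff, ← hcompl.sup_eq_top]
    exact sup_le (Subgroup.zpowers_le.2 (left_mem_closure_pair c d))
      (Subgroup.zpowers_le.2 (right_mem_closure_pair c d))
  have hcomm : commutator G ≤ Subgroup.zpowers (c ^ p ^ 0) := by
    rw [pow_zero, pow_one]
    refine commutator_le_of_closure_pair hgen _ ?_
    rw [commutatorElement_def, mul_assoc, mul_assoc]
    refine Subgroup.mul_mem _ (Subgroup.mem_zpowers c) ?_
    rw [← mul_assoc]
    exact hN.conj_mem _ (Subgroup.inv_mem _ (Subgroup.mem_zpowers c)) d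
  obtain ⟨n', m', r', w, -, hrn, hw, ht⟩ := exists_isTwistedPair hp hG hgen hcomm hab
  have hd1 : d ^ p ^ m' = 1 :=
    Subgroup.disjoint_def.1 hcompl.disjoint ht.pow_mem (Subgroup.pow_mem _ (Subgroup.mem_zpowers d) _)
  have hd : orderOf d = p ^ m' := by
    refine Nat.dvd_antisymm (orderOf_dvd_of_pow_eq_one hd1) ?_
    refine Int.natCast_dvd_natCast.1 (ht.dvd_of_pow_mem _ ?_)
    rw [zpow_natCast, pow_orderOf_eq_one]
    exact Subgroup.one_mem _
  have hcard : n' + m' = n + m := by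
    apply Nat.pow_right_injective hp.two_le
    simp only
    rw [← h.card_eq hp, ← hcompl.card_mul_card, Nat.card_zpowers, Nat.card_zpowers, hd,
      ht.orderOf_left, pow_add]
  have hcG := ht.commutator_eq hp hG hw
  have hcardpow : ∀ k, k ≤ n' → Nat.card (Subgroup.zpowers (c ^ p ^ k)) = p ^ (n' - k) := by
    intro k hk
    rw [Nat.card_zpowers, orderOf_pow' _ (pow_pos hp.pos k).ne', ht.orderOf_left,
      Nat.gcd_eq_right (pow_dvd_pow _ hk), Nat.pow_div hk hp.pos]
  have hcc : n' - r' = n - r := by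
    apply Nat.pow_right_injective hp.two_le
    simp only
    rw [← h.card_commutator hp, hcG, hcardpow r' hrn.le]
  obtain ⟨hr, hrl, hln, hnlr, hlm⟩ := hP
  have hexp : ∀ k, r' ≤ k ∧ m' ≤ k ↔ min r n ≤ k ∧ m ≤ k := by
    intro k
    rw [← h.forall_pow_mem_commutator_iff hp (by omega), forall_pow_mem_commutator_iff hgen, hcG]
    refine and_congr ⟨fun hk => ?_, fun hk => ?_⟩ ⟨fun hk => ?_, fun hk => ?_⟩
    · rw [show k = r' + (k - r') by omega, pow_add, pow_mul]
      exact Subgroup.pow_mem _ (Subgroup.mem_zpowers _) _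
    · by_contra! hlt
      have h1 := Subgroup.card_le_of_le (Subgroup.zpowers_le.2 hk)
      rw [hcardpow k (by omega), hcardpow r' hrn.le, Nat.pow_le_pow_iff_right hp.one_lt] at h1
      omega
    · rw [show k = m' + (k - m') by omega, pow_add, pow_mul, hd1, one_pow]
      exact Subgroup.one_mem _
    · have h1 : d ^ ((p ^ k : ℕ) : ℤ) ∈ Subgroup.zpowers c := by
        rw [zpow_natCast]
        exact Subgroup.zpowers_le.2 (Subgroup.pow_mem _ (Subgroup.mem_zpowers c) _) hk
      exact (Nat.pow_dvd_pow_iff_le_right hp.one_lt).1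
        (Int.natCast_dvd_natCast.1 (ht.dvd_of_pow_mem _ h1))
  have h1 := hexp (max r' m')
  have h2 := hexp m
  -- Here `max r' m' = m`: either `m' = m`, and then `r' = r`, or `r' = m > r`.
  have hr' : 2 ≤ r' := by omega
  obtain ⟨a', b', h'⟩ := ht.hasMetacyclicPair_of_pow_mem hp hG hr' hrn hw
    (by rw [hd1]; exact Subgroup.one_mem _)
  have h3 := hinv ⟨a', b', h'⟩ (NonsplitParams.metacyclicParams ⟨hr, hrl, hln, hnlr, hlm⟩)
    ⟨hr', hrn, h'.le_add_of_comm' hp hr' hrn.le, Or.inl rfl⟩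
  omega

/-! ### Direct ancestors -/

theorem HasMetacyclicPair.isDirectAncestor_iff {H : Type v} [Group H] {n₁ m₁ : ℕ} (hp : p.Prime)
    (h : HasMetacyclicPair p n m l r G) (hP : MetacyclicParams n m l r)
    (hn : n₁ = min (n - r + 1) l) (hm : m₁ = min m (n - r + 1)) :
    IsDirectAncestor p G H ↔ HasMetacyclicPair p n₁ m₁ n₁ r H := by
  obtain ⟨hr, hrn, hmr, hl⟩ := hP
  have hG := h.isPowerfullyNilpotent hp hr
  have hab := mt (h.isAbelian_iff hp).1 (by omega)
  have hQ : HasMetacyclicPair p n₁ m₁ n₁ r (G ⧸ centerPow p G) := by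
    obtain ⟨a, b, h⟩ := h
    subst hn hm
    exact ⟨_, _, h.quotient_centerPow hp hr hrn (by omega) (by omega)⟩
  constructor
  · rintro ⟨-, -, -, ⟨e⟩⟩
    exact hQ.of_equiv e.symm
  · intro hH
    exact ⟨hG, hH.isPowerfullyNilpotent hp hr, hab, hH.nonempty_mulEquiv hp hQ⟩

theorem exists_metacyclicParams (hp : p.Prime) (hG : IsPowerfullyNilpotent p G)
    (hrank : HasRankTwo G) (hab : ¬ IsAbelian G) :
    ∃ n m l r, MetacyclicParams n m l r ∧ HasMetacyclicPair p n m l r G := by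
  rcases exists_hasMetacyclicPair hp hG hrank hab with ⟨n, m, r, hP, h⟩ | ⟨n, m, l, r, hP, h⟩
  · exact ⟨n, m, n, r, hP.metacyclicParams, h⟩
  · exact ⟨n, m, l, r, hP.metacyclicParams, h⟩

/-- `Z(G)^p ≤ G^p` consists of non-generators, so generators of the quotient lift to generators. -/
theorem IsDirectAncestor.hasRankTwo_left {H : Type v} [Group H] (hp : p.Prime)
    (h : IsDirectAncestor p G H) (hH : HasRankTwo H) : HasRankTwo G := by
  obtain ⟨hG, -, -, ⟨e⟩⟩ := h
  have := hG.finite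
  obtain ⟨⟨a, b, hab⟩, hc⟩ := hasRankTwo_iff.1 (hH.of_equiv e)
  refine hasRankTwo_iff.2 ⟨?_, fun hcyc => hc (isCyclic_of_surjective _
    (QuotientGroup.mk'_surjective (centerPow p G)))⟩
  obtain ⟨a, rfl⟩ := QuotientGroup.mk_surjective a
  obtain ⟨b, rfl⟩ := QuotientGroup.mk_surjective b
  refine ⟨a, b, hG.isPGroup.eq_top_of_sup_powSubgroup hp ?_⟩
  rw [Subgroup.eq_top_iff']
  intro x
  have hx : QuotientGroup.mk' (centerPow p G) x ∈
      (Subgroup.closure {a, b}).map (QuotientGroup.mk' (centerPow p G)) := by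
    rw [MonoidHom.map_closure, Set.image_pair]
    exact hab ▸ Subgroup.mem_top _
  obtain ⟨y, hy, hxy⟩ := hx
  have := Subgroup.mul_mem_sup hy (powSubgroup_mono le_top p (QuotientGroup.eq.1 hxy))
  rwa [mul_inv_cancel_left] at this

theorem IsDirectAncestor.exists_params {H : Type v} [Group H] (hp : p.Prime)
    (h : IsDirectAncestor p G H) (hG : HasRankTwo G) :
    ∃ n m l r, MetacyclicParams n m l r ∧ HasMetacyclicPair p n m l r G ∧
      HasMetacyclicPair p (min (n - r + 1) l) (min m (n - r + 1)) (min (n - r + 1) l) r H := by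
  obtain ⟨n, m, l, r, hP, hGp⟩ := exists_metacyclicParams hp h.left hG h.not_abelian
  exact ⟨n, m, l, r, hP, hGp, (hGp.isDirectAncestor_iff hp hP rfl rfl).1 h⟩

theorem isDirectAncestor_quotient (hp : p.Prime) (hG : IsPowerfullyNilpotent p G)
    (hrank : HasRankTwo G) (hab : ¬ IsAbelian G) : IsDirectAncestor p G (G ⧸ centerPow p G) := by
  obtain ⟨n, m, l, r, hP, a, b, h⟩ := exists_metacyclicParams hp hG hrank hab
  have hQ := h.quotient_centerPow hp hP.1 hP.2.1 (by have := hP.2.2.2; omega)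
    (by have := hP.2.2.2; omega)
  exact ⟨hG, hQ.isPowerfullyNilpotent hp hP.1, hab, ⟨MulEquiv.refl _⟩⟩

theorem MetacyclicParams.hasDirectAncestor {n₁ m₁ : ℕ} (hp : p.Prime)
    (hP : MetacyclicParams n m l r) (hn : n₁ = min (n - r + 1) l) (hm : m₁ = min m (n - r + 1))
    (h : HasMetacyclicPair p n₁ m₁ n₁ r G) : HasDirectAncestor p G := by
  have hM := hasMetacyclicPair_nonsplitGroup (p := p) (n := n) (m := m) (l := l) (r := r) hp hP.1
    hP.2.2.1 (by have := hP.2.2.2; omega)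
  exact ⟨ULift (NonsplitGroup p n m l r), inferInstance,
    ((hM.of_equiv MulEquiv.ulift.symm).isDirectAncestor_iff hp hP hn hm).2 h⟩

/-- The three shapes come from neither exception, from `m = n - r`, and from `l = n - r`. Abelian
groups are included, with `r` at least the first parameter. -/
theorem hasDirectAncestor_iff (hp : p.Prime) (hG : HasRankTwo G) :
    HasDirectAncestor p G ↔ ∃ k r, 2 ≤ r ∧ ((2 ≤ k ∧ HasMetacyclicPair p k k k r G) ∨
      (1 ≤ k ∧ HasMetacyclicPair p (k + 1) k (k + 1) r G) ∨
      (r < k ∧ HasMetacyclicPair p k (k + 1) k r G)) := by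
  constructor
  · rintro ⟨M, _, h⟩
    obtain ⟨n, m, l, r, hP, -, hGp⟩ := h.exists_params hp (h.hasRankTwo_left hp hG)
    obtain ⟨hr, hrn, hmr, hl⟩ := hP
    by_cases h1 : n - r = l
    · refine ⟨n - r, r, hr, Or.inr (Or.inr ⟨by omega, ?_⟩)⟩
      rwa [show min (n - r + 1) l = n - r by omega,
        show min m (n - r + 1) = n - r + 1 by omega] at hGp
    by_cases h2 : m = n - r
    · refine ⟨n - r, r, hr, Or.inr (Or.inl ⟨by omega, ?_⟩)⟩
      rwa [show min (n - r + 1) l = n - r + 1 by omega,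
        show min m (n - r + 1) = n - r by omega] at hGp
    · refine ⟨n - r + 1, r, hr, Or.inl ⟨by omega, ?_⟩⟩
      rwa [show min (n - r + 1) l = n - r + 1 by omega,
        show min m (n - r + 1) = n - r + 1 by omega] at hGp
  · rintro ⟨k, r, hr, ⟨hk, h⟩ | ⟨hk, h⟩ | ⟨hk, h⟩⟩
    · exact MetacyclicParams.hasDirectAncestor (n := k + r - 1) (m := k) (l := k + r - 1) hp
        ⟨hr, by omega, by omega, Or.inl rfl⟩ (by omega) (by omega) h
    · exact MetacyclicParams.hasDirectAncestor (n := k + r) (m := k) (l := k + r) hp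
        ⟨hr, by omega, by omega, Or.inl rfl⟩ (by omega) (by omega) h
    · exact MetacyclicParams.hasDirectAncestor (n := k + r) (m := k + 1) (l := k) hp
        ⟨hr, by omega, by omega, Or.inr ⟨by omega, by omega, by omega, by omega⟩⟩ (by omega)
        (by omega) h

/-- A parent that itself has an ancestor is split with `m ≥ n - r + 1` in each of the three shapes,
so both orders in its descendant are `p^{n-r+1}`. -/
theorem exists_grandparent_iff (hp : p.Prime) (hG : HasRankTwo G) :
    (∃ (K : Type u) (_ : Group K), IsDirectAncestor p K G ∧ HasDirectAncestor p K) ↔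
      ∃ k r, 2 ≤ r ∧ 2 ≤ k ∧ HasMetacyclicPair p k k k r G := by
  constructor
  · rintro ⟨K, _, hKG, hK⟩
    have hrank := hKG.hasRankTwo_left hp hG
    obtain ⟨k, r, hr, hkr⟩ := (hasDirectAncestor_iff hp hrank).1 hK
    have key : ∀ n m, HasMetacyclicPair p n m n r K → (n - r + 1 ≤ m ∧ n ≤ m + r) →
        ∃ k r, 2 ≤ r ∧ 2 ≤ k ∧ HasMetacyclicPair p k k k r G := by
      intro n m h hnm
      have hrn : r < n := by
        have := mt (h.isAbelian_iff hp).2 hKG.not_abelian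
        omega
      exact ⟨n - r + 1, r, hr, by omega, (h.isDirectAncestor_iff hp
        ⟨hr, hrn, by omega, Or.inl rfl⟩ (by omega) (by omega)).1 hKG⟩
    rcases hkr with ⟨hk, h⟩ | ⟨hk, h⟩ | ⟨hk, h⟩
    · exact key _ _ h (by omega)
    · exact key _ _ h (by omega)
    · exact key _ _ h (by omega)
  · rintro ⟨k, r, hr, hk, h⟩
    have hP : MetacyclicParams (k + r - 1) (k + r - 1) (k + r - 1) r :=
      ⟨hr, by omega, by omega, Or.inl rfl⟩
    have hM := (hasMetacyclicPair_nonsplitGroup (p := p) (n := k + r - 1) (m := k + r - 1)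
      (l := k + r - 1) (r := r) hp hr (by omega) (by omega)).of_equiv MulEquiv.ulift.{0, u}.symm
    refine ⟨ULift (NonsplitGroup p (k + r - 1) (k + r - 1) (k + r - 1) r), inferInstance,
      (hM.isDirectAncestor_iff hp hP (by omega) (by omega)).2 h, ?_⟩
    exact (hasDirectAncestor_iff hp (hM.hasRankTwo hp (by omega) (by omega) (by omega) le_rfl)).2
      ⟨_, r, hr, Or.inl ⟨by omega, hM⟩⟩

/-! ### Abelian groups of rank two -/

/-- Any `r ≥ n` is allowed because `a^{p^r} = 1`; this freedom yields the many ancestors of an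
abelian group. -/
theorem hasMetacyclicPair_zmod_prod (hp : p.Prime) (h : n ≤ r) :
    HasMetacyclicPair p n m n r (Multiplicative (ZMod (p ^ n) × ZMod (p ^ m))) := by
  have hn : NeZero (p ^ n) := ⟨(pow_pos hp.pos n).ne'⟩
  have hm : NeZero (p ^ m) := ⟨(pow_pos hp.pos m).ne'⟩
  let a : Multiplicative (ZMod (p ^ n) × ZMod (p ^ m)) := Multiplicative.ofAdd (1, 0)
  let b : Multiplicative (ZMod (p ^ n) × ZMod (p ^ m)) := Multiplicative.ofAdd (0, 1)
  have hapow : ∀ i : ℕ, a ^ i = Multiplicative.ofAdd ((i : ZMod (p ^ n)), (0 : ZMod (p ^ m))) := by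
    intro i
    rw [← ofAdd_nsmul]
    simp
  have hbpow : ∀ i : ℤ, b ^ i = Multiplicative.ofAdd ((0 : ZMod (p ^ n)), (i : ZMod (p ^ m))) := by
    intro i
    rw [← ofAdd_zsmul]
    simp
  have hazpow : ∀ i : ℤ, a ^ i = Multiplicative.ofAdd ((i : ZMod (p ^ n)), (0 : ZMod (p ^ m))) := by
    intro i
    rw [← ofAdd_zsmul]
    simp
  have hone : ∀ s, n ≤ s → a ^ p ^ s = 1 := by
    intro s hs
    rw [hapow, (ZMod.natCast_eq_zero_iff _ _).2 (pow_dvd_pow p hs)]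
    rfl
  refine ⟨a, b, ⟨?_, hone n le_rfl, ?_, ?_⟩, ?_, ?_⟩
  · rw [Subgroup.eq_top_iff']
    intro x
    have : x = a ^ x.toAdd.1.val * b ^ (x.toAdd.2.val : ℤ) := by
      rw [hapow, hbpow, ← ofAdd_add]
      simp
    rw [this]
    exact Subgroup.mul_mem _ (Subgroup.pow_mem _ (left_mem_closure_pair a b) _)
      (Subgroup.zpow_mem _ (right_mem_closure_pair a b) _)
  · rw [hone n le_rfl, ← zpow_natCast, hbpow, Int.cast_natCast, ZMod.natCast_self]
    rfl
  · rw [pow_add, hone r h, pow_one, mul_one, mul_comm]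
  · intro i hi
    rw [hapow] at hi
    exact (ZMod.natCast_eq_zero_iff _ _).1 (congrArg (fun x => x.toAdd.1) hi)
  · rintro j ⟨k, hk⟩
    simp only [hazpow, hbpow] at hk
    exact (ZMod.intCast_zmod_eq_zero_iff_dvd j (p ^ m)).1
      (congrArg (fun x => x.toAdd.2) hk).symm

theorem nonempty_equiv_abelianA_iff (hp : p.Prime) (h : n ≤ r) :
    Nonempty (G ≃* AbelianA p n) ↔ HasMetacyclicPair p n n n r G :=
  ⟨fun ⟨e⟩ => (hasMetacyclicPair_zmod_prod hp h).of_equiv e.symm,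
    fun hG => hG.nonempty_mulEquiv hp (hasMetacyclicPair_zmod_prod hp h)⟩

theorem nonempty_equiv_abelianB_iff (hp : p.Prime) (h : n + 1 ≤ r) :
    Nonempty (G ≃* AbelianB p n) ↔ HasMetacyclicPair p (n + 1) n (n + 1) r G :=
  ⟨fun ⟨e⟩ => (hasMetacyclicPair_zmod_prod hp h).of_equiv e.symm,
    fun hG => hG.nonempty_mulEquiv hp (hasMetacyclicPair_zmod_prod hp h)⟩

end

/-! ### Infinite chains -/

section
variable {p : ℕ} {H : ℕ → Type u} [∀ i, Group (H i)]

/-- Every `H (i + 1)` is non-abelian and has a grandparent, so its parameters are unique and both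
orders agree; comparing neighbours fixes `r`. For `H 0`, possibly abelian, `r` is read from `H 1`.
-/
theorem IsInfiniteChain.exists_params (hp : p.Prime) (h : IsInfiniteChain p H) :
    ∃ n r, 2 ≤ n ∧ 2 ≤ r ∧ ∀ i,
      HasMetacyclicPair p (n + i * (r - 1)) (n + i * (r - 1)) (n + i * (r - 1)) r (H i) := by
  have h1 : ∀ i, ∃ k r, 2 ≤ r ∧ 2 ≤ k ∧ HasMetacyclicPair p k k k r (H (i + 1)) := fun i =>
    (exists_grandparent_iff hp (h.rank_two (i + 1))).1
      ⟨H (i + 2), inferInstance, h.step (i + 1), H (i + 3), inferInstance, h.step (i + 2)⟩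
  choose k r hr hk hkr using h1
  have hrk : ∀ i, r i < k i := fun i => by
    have := mt ((hkr i).isAbelian_iff hp).2 (h.step i).not_abelian
    omega
  have hP : ∀ i, MetacyclicParams (k i) (k i) (k i) (r i) := fun i =>
    ⟨hr i, hrk i, by omega, Or.inl rfl⟩
  have hdesc : ∀ i, HasMetacyclicPair p (k i - r i + 1) (k i - r i + 1) (k i - r i + 1) (r i)
      (H i) := fun i => by
    have := hr i
    have := hrk i
    exact ((hkr i).isDirectAncestor_iff hp (hP i) (by omega) (by omega)).1 (h.step i)
  have hstep : ∀ i, k i = k (i + 1) - r (i + 1) + 1 ∧ r i = r (i + 1) := by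
    intro i
    have hab := mt ((hdesc (i + 1)).isAbelian_iff hp).2 (h.step i).not_abelian
    have := (hkr i).params_unique hp (hdesc (i + 1)) (hP i)
      ⟨hr (i + 1), by omega, by omega, Or.inl rfl⟩
    exact ⟨this.1, this.2.2.2⟩
  have hr0 : ∀ i, r i = r 0 := by
    intro i
    induction i with
    | zero => rfl
    | succ i ih => rw [← (hstep i).2, ih]
  have hk0 : ∀ i, k i = (k 0 - r 0 + 1) + (i + 1) * (r 0 - 1) := by
    intro i
    induction i with
    | zero =>
      have := hrk 0
      have := hr 0
      omega
    | succ i ih =>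
      have h2 := (hstep i).1
      have h3 := hrk (i + 1)
      have h4 := hr0 (i + 1)
      have h5 := hr 0
      rw [add_mul (i + 1)]
      omega
  refine ⟨k 0 - r 0 + 1, r 0, by have := hrk 0; omega, hr 0, fun i => ?_⟩
  cases i with
  | zero => simpa using hdesc 0
  | succ i =>
    have := hkr i
    rwa [hr0, hk0] at this

theorem isInfiniteChain_of_params (hp : p.Prime) {n r : ℕ} (hn : 2 ≤ n) (hr : 2 ≤ r)
    (h : ∀ i, HasMetacyclicPair p (n + i * (r - 1)) (n + i * (r - 1)) (n + i * (r - 1)) r (H i)) :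
    IsInfiniteChain p H where
  rank_two i := (h i).hasRankTwo hp (by omega) (by omega) (by omega) le_rfl
  step i := by
    have hmul : (i + 1) * (r - 1) = i * (r - 1) + (r - 1) := by rw [add_mul, one_mul]
    exact ((h (i + 1)).isDirectAncestor_iff hp ⟨hr, by omega, by omega, Or.inl rfl⟩ (by omega)
      (by omega)).2 (h i)

/-- The orders of `H 0` and `H 1` are `p^{2n}` and `p^{2(n+r-1)}` and suffice, even when `H 0` is
abelian. -/
theorem params_unique_of_chain (hp : p.Prime) {n r n' r' : ℕ} (hr : 2 ≤ r) (hr' : 2 ≤ r')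
    (h : ∀ i, HasMetacyclicPair p (n + i * (r - 1)) (n + i * (r - 1)) (n + i * (r - 1)) r (H i))
    (h' : ∀ i, HasMetacyclicPair p (n' + i * (r' - 1)) (n' + i * (r' - 1)) (n' + i * (r' - 1)) r'
      (H i)) : n = n' ∧ r = r' := by
  have h0 := ((h 0).invariants hp (h' 0) (by omega) (by omega) le_rfl le_rfl (by omega)
    (by omega)).1
  have h1 := ((h 1).invariants hp (h' 1) (by omega) (by omega) le_rfl le_rfl (by omega)
    (by omega)).1
  simp only [zero_mul, one_mul] at h0 h1
  omega

end

/-! ### The main theorem -/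

section
variable {G : Type u} [Group G] {p n m l r : ℕ}

theorem SplitParams.nonempty_equiv_iff (hp : p.Prime) (hP : SplitParams n m r) :
    Nonempty (G ≃* SplitGroup p n m r) ↔ HasMetacyclicPair p n m n r G :=
  nonempty_equiv_splitGroup_iff hp hP.2.1 hP.1

theorem NonsplitParams.nonempty_equiv_iff (hp : p.Prime) (hP : NonsplitParams n m l r) :
    Nonempty (G ≃* NonsplitGroup p n m l r) ↔ HasMetacyclicPair p n m l r G :=
  nonempty_equiv_nonsplitGroup_iff hp hP.1 hP.metacyclicParams.2.2.1 hP.2.2.2.1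

theorem SplitParams.hasMetacyclicPair (hp : p.Prime) (hP : SplitParams n m r) :
    HasMetacyclicPair p n m n r (SplitGroup p n m r) :=
  hasMetacyclicPair_splitGroup hp hP.2.1 hP.1

theorem NonsplitParams.hasMetacyclicPair (hp : p.Prime) (hP : NonsplitParams n m l r) :
    HasMetacyclicPair p n m l r (NonsplitGroup p n m l r) :=
  hasMetacyclicPair_nonsplitGroup hp hP.1 hP.metacyclicParams.2.2.1 hP.2.2.2.1

theorem MetacyclicParams.split_or_nonsplit (hp : p.Prime) (hP : MetacyclicParams n m l r)
    (h : HasMetacyclicPair p n m l r G) :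
    (l = n ∧ SplitParams n m r ∧ Nonempty (G ≃* SplitGroup p n m r)) ∨
      (l < n ∧ NonsplitParams n m l r ∧ Nonempty (G ≃* NonsplitGroup p n m l r)) := by
  obtain ⟨hr, hrn, hmr, rfl | ⟨hrl, hln, hlr, hlm⟩⟩ := hP
  · have hS : SplitParams l m r := ⟨hmr, hr, hrn⟩
    exact Or.inl ⟨rfl, hS, (hS.nonempty_equiv_iff hp).2 h⟩
  · have hN : NonsplitParams n m l r := ⟨hr, hrl, hln, hlr, hlm⟩
    exact Or.inr ⟨hln, hN, (hN.nonempty_equiv_iff hp).2 h⟩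

theorem MetacyclicParams.properties (hp : p.Prime) (hP : MetacyclicParams n m l r)
    (h : HasMetacyclicPair p n m l r G) :
    IsPowerfullyNilpotent p G ∧ HasRankTwo G ∧ ¬ IsAbelian G := by
  obtain ⟨hr, hrn, hmr, hl⟩ := hP
  exact ⟨h.isPowerfullyNilpotent hp hr,
    h.hasRankTwo hp (by omega) (by omega) (by omega) (by omega),
    mt (h.isAbelian_iff hp).1 (by omega)⟩

theorem IsDirectAncestor.hasRankTwo_right {H : Type v} [Group H] (hp : p.Prime)
    (h : IsDirectAncestor p G H) (hG : HasRankTwo G) : HasRankTwo H ∧ IsSplitMetacyclic H := by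
  obtain ⟨n, m, l, r, ⟨hr, hrn, hmr, hl⟩, -, hH⟩ := h.exists_params hp hG
  exact ⟨hH.hasRankTwo hp (by omega) (by omega) (by omega) le_rfl, hH.isSplitMetacyclic hp⟩

/-- The direct ancestors of a group with parameters `(n₁, m₁, n₁, r₁)`. -/
theorem isDirectAncestor_iff_exists {H : Type v} [Group H] {n₁ m₁ r₁ : ℕ} (hp : p.Prime)
    (hr₁ : 2 ≤ r₁) (hn₁ : 1 ≤ n₁) (hm₁ : 1 ≤ m₁) (hH : HasMetacyclicPair p n₁ m₁ n₁ r₁ H) :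
    IsDirectAncestor p G H ↔ ∃ n m l r, MetacyclicParams n m l r ∧ HasMetacyclicPair p n m l r G ∧
      HasMetacyclicPair p (min (n - r + 1) l) (min m (n - r + 1)) (min (n - r + 1) l) r H := by
  constructor
  · intro h
    exact h.exists_params hp (h.hasRankTwo_left hp (hH.hasRankTwo hp (by omega) hm₁ hn₁ le_rfl))
  · rintro ⟨n, m, l, r, hP, hG, hH'⟩
    exact (hG.isDirectAncestor_iff hp hP rfl rfl).2 hH'

end

theorem mainTheorem4 (p : ℕ) (hp : p.Prime) :
    -- The groups in question, without repetition.
    ((∀ (G : Type u) [Group G],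
        (IsPowerfullyNilpotent p G ∧ HasRankTwo G ∧ ¬ IsAbelian G) ↔
          (∃ n m r, SplitParams n m r ∧ Nonempty (G ≃* SplitGroup p n m r)) ∨
          (∃ n m l r, NonsplitParams n m l r ∧ Nonempty (G ≃* NonsplitGroup p n m l r))) ∧
      (∀ n m r n' m' r', SplitParams n m r → SplitParams n' m' r' →
        Nonempty (SplitGroup p n m r ≃* SplitGroup p n' m' r') → n = n' ∧ m = m' ∧ r = r') ∧
      (∀ n m l r n' m' l' r', NonsplitParams n m l r → NonsplitParams n' m' l' r' →
        Nonempty (NonsplitGroup p n m l r ≃* NonsplitGroup p n' m' l' r') →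
        n = n' ∧ m = m' ∧ l = l' ∧ r = r') ∧
      (∀ n m l r, NonsplitParams n m l r → ¬ IsSplitMetacyclic (NonsplitGroup p n m l r)) ∧
      (∀ n m r, SplitParams n m r → IsSplitMetacyclic (SplitGroup p n m r))) ∧
    -- Direct descendants of the split groups: cases (a) and (b).
    (∀ n m r, SplitParams n m r →
      (n - r < m →
        IsDirectAncestor p (SplitGroup p n m r) (SplitGroup p (n - r + 1) (n - r + 1) r) ∧
        (IsAbelian (SplitGroup p (n - r + 1) (n - r + 1) r) ↔ n - r + 1 ≤ r)) ∧
      (m = n - r →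
        IsDirectAncestor p (SplitGroup p n m r) (SplitGroup p (n - r + 1) (n - r) r) ∧
        (IsAbelian (SplitGroup p (n - r + 1) (n - r) r) ↔ n - r + 1 ≤ r))) ∧
    -- Direct descendants of the non-split groups: cases (c) and (d).
    (∀ n m l r, NonsplitParams n m l r →
      (n - r < l →
        IsDirectAncestor p (NonsplitGroup p n m l r) (SplitGroup p (n - r + 1) (n - r + 1) r) ∧
        (IsAbelian (SplitGroup p (n - r + 1) (n - r + 1) r) ↔ n - r + 1 ≤ r)) ∧
      (n - r = l →
        IsDirectAncestor p (NonsplitGroup p n m l r) (SplitGroup p (n - r) (n - r + 1) r) ∧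
        ¬ IsAbelian (SplitGroup p (n - r) (n - r + 1) r))) ∧
    -- Every direct descendant is split; non-split groups have no direct ancestors.
    (∀ (G : Type u) [Group G] (H : Type u) [Group H], HasRankTwo G →
      IsDirectAncestor p G H → HasRankTwo H ∧ IsSplitMetacyclic H) ∧
    (∀ (H : Type u) [Group H], IsPowerfullyNilpotent p H → HasRankTwo H →
      ¬ IsSplitMetacyclic H → ¬ HasDirectAncestor p H) ∧
    (∀ n m l r, NonsplitParams n m l r →
      ∀ (G : Type u) [Group G], ¬ IsDirectAncestor p G (NonsplitGroup p n m l r)) ∧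
    -- The rank-2 groups that have direct ancestors, abelian and non-abelian.
    (∀ (H : Type u) [Group H], IsPowerfullyNilpotent p H → HasRankTwo H → IsAbelian H →
      (HasDirectAncestor p H ↔
        (∃ n, 2 ≤ n ∧ Nonempty (H ≃* AbelianA p n)) ∨
        (∃ n, 1 ≤ n ∧ Nonempty (H ≃* AbelianB p n)))) ∧
    (∀ (H : Type u) [Group H], IsPowerfullyNilpotent p H → HasRankTwo H → ¬ IsAbelian H →
      (HasDirectAncestor p H ↔
        (∃ n r, 3 ≤ n ∧ 2 ≤ r ∧ r ≤ n - 1 ∧ Nonempty (H ≃* SplitGroup p n n r)) ∨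
        (∃ n r, 2 ≤ n ∧ 2 ≤ r ∧ r ≤ n ∧ Nonempty (H ≃* SplitGroup p (n + 1) n r)) ∨
        (∃ n r, 3 ≤ n ∧ 2 ≤ r ∧ r ≤ n - 1 ∧ Nonempty (H ≃* SplitGroup p n (n + 1) r)))) ∧
    -- Direct ancestors of `A(n)` and of `B(n)`.
    (∀ n, 2 ≤ n → ∀ (G : Type u) [Group G], IsDirectAncestor p G (AbelianA p n) ↔
      (∃ m r, n ≤ r ∧ n ≤ m ∧ Nonempty (G ≃* SplitGroup p (n + r - 1) m r)) ∨
      (∃ m l r, n ≤ r ∧ r < l ∧ l ≤ r + (n - 2) ∧ l < m ∧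
        Nonempty (G ≃* NonsplitGroup p (n + r - 1) m l r))) ∧
    (∀ n, 1 ≤ n → ∀ (G : Type u) [Group G], IsDirectAncestor p G (AbelianB p n) ↔
      ∃ r, n + 1 ≤ r ∧ Nonempty (G ≃* SplitGroup p (n + r) n r)) ∧
    -- Direct ancestors of `C(n) = G(n,n,r)`, `D(n) = G(n+1,n,r)` and `E(n) = G(n,n+1,r)`.
    (∀ n r, 3 ≤ n → 2 ≤ r → r ≤ n - 1 → ∀ (G : Type u) [Group G],
      IsDirectAncestor p G (SplitGroup p n n r) ↔
        (∃ m, n ≤ m ∧ Nonempty (G ≃* SplitGroup p (n + r - 1) m r)) ∨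
        (∃ m l, n ≤ l ∧ l < m ∧ l ≤ r + n - 2 ∧
          Nonempty (G ≃* NonsplitGroup p (n + r - 1) m l r))) ∧
    (∀ n r, 2 ≤ n → 2 ≤ r → r ≤ n → ∀ (G : Type u) [Group G],
      IsDirectAncestor p G (SplitGroup p (n + 1) n r) ↔
        Nonempty (G ≃* SplitGroup p (n + r) n r)) ∧
    (∀ n r, 3 ≤ n → 2 ≤ r → r ≤ n - 1 → ∀ (G : Type u) [Group G],
      IsDirectAncestor p G (SplitGroup p n (n + 1) r) ↔
        ∃ m, n < m ∧ Nonempty (G ≃* NonsplitGroup p (n + r) m n r)) ∧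
    -- The rank-2 groups that have grandparents.
    (∀ (H : Type u) [Group H], IsPowerfullyNilpotent p H → HasRankTwo H →
      ((∃ (G : Type u) (_ : Group G), IsDirectAncestor p G H ∧ HasDirectAncestor p G) ↔
        (∃ n, 2 ≤ n ∧ Nonempty (H ≃* AbelianA p n)) ∨
        (∃ n r, 3 ≤ n ∧ 2 ≤ r ∧ r ≤ n - 1 ∧ Nonempty (H ≃* SplitGroup p n n r)))) ∧
    -- Infinite branches: each admissible pair gives one, and these are all, one for each pair.
    (∀ n r, 2 ≤ n → n ≤ r →
      IsDirectAncestor p (SplitGroup p (n + (r - 1)) (n + (r - 1)) r) (AbelianA p n) ∧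
      ∀ i, 1 ≤ i → IsDirectAncestor p
        (SplitGroup p (n + (i + 1) * (r - 1)) (n + (i + 1) * (r - 1)) r)
        (SplitGroup p (n + i * (r - 1)) (n + i * (r - 1)) r)) ∧
    (∀ (H : ℕ → Type u) [∀ i, Group (H i)], IsInfiniteBranch p H ↔
      ∃! q : ℕ × ℕ, 2 ≤ q.1 ∧ q.1 ≤ q.2 ∧ Nonempty (H 0 ≃* AbelianA p q.1) ∧
        ∀ i, 1 ≤ i → Nonempty (H i ≃*
          SplitGroup p (q.1 + i * (q.2 - 1)) (q.1 + i * (q.2 - 1)) q.2)) ∧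
    -- Infinite chains from an arbitrary first group: one for each pair `n, r ≥ 2`, with first
    -- group `⟨a, b | a^{p^n} = b^{p^n} = 1, [a,b] = a^{p^r}⟩`, which is `A(n)` iff `n ≤ r`.
    (∀ (H : ℕ → Type u) [∀ i, Group (H i)], IsInfiniteChain p H ↔
      ∃! q : ℕ × ℕ, 2 ≤ q.1 ∧ 2 ≤ q.2 ∧ ∀ i, Nonempty (H i ≃*
        SplitGroup p (q.1 + i * (q.2 - 1)) (q.1 + i * (q.2 - 1)) q.2)) ∧
    (∀ n r, 2 ≤ n → 2 ≤ r → (Nonempty (SplitGroup p n n r ≃* AbelianA p n) ↔ n ≤ r)) := by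
  refine ⟨⟨?_, ?_, ?_, ?_, ?_⟩, ?_, ?_, ?_, ?_, ?_, ?_, ?_, ?_, ?_, ?_, ?_, ?_, ?_, ?_, ?_, ?_, ?_⟩
  · intro G _
    constructor
    · rintro ⟨hG, hrank, hab⟩
      obtain ⟨n, m, l, r, hP, h⟩ := exists_metacyclicParams hp hG hrank hab
      rcases hP.split_or_nonsplit hp h with ⟨-, hS, e⟩ | ⟨-, hN, e⟩
      · exact Or.inl ⟨n, m, r, hS, e⟩
      · exact Or.inr ⟨n, m, l, r, hN, e⟩
    · rintro (⟨n, m, r, hS, e⟩ | ⟨n, m, l, r, hN, e⟩)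
      · exact hS.metacyclicParams.properties hp ((hS.nonempty_equiv_iff hp).1 e)
      · exact hN.metacyclicParams.properties hp ((hN.nonempty_equiv_iff hp).1 e)
  · intro n m r n' m' r' hP hP' e
    have := (hP.hasMetacyclicPair hp).params_unique hp ((hP'.nonempty_equiv_iff hp).1 e)
      hP.metacyclicParams hP'.metacyclicParams
    exact ⟨this.1, this.2.1, this.2.2.2⟩
  · intro n m l r n' m' l' r' hP hP' e
    exact (hP.hasMetacyclicPair hp).params_unique hp ((hP'.nonempty_equiv_iff hp).1 e)
      hP.metacyclicParams hP'.metacyclicParams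
  · intro n m l r hP
    exact (hP.hasMetacyclicPair hp).not_isSplitMetacyclic hp hP
  · intro n m r hP
    exact (hP.hasMetacyclicPair hp).isSplitMetacyclic hp
  · intro n m r hP
    have hM := hP.metacyclicParams
    have hG := hP.hasMetacyclicPair hp
    obtain ⟨h1, h2, h3⟩ := hP
    constructor
    · intro h
      have hD := hasMetacyclicPair_splitGroup (n := n - r + 1) (m := n - r + 1) hp h2 (by omega)
      exact ⟨(hG.isDirectAncestor_iff hp hM (by omega) (by omega)).2 hD, hD.isAbelian_iff hp⟩
    · intro h
      have hD := hasMetacyclicPair_splitGroup (n := n - r + 1) (m := n - r) hp h2 (by omega)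
      exact ⟨(hG.isDirectAncestor_iff hp hM (by omega) (by omega)).2 hD, hD.isAbelian_iff hp⟩
  · intro n m l r hP
    have hM := hP.metacyclicParams
    have hG := hP.hasMetacyclicPair hp
    obtain ⟨h1, h2, h3, h4, h5⟩ := hP
    constructor
    · intro h
      have hD := hasMetacyclicPair_splitGroup (n := n - r + 1) (m := n - r + 1) hp h1 (by omega)
      exact ⟨(hG.isDirectAncestor_iff hp hM (by omega) (by omega)).2 hD, hD.isAbelian_iff hp⟩
    · intro h
      have hD := hasMetacyclicPair_splitGroup (n := n - r) (m := n - r + 1) hp h1 (by omega)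
      exact ⟨(hG.isDirectAncestor_iff hp hM (by omega) (by omega)).2 hD,
        mt (hD.isAbelian_iff hp).1 (by omega)⟩
  · intro G _ H _ hG h
    exact h.hasRankTwo_right hp hG
  · rintro H _ - hH hsplit ⟨G, _, h⟩
    exact hsplit (h.hasRankTwo_right hp (h.hasRankTwo_left hp hH)).2
  · intro n m l r hP G _ h
    have hN := hP.hasMetacyclicPair hp
    exact hN.not_isSplitMetacyclic hp hP (h.hasRankTwo_right hp
      (h.hasRankTwo_left hp (hP.metacyclicParams.properties hp hN).2.1)).2
  · intro H _ _ hH hab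
    rw [hasDirectAncestor_iff hp hH]
    constructor
    · rintro ⟨k, r, hr, ⟨hk, h⟩ | ⟨hk, h⟩ | ⟨hk, h⟩⟩
      · exact Or.inl ⟨k, hk, (nonempty_equiv_abelianA_iff hp ((h.isAbelian_iff hp).1 hab)).2 h⟩
      · exact Or.inr ⟨k, hk, (nonempty_equiv_abelianB_iff hp ((h.isAbelian_iff hp).1 hab)).2 h⟩
      · have := (h.isAbelian_iff hp).1 hab
        omega
    · rintro (⟨n, hn, e⟩ | ⟨n, hn, e⟩)
      · exact ⟨n, n, hn, Or.inl ⟨hn, (nonempty_equiv_abelianA_iff hp le_rfl).1 e⟩⟩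
      · exact ⟨n, n + 1, by omega,
          Or.inr (Or.inl ⟨hn, (nonempty_equiv_abelianB_iff hp le_rfl).1 e⟩)⟩
  · intro H _ _ hH hab
    rw [hasDirectAncestor_iff hp hH]
    constructor
    · rintro ⟨k, r, hr, ⟨hk, h⟩ | ⟨hk, h⟩ | ⟨hk, h⟩⟩
      · have := mt (h.isAbelian_iff hp).2 hab
        exact Or.inl ⟨k, r, by omega, hr, by omega,
          (nonempty_equiv_splitGroup_iff hp hr (by omega)).2 h⟩
      · have := mt (h.isAbelian_iff hp).2 hab
        exact Or.inr (Or.inl ⟨k, r, by omega, hr, by omega,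
          (nonempty_equiv_splitGroup_iff hp hr (by omega)).2 h⟩)
      · exact Or.inr (Or.inr ⟨k, r, by omega, hr, by omega,
          (nonempty_equiv_splitGroup_iff hp hr (by omega)).2 h⟩)
    · rintro (⟨n, r, hn, hr, hrn, e⟩ | ⟨n, r, hn, hr, hrn, e⟩ | ⟨n, r, hn, hr, hrn, e⟩)
      · exact ⟨n, r, hr, Or.inl ⟨by omega,
          (nonempty_equiv_splitGroup_iff hp hr (by omega)).1 e⟩⟩
      · exact ⟨n, r, hr, Or.inr (Or.inl ⟨by omega,
          (nonempty_equiv_splitGroup_iff hp hr (by omega)).1 e⟩)⟩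
      · exact ⟨n, r, hr, Or.inr (Or.inr ⟨by omega,
          (nonempty_equiv_splitGroup_iff hp hr (by omega)).1 e⟩)⟩
  · intro n hn G _
    have hA : ∀ r, n ≤ r → HasMetacyclicPair p n n n r (AbelianA p n) := fun r hr =>
      hasMetacyclicPair_zmod_prod hp hr
    constructor
    · intro h
      obtain ⟨n', m', l', r', hP, hG, hH⟩ :=
        (isDirectAncestor_iff_exists hp hn (by omega) (by omega) (hA n le_rfl)).1 h
      have hsplit := hP.split_or_nonsplit hp hG
      obtain ⟨hr', hrn', hmr', hl'⟩ := hP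
      have h1 := (hH.isAbelian_iff hp).1 (((hA n le_rfl).isAbelian_iff hp).2 le_rfl)
      have h2 := hH.invariants hp (hA n le_rfl) (by omega) (by omega) le_rfl le_rfl (by omega)
        (by omega)
      rcases hsplit with ⟨-, hS, e⟩ | ⟨hln, hN, e⟩
      · refine Or.inl ⟨m', r', by omega, by omega, ?_⟩
        rwa [show n + r' - 1 = n' by omega]
      · have h3 := hN.2.1
        refine Or.inr ⟨m', l', r', by omega, by omega, by omega, by omega, ?_⟩
        rwa [show n + r' - 1 = n' by omega]
    · rintro (⟨m, r, hr, hm, e⟩ | ⟨m, l, r, hr, hrl, hlr, hlm, e⟩)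
      · have hS : SplitParams (n + r - 1) m r := ⟨by omega, by omega, by omega⟩
        exact (((hS.nonempty_equiv_iff hp).1 e).isDirectAncestor_iff hp hS.metacyclicParams
          (by omega) (by omega)).2 (hA r hr)
      · have hN : NonsplitParams (n + r - 1) m l r :=
          ⟨by omega, by omega, by omega, by omega, by omega⟩
        exact (((hN.nonempty_equiv_iff hp).1 e).isDirectAncestor_iff hp hN.metacyclicParams
          (by omega) (by omega)).2 (hA r hr)
  · intro n hn G _
    have hB : ∀ r, n + 1 ≤ r → HasMetacyclicPair p (n + 1) n (n + 1) r (AbelianB p n) :=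
      fun r hr => hasMetacyclicPair_zmod_prod hp hr
    constructor
    · intro h
      obtain ⟨n', m', l', r', hP, hG, hH⟩ :=
        (isDirectAncestor_iff_exists hp (by omega) (by omega) (by omega) (hB (n + 1) le_rfl)).1 h
      have hsplit := hP.split_or_nonsplit hp hG
      obtain ⟨hr', hrn', hmr', hl'⟩ := hP
      have h1 := (hH.isAbelian_iff hp).1 (((hB (n + 1) le_rfl).isAbelian_iff hp).2 le_rfl)
      have h2 := hH.invariants hp (hB (n + 1) le_rfl) (by omega) (by omega) le_rfl le_rfl (by omega)
        (by omega)
      rcases hsplit with ⟨-, hS, e⟩ | ⟨hln, hN, e⟩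
      · refine ⟨r', by omega, ?_⟩
        rwa [show n + r' = n' by omega, show n = m' by omega]
      · have h3 := hN.2.1
        omega
    · rintro ⟨r, hr, e⟩
      have hS : SplitParams (n + r) n r := ⟨by omega, by omega, by omega⟩
      exact (((hS.nonempty_equiv_iff hp).1 e).isDirectAncestor_iff hp hS.metacyclicParams
        (by omega) (by omega)).2 (hB r hr)
  · intro n r hn hr hrn G _
    have hC := hasMetacyclicPair_splitGroup (n := n) (m := n) hp hr (by omega)
    constructor
    · intro h
      obtain ⟨n', m', l', r', hP, hG, hH⟩ :=
        (isDirectAncestor_iff_exists hp hr (by omega) (by omega) hC).1 h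
      have hsplit := hP.split_or_nonsplit hp hG
      obtain ⟨hr', hrn', hmr', hl'⟩ := hP
      have h1 := mt (hH.isAbelian_iff hp).2 (mt (hC.isAbelian_iff hp).1 (by omega))
      have h2 := hH.params_unique hp hC ⟨by omega, by omega, by omega, Or.inl rfl⟩
        ⟨by omega, by omega, by omega, Or.inl rfl⟩
      obtain rfl : r' = r := h2.2.2.2
      rcases hsplit with ⟨-, hS, e⟩ | ⟨hln, hN, e⟩
      · refine Or.inl ⟨m', by omega, ?_⟩
        rwa [show n + r' - 1 = n' by omega]
      · refine Or.inr ⟨m', l', by omega, by omega, by omega, ?_⟩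
        rwa [show n + r' - 1 = n' by omega]
    · rintro (⟨m, hm, e⟩ | ⟨m, l, hnl, hlm, hlr, e⟩)
      · have hS : SplitParams (n + r - 1) m r := ⟨by omega, by omega, by omega⟩
        exact (((hS.nonempty_equiv_iff hp).1 e).isDirectAncestor_iff hp hS.metacyclicParams
          (by omega) (by omega)).2 hC
      · have hN : NonsplitParams (n + r - 1) m l r :=
          ⟨by omega, by omega, by omega, by omega, by omega⟩
        exact (((hN.nonempty_equiv_iff hp).1 e).isDirectAncestor_iff hp hN.metacyclicParams
          (by omega) (by omega)).2 hC
  · intro n r hn hr hrn G _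
    have hD := hasMetacyclicPair_splitGroup (n := n + 1) (m := n) hp hr (by omega)
    constructor
    · intro h
      obtain ⟨n', m', l', r', hP, hG, hH⟩ :=
        (isDirectAncestor_iff_exists hp hr (by omega) (by omega) hD).1 h
      have hsplit := hP.split_or_nonsplit hp hG
      obtain ⟨hr', hrn', hmr', hl'⟩ := hP
      have h1 := mt (hH.isAbelian_iff hp).2 (mt (hD.isAbelian_iff hp).1 (by omega))
      have h2 := hH.params_unique hp hD ⟨by omega, by omega, by omega, Or.inl rfl⟩
        ⟨by omega, by omega, by omega, Or.inl rfl⟩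
      obtain rfl : r' = r := h2.2.2.2
      rcases hsplit with ⟨-, hS, e⟩ | ⟨hln, hN, e⟩
      · rwa [show n + r' = n' by omega, show n = m' by omega]
      -- A non-split ancestor would need `m' = n` and `l' ≥ n + 1`, against `l' < m'`.
      · omega
    · intro e
      have hS : SplitParams (n + r) n r := ⟨by omega, by omega, by omega⟩
      exact (((hS.nonempty_equiv_iff hp).1 e).isDirectAncestor_iff hp hS.metacyclicParams
        (by omega) (by omega)).2 hD
  · intro n r hn hr hrn G _
    have hE := hasMetacyclicPair_splitGroup (n := n) (m := n + 1) hp hr (by omega)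
    constructor
    · intro h
      obtain ⟨n', m', l', r', hP, hG, hH⟩ :=
        (isDirectAncestor_iff_exists hp hr (by omega) (by omega) hE).1 h
      have hsplit := hP.split_or_nonsplit hp hG
      obtain ⟨hr', hrn', hmr', hl'⟩ := hP
      have h1 := mt (hH.isAbelian_iff hp).2 (mt (hE.isAbelian_iff hp).1 (by omega))
      have h2 := hH.params_unique hp hE ⟨by omega, by omega, by omega, Or.inl rfl⟩
        ⟨by omega, by omega, by omega, Or.inl rfl⟩
      obtain rfl : r' = r := h2.2.2.2
      rcases hsplit with ⟨hln, hS, e⟩ | ⟨hln, hN, e⟩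
      · omega
      · refine ⟨m', by omega, ?_⟩
        rwa [show n + r' = n' by omega, show n = l' by omega]
    · rintro ⟨m, hm, e⟩
      have hN : NonsplitParams (n + r) m n r := ⟨by omega, by omega, by omega, by omega, by omega⟩
      exact (((hN.nonempty_equiv_iff hp).1 e).isDirectAncestor_iff hp hN.metacyclicParams
        (by omega) (by omega)).2 hE
  · intro H _ _ hH
    rw [exists_grandparent_iff hp hH]
    constructor
    · rintro ⟨k, r, hr, hk, h⟩
      rcases le_or_gt k r with hkr | hkr
      · exact Or.inl ⟨k, hk, (nonempty_equiv_abelianA_iff hp hkr).2 h⟩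
      · exact Or.inr ⟨k, r, by omega, hr, by omega,
          (nonempty_equiv_splitGroup_iff hp hr (by omega)).2 h⟩
    · rintro (⟨n, hn, e⟩ | ⟨n, r, hn, hr, hrn, e⟩)
      · exact ⟨n, n, hn, hn, (nonempty_equiv_abelianA_iff hp le_rfl).1 e⟩
      · exact ⟨n, r, hr, by omega, (nonempty_equiv_splitGroup_iff hp hr (by omega)).1 e⟩
  · intro n r hn hr
    constructor
    · have hS : SplitParams (n + (r - 1)) (n + (r - 1)) r := ⟨by omega, by omega, by omega⟩
      exact ((hS.hasMetacyclicPair hp).isDirectAncestor_iff hp hS.metacyclicParams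
        (by omega) (by omega)).2 (hasMetacyclicPair_zmod_prod hp hr)
    · intro i hi
      have hmul : (i + 1) * (r - 1) = i * (r - 1) + (r - 1) := by rw [add_mul, one_mul]
      have hS : SplitParams (n + (i + 1) * (r - 1)) (n + (i + 1) * (r - 1)) r :=
        ⟨by omega, by omega, by omega⟩
      exact ((hS.hasMetacyclicPair hp).isDirectAncestor_iff hp hS.metacyclicParams
        (by omega) (by omega)).2 (hasMetacyclicPair_splitGroup hp (by omega) (by omega))
  · intro H _
    have key : ∀ q : ℕ × ℕ, (2 ≤ q.1 ∧ q.1 ≤ q.2 ∧ Nonempty (H 0 ≃* AbelianA p q.1) ∧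
        ∀ i, 1 ≤ i → Nonempty (H i ≃*
          SplitGroup p (q.1 + i * (q.2 - 1)) (q.1 + i * (q.2 - 1)) q.2)) ↔
        (2 ≤ q.1 ∧ q.1 ≤ q.2 ∧ ∀ i, HasMetacyclicPair p (q.1 + i * (q.2 - 1))
          (q.1 + i * (q.2 - 1)) (q.1 + i * (q.2 - 1)) q.2 (H i)) := by
      rintro ⟨n, r⟩
      refine and_congr_right fun hn => and_congr_right fun hr => ?_
      simp only at hn hr ⊢
      constructor
      · rintro ⟨h0, hi⟩ i
        rcases Nat.eq_zero_or_pos i with rfl | hpos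
        · simpa using (nonempty_equiv_abelianA_iff hp hr).1 h0
        · exact (nonempty_equiv_splitGroup_iff hp (by omega) (by omega)).1 (hi i hpos)
      · intro h
        refine ⟨(nonempty_equiv_abelianA_iff hp hr).2 (by simpa using h 0), fun i _ => ?_⟩
        exact (nonempty_equiv_splitGroup_iff hp (by omega) (by omega)).2 (h i)
    simp only [key]
    constructor
    · intro h
      obtain ⟨n, r, hn, hr, hi⟩ := h.toIsInfiniteChain.exists_params hp
      have hab : IsAbelian (H 0) := by
        by_contra hab
        -- A non-abelian `H 0` would have the direct descendant `H 0 / Z(H 0)^p`, so a root is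
        -- abelian.
        exact h.root _ (isDirectAncestor_quotient hp (h.step 0).right (h.rank_two 0) hab)
      have hnr : n ≤ r := by simpa using ((hi 0).isAbelian_iff hp).1 hab
      refine ⟨(n, r), ⟨hn, hnr, hi⟩, ?_⟩
      rintro ⟨n', r'⟩ ⟨hn', hr', hi'⟩
      simp only at hn' hr' hi'
      have := params_unique_of_chain hp (by omega) hr hi' hi
      rw [this.1, this.2]
    · rintro ⟨⟨n, r⟩, ⟨hn, hr, hi⟩, -⟩
      simp only at hn hr hi
      refine ⟨isInfiniteChain_of_params hp hn (by omega) hi, fun K _ hK => hK.not_abelian ?_⟩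
      exact ((hi 0).isAbelian_iff hp).2 (by omega)
  · intro H _
    have key : ∀ q : ℕ × ℕ, (2 ≤ q.1 ∧ 2 ≤ q.2 ∧ ∀ i, Nonempty (H i ≃*
          SplitGroup p (q.1 + i * (q.2 - 1)) (q.1 + i * (q.2 - 1)) q.2)) ↔
        (2 ≤ q.1 ∧ 2 ≤ q.2 ∧ ∀ i, HasMetacyclicPair p (q.1 + i * (q.2 - 1))
          (q.1 + i * (q.2 - 1)) (q.1 + i * (q.2 - 1)) q.2 (H i)) := fun q =>
      and_congr_right fun _ => and_congr_right fun hr => forall_congr' fun i =>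
        nonempty_equiv_splitGroup_iff hp hr (by omega)
    simp only [key]
    constructor
    · intro h
      obtain ⟨n, r, hn, hr, hi⟩ := h.exists_params hp
      refine ⟨(n, r), ⟨hn, hr, hi⟩, ?_⟩
      rintro ⟨n', r'⟩ ⟨-, hr', hi'⟩
      simp only at hr' hi'
      have := params_unique_of_chain hp hr' hr hi' hi
      rw [this.1, this.2]
    · rintro ⟨⟨n, r⟩, ⟨hn, hr, hi⟩, -⟩
      exact isInfiniteChain_of_params hp hn hr hi
  · intro n r _ hr
    have hS := hasMetacyclicPair_splitGroup (n := n) (m := n) hp hr (by omega)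
    refine ⟨fun ⟨e⟩ => (hS.isAbelian_iff hp).1 ?_, fun h =>
      (nonempty_equiv_abelianA_iff hp h).2 hS⟩
    have hA := hasMetacyclicPair_zmod_prod (m := n) hp (le_refl n)
    exact ((hA.isAbelian_iff hp).2 le_rfl).of_equiv e.symm
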